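/- Write $\log x=\lceil\log_2 x\rceil$ and let $\oplus$ be bitwise addition mod 2. **Tools.** (i) A *fingerprint scheme* has integer constants $C_s,C_h\ge 1$ and, for all $\ell\ge1$, $p\in(0,1)$, tags $t_s(m)\in\{0,1\}^{C_h\log(1/p)}$ of strings $m$, for seeds $s\in\{0,1\}^{C_s\log(\ell/p)}$, such that $\Pr_s[t_s(m)=t_s(m')]\le p$ for any distinct $m,m'$ of length at most $\ell$; the fingerprint of $m$ is $(s,t_s(m))$. (ii) An *AMD code* has an integer constant $C_a\ge1$ and, for all $x\ge1$, $\eta\in(0,1)$, a randomized encoding of $x$-bit strings into strings of $x+C_a\log(x/\eta)$ bits, with a decoder that inverts it, such that for every message $m$ and every fixed $t\neq0$ the string $\mathrm{enc}(m)\oplus t$ is a codeword (an encoding of some message) with probability at most $\eta$. (iii) An *error-correcting code* has constants $C_e\ge 1$ (an integer) and $\rho>0$ and, for every $k$, a linear encoding $\{0,1\}^k\to\{0,1\}^{C_ek}$ with a decoder such that $\mathrm{dec}(\mathrm{enc}(m)\oplus t)=m$ if $t$ has at most $\rho C_ek$ ones, and $\mathrm{dec}(\mathrm{enc}(m)\oplus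 t)=m\oplus\mathrm{dec}(t)$ for all $t$. **Channel.** In each step a bit may be sent. The adversary knows the protocol and Alice's message but neither the players' coins nor the bits on the channel: it fixes beforehand a finite set of steps and a bit for every step. A bit that is sent is flipped exactly in the chosen steps. In the first step of a period in which nobody sends, the bit received is the adversary's bit for that step, free of charge; in each later step of the period the previous received bit is repeated, except that it changes in the chosen steps. $T$ is the number of bit changes that actually occur in the execution, the free ones not counted. **Protocol.** Let $L\ge2$, $q=2^{\log L}$, $d=\lceil L/\log q\rceil-1$, $\eta_j=2^{-\lfloor j/d\rfloor}\delta/(6d)$ and $b_j=C\log(L/\eta_j)$, where $C=C_e\kappa$, $\kappa=\max\{71,\,a+C_a(a+2)\}$, $a=C_s+C_h+2$. Both players know $L$ and $\delta$. Alice encodes her $L$-bit message $M$ as the coefficients of a polynomial $P_a$ of degree at most $d$ over $GF(q)$ and sends $P_a$ at the first $d+1$ field elements in plain. Then rounds $j=1,2,\dots$ follow, each of four slots of $b_j$ steps; in slots 1, 2 and 4 a message is padded with zeros to $\kappa\log(L/\eta_j)$ bits and then encoded by the error-correcting code. 1. From all evaluations received, Bob takes the majority value at each field element for which he has received one, and lets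 $P_b$ be a polynomial of degree at most $d$ through the largest number of these points. He sends the AMD encoding (strength $\eta_j$) of the fingerprint (with a fresh seed, $\ell=L$, $p=\eta_j$) of the message represented by $P_b$. 2. If what Alice decodes is a padded AMD codeword of a fingerprint of $M$ (with the seed that it contains), she sends it back; otherwise she sends $b_j$ zeros. If Bob decodes what he sent in slot 1, he terminates and outputs the message represented by $P_b$. 3. Bob, if he has not terminated, sends $b_j$ uniformly random bits. If the string Alice receives has fewer than $b_j/3$ bit alternations, she terminates. 4. Otherwise she sends the AMD encoding (strength $\eta_j$) of the values of $P_a$ at the next two field elements, in cyclic order. **Theorem.** Fingerprint schemes, AMD codes and error-correcting codes as above exist. For any choice of the three tools there is a constant $K>0$, depending only on them, such that the following holds for all $L\ge2$, all $\delta\in(0,1)$, every message $M\in\{0,1\}^L$, every adversary, every ordering and binary representation of the field elements, and every way of breaking ties. With probability at least $1-\delta$ over the players' independent fair coins, both players terminate, Bob not after Alice, and Bob outputs $M$. Moreover, in every execution in which both players terminate, Bob not after Alice (whatever Bob outputs), the total number of bits sent is at most $$L+K\left(T+\min\left(T+1,\frac{L}{\log L}\right)\log\frac{L}{\delta}\right).$$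 -/

import Mathlib

open MeasureTheory ProbabilityTheory

namespace UnknownNoise

/-! ### Bits and bit strings -/

/-- A bit.  Addition in `ZMod 2` is exclusive or. -/
abbrev Bit : Type := ZMod 2

/-- Bit strings of length `n`; addition is bitwise exclusive or. -/
abbrev Bits (n : ℕ) : Type := Fin n → Bit

/-- The integer `⌈log₂ x⌉`. -/
noncomputable def clog2 (x : ℝ) : ℕ := ⌈Real.logb 2 x⌉₊

/-- The bit at position `i`, with the value `0` outside the string. -/
def bitAt {n : ℕ} (v : Bits n) (i : ℕ) : Bit := if h : i < n then v ⟨i, h⟩ else 0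

/-- Pad with zeros (or cut) to length `n`. -/
def resize {m : ℕ} (n : ℕ) (v : Bits m) : Bits n := fun i => bitAt v i

/-- The number of bit alternations of a string: positions `i` with `s i ≠ s (i + 1)`. -/
def alternations {n : ℕ} (s : Bits n) : ℕ :=
  ((Finset.range (n - 1)).filter (fun i => bitAt s i ≠ bitAt s (i + 1))).card

/-- A string is read as silence iff it has fewer than (its length) / 3 bit alternations. -/
def IsSilence {n : ℕ} (s : Bits n) : Prop := 3 * alternations s < n

/-- The uniform probability measure on a finite type. -/
noncomputable def uniform (α : Type) [MeasurableSpace α] : Measure α := uniformOn Set.univ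

/-! ### The three coding tools -/

/-- A family of fingerprint functions: for `ℓ ≥ 1` and `0 < p < 1`, a uniformly random seed of
`Cs * ⌈log₂ (ℓ / p)⌉` bits, a tag of `Ch * ⌈log₂ (1 / p)⌉` bits, and collision probability at
most `p` for any two distinct strings of length at most `ℓ`. -/
structure FingerprintScheme where
  Cs : ℕ
  Ch : ℕ
  Cs_pos : 0 < Cs
  Ch_pos : 0 < Ch
  tag : (ℓ : ℕ) → (p : ℝ) → Bits (Cs * clog2 (ℓ / p)) → List Bit → Bits (Ch * clog2 (1 / p))
  collision : ∀ (ℓ : ℕ) (p : ℝ), 0 < ℓ → 0 < p → p < 1 → ∀ m m' : List Bit,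
    m.length ≤ ℓ → m'.length ≤ ℓ → m ≠ m' →
      uniform (Bits (Cs * clog2 (ℓ / p))) {s | tag ℓ p s m = tag ℓ p s m'} ≤ ENNReal.ofReal p

/-- The fingerprint `(s, f)` of the string `m`, with seed `s` and tag `f`. -/
noncomputable def FingerprintScheme.fp (F : FingerprintScheme) (ℓ : ℕ) (p : ℝ)
    (s : Bits (F.Cs * clog2 (ℓ / p))) (m : List Bit) :
    Bits (F.Cs * clog2 (ℓ / p) + F.Ch * clog2 (1 / p)) :=
  Fin.append s (F.tag ℓ p s m)

/-- A family of algebraic manipulation detection codes.  The encoding of an `x`-bit message with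
strength `η` is randomized, its coins being the last argument of `enc`, and it has
`x + Ca * ⌈log₂ (x / η)⌉` bits.  A fixed nonzero shift of the encoding is again a codeword with
probability at most `η`. -/
structure AMDCode where
  Ca : ℕ
  Ca_pos : 0 < Ca
  coins : ℕ → ℝ → ℕ
  enc : (x : ℕ) → (η : ℝ) → Bits x → Bits (coins x η) → Bits (x + Ca * clog2 (x / η))
  dec : (x : ℕ) → (η : ℝ) → Bits (x + Ca * clog2 (x / η)) → Bits x
  dec_enc : ∀ (x : ℕ) (η : ℝ), 0 < x → 0 < η → η < 1 → ∀ m r, dec x η (enc x η m r) = m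
  detect : ∀ (x : ℕ) (η : ℝ), 0 < x → 0 < η → η < 1 → ∀ (m : Bits x)
    (t : Bits (x + Ca * clog2 (x / η))), t ≠ 0 →
      uniform (Bits (coins x η)) {r | ∃ m' r', enc x η m' r' = enc x η m r + t}
        ≤ ENNReal.ofReal η

/-- `c` is the encoding of some message, for some outcome of the coins. -/
def AMDCode.IsCodeword (A : AMDCode) {x : ℕ} {η : ℝ} (c : Bits (x + A.Ca * clog2 (x / η))) :
    Prop :=
  ∃ m r, A.enc x η m r = c

/-- A family of binary linear codes of constant rate `1 / Ce` that correct a constant fraction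
`ρ` of errors, with a decoder that commutes with shifts of a codeword (as syndrome decoding
does). -/
structure ErrorCorrectingCode where
  Ce : ℕ
  Ce_pos : 0 < Ce
  ρ : ℝ
  ρ_pos : 0 < ρ
  enc : (k : ℕ) → Bits k → Bits (Ce * k)
  dec : (k : ℕ) → Bits (Ce * k) → Bits k
  enc_add : ∀ k m m', enc k (m + m') = enc k m + enc k m'
  dec_correct : ∀ k m t, (hammingNorm t : ℝ) ≤ ρ * (Ce * k : ℕ) → dec k (enc k m + t) = m
  dec_shift : ∀ k m t, dec k (enc k m + t) = m + dec k t

/-! ### Polynomials that encode messages -/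

/-- `log q = ⌈log₂ L⌉`, the number of bits of a field element. -/
def logq (L : ℕ) : ℕ := Nat.clog 2 L

/-- `d = ⌈L / log q⌉ - 1`. -/
def deg (L : ℕ) : ℕ := (L + logq L - 1) / logq L - 1

/-- The field with `q = 2 ^ ⌈log₂ L⌉` elements. -/
abbrev GF (L : ℕ) : Type := GaloisField 2 (logq L)

/-- Polynomials of degree at most `d` over `GF(q)`. -/
abbrev Poly (L : ℕ) : Type := Polynomial.degreeLT (GF L) (deg L + 1)

/-- The number of points of `S` on the graph of `P`. -/
noncomputable def support {L : ℕ} (S : Finset (GF L × GF L)) (P : Poly L) : ℕ :=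
  {z ∈ (S : Set (GF L × GF L)) | (P : Polynomial (GF L)).eval z.1 = z.2}.ncard

open Classical in
/-- The choices that are arbitrary but fixed and known to both players: how a field element is
written in bits, the order of the field elements, and the breaking of ties in the majority vote
and in the reconstruction of a polynomial. -/
structure Conventions (L : ℕ) where
  rep : GF L ≃ Bits (logq L)
  point : Fin (2 ^ logq L) ≃ GF L
  /-- `winner B x` is a value that occurs most often in `B` together with `x`. -/
  winner : Multiset (GF L × GF L) → GF L → GF L
  winner_spec : ∀ (B : Multiset (GF L × GF L)) (x y : GF L), B.count (x, y) ≤ B.count (x, winner B x)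
  /-- A polynomial of degree at most `d` that is supported by the largest number of points. -/
  getPoly : Finset (GF L × GF L) → Poly L
  getPoly_spec : ∀ S Q, support S Q ≤ support S (getPoly S)

theorem Conventions.nonempty {L : ℕ} (hL : 2 ≤ L) : Nonempty (Conventions L) := by
  classical
  have hk : logq L ≠ 0 := (Nat.clog_pos (by norm_num) hL).ne'
  have hc : Nat.card (GF L) = 2 ^ logq L := GaloisField.card 2 _ hk
  have : Finite (GF L) := Nat.finite_of_card_ne_zero (by rw [hc]; positivity)
  have : Finite (Poly L) :=
    Finite.of_equiv _ (Polynomial.degreeLTEquiv (GF L) (deg L + 1)).symm.toEquiv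
  have e1 : Nonempty (GF L ≃ Bits (logq L)) :=
    Finite.card_eq.mp (by rw [hc]; simp)
  have e2 : Nonempty (Fin (2 ^ logq L) ≃ GF L) :=
    Finite.card_eq.mp (by rw [hc]; simp)
  choose w hw using fun (B : Multiset (GF L × GF L)) (x : GF L) =>
    Finite.exists_max (fun y => B.count (x, y))
  choose g hg using fun S : Finset (GF L × GF L) => Finite.exists_max (fun P => support S P)
  exact ⟨⟨e1.some, e2.some, w, fun B x y => by convert hw B x y, g, hg⟩⟩

section Encoding

variable {L : ℕ} (c : Conventions L)

/-- The field elements in order, cyclically. -/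
def Conventions.nth (n : ℕ) : GF L :=
  c.point ⟨n % 2 ^ logq L, Nat.mod_lt _ (by positivity)⟩

/-- The polynomial whose coefficients are the successive `log q`-bit blocks of the message (the
last block being completed by zeros). -/
noncomputable def Conventions.encode (M : Bits L) : Poly L :=
  (Polynomial.degreeLTEquiv (GF L) (deg L + 1)).symm
    (fun i => c.rep.symm (fun a => bitAt M (i * logq L + a)))

/-- The message that is read off the coefficients of a polynomial. -/
noncomputable def Conventions.messageOf (P : Poly L) : Bits L :=
  fun t => bitAt (c.rep ((P : Polynomial (GF L)).coeff (t / logq L))) (t % logq L)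

/-- The evaluation of `P` at the `n`-th field element, in bits. -/
noncomputable def Conventions.evalBits (P : Poly L) (n : ℕ) : Bits (logq L) :=
  c.rep ((P : Polynomial (GF L)).eval (c.nth n))

open Classical in
/-- The majority tuples `(x, z)`, one for every `x` that occurs in `B`. -/
noncomputable def Conventions.maj (B : Multiset (GF L × GF L)) : Finset (GF L × GF L) :=
  (B.map Prod.fst).toFinset.image (fun x => (x, c.winner B x))

end Encoding

/-! ### The channel -/

/-- A player as a function of the bits received so far and of the time `t`: `some b` means that
the bit `b` is sent in step `t`, and `none` that nothing is sent. -/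
abbrev Party : Type := (ℕ → Bit) → ℕ → Option Bit

/-- An adversary that does not see the channel: the finite set of steps in which it changes a
bit, and the bits to which it sets the channel, for free, when a silent period begins. -/
structure Adversary where
  flips : Finset ℕ
  free : ℕ → Bit

/-- The first `t` entries of `y`, followed by zeros. -/
def before (y : ℕ → Bit) (t : ℕ) : ℕ → Bit := fun i => if i < t then y i else 0

/-- What is sent in step `t` if the channel delivers `y`; it depends on what was delivered before
step `t` only.  (The protocol below never lets both players send in the same step.) -/
def sent (A B : Party) (y : ℕ → Bit) (t : ℕ) : Option Bit :=
  (A (before y t) t).or (B (before y t) t)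

/-- The bit `e t` by which the adversary changes step `t`. -/
def Adversary.flip (adv : Adversary) (t : ℕ) : Bit := if t ∈ adv.flips then 1 else 0

/-- The bits delivered in the first `t` steps.  A bit that is sent is delivered with the
adversary's change.  In the first step of a silent period the adversary chooses the bit; in every
later step the previous bit is repeated, up to the adversary's change. -/
def transcript (A B : Party) (adv : Adversary) : ℕ → (ℕ → Bit)
  | 0 => fun _ => 0
  | t + 1 =>
    let y := transcript A B adv t
    Function.update y t
      (match sent A B y t with
        | some b => b + adv.flip t
        | none =>
          if 0 < t ∧ sent A B y (t - 1) = none then y (t - 1) + adv.flip t else adv.free t)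

/-- The bit delivered in step `t`. -/
def received (A B : Party) (adv : Adversary) (t : ℕ) : Bit := transcript A B adv (t + 1) t

open Classical in
/-- The number `T` of bit flips of an execution.  A change in the first step of a silent period
is not charged (and has no effect). -/
noncomputable def flipCount (A B : Party) (adv : Adversary) : ℕ :=
  (adv.flips.filter (fun t => sent A B (received A B adv) t ≠ none ∨
    (0 < t ∧ sent A B (received A B adv) (t - 1) = none))).card

/-- The steps in which a player sends a bit, when the channel delivers `y`. -/
def sendSteps (A : Party) (y : ℕ → Bit) : Set ℕ := {t | A (before y t) t ≠ none}

/-- The number of bits sent by both players together (infinite if they send forever). -/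
noncomputable def bitsSent (A B : Party) (adv : Adversary) : ℕ∞ :=
  (sendSteps A (received A B adv)).encard + (sendSteps B (received A B adv)).encard

/-! ### The protocol -/

/-- The public data of the protocol: the tools, the length, the error parameter, the
conventions. -/
structure Setup where
  F : FingerprintScheme
  A : AMDCode
  E : ErrorCorrectingCode
  L : ℕ
  δ : ℝ
  conv : Conventions L

namespace Setup

variable (S : Setup)

/-- The strength `η_j` of round `j`. -/
noncomputable def η (j : ℕ) : ℝ := (1 / 2) ^ (j / deg S.L) * S.δ / (6 * deg S.L)

/-- The constant `κ`: every message of round `j` fits into `κ * ⌈log₂ (L / η_j)⌉` bits before the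
error-correcting code is applied. -/
def κ : ℕ :=
  max 71 ((S.F.Cs + S.F.Ch + 2) + S.A.Ca * ((S.F.Cs + S.F.Ch + 2) + 2))

/-- The common length of the messages of round `j` before error correction. -/
noncomputable def w (j : ℕ) : ℕ := S.κ * clog2 (S.L / S.η j)

/-- The length `b_j = C * ⌈log₂ (L / η_j)⌉`, with `C = Ce * κ`, of each message of round `j`. -/
noncomputable def b (j : ℕ) : ℕ := S.E.Ce * S.w j

/-- The length of the seed of round `j`. -/
noncomputable def seedLen (j : ℕ) : ℕ := S.F.Cs * clog2 (S.L / S.η j)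

/-- The length of the fingerprint `(s, f)` of round `j`. -/
noncomputable def fpLen (j : ℕ) : ℕ := S.seedLen j + S.F.Ch * clog2 (1 / S.η j)

/-- The length of two evaluations. -/
def pairLen : ℕ := logq S.L + logq S.L

/-- The private coins of Bob in round `j`: the seed, the coins of the AMD encoding of the
fingerprint, and the noise by which he asks for more evaluations. -/
abbrev BobCoins (j : ℕ) : Type :=
  Bits (S.seedLen j) × Bits (S.A.coins (S.fpLen j) (S.η j)) × Bits (S.b j)

/-- The private coins of Alice in round `j`: those of the AMD encoding of two evaluations. -/
abbrev AliceCoins (j : ℕ) : Type := Bits (S.A.coins S.pairLen (S.η j))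

/-- The coins of all rounds. -/
abbrev Coins : Type := (j : ℕ) → S.AliceCoins j × S.BobCoins j

/-- All coins are fair and independent. -/
noncomputable def coinMeasure : Measure S.Coins :=
  Measure.infinitePi (fun j => uniform (S.AliceCoins j × S.BobCoins j))

/-- The step in which round `j` begins.  The first `(d + 1) * log q` steps are used for the first
`d + 1` evaluations; every round consists of four slots of `b_j` steps: Bob's fingerprint, Alice's
echo, Bob's noise (or silence, if he has left), two more evaluations from Alice. -/
noncomputable def start (j : ℕ) : ℕ :=
  (deg S.L + 1) * logq S.L + ∑ i ∈ Finset.Ico 1 j, 4 * S.b i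

/-- The round to which step `t` belongs, `0` for the steps before the first round. -/
noncomputable def roundOf (t : ℕ) : ℕ := Nat.findGreatest (fun j => S.start j ≤ t) t

/-- What is delivered in slot `s` of round `j`. -/
noncomputable def slot (y : ℕ → Bit) (j s : ℕ) : Bits (S.b j) :=
  fun i => y (S.start j + s * S.b j + i)

/-- The error-corrected content of slot `s` of round `j`. -/
noncomputable def decoded (y : ℕ → Bit) (j s : ℕ) : Bits (S.w j) :=
  S.E.dec (S.w j) (S.slot y j s)

/-- The string of which the fingerprint of a polynomial is taken. -/
noncomputable def word (P : Poly S.L) : List Bit := List.ofFn (S.conv.messageOf P)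

/-! #### Alice -/

/-- Alice accepts the fingerprint of round `j`: it is the (padded) AMD codeword of a pair
`(s, f)` that is the fingerprint, with seed `s`, of her own polynomial. -/
def Accepts (M : Bits S.L) (y : ℕ → Bit) (j : ℕ) : Prop :=
  let f := S.decoded y j 0
  let c : Bits (S.fpLen j + S.A.Ca * clog2 (S.fpLen j / S.η j)) := resize _ f
  resize _ c = f ∧ S.A.IsCodeword c ∧
    let z : Bits (S.fpLen j) := S.A.dec (S.fpLen j) (S.η j) c
    z = S.F.fp S.L (S.η j) (resize (S.seedLen j) z) (S.word (S.conv.encode M))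

open Classical in
/-- Alice's message in the second slot of round `j`: the echo, or zeros. -/
noncomputable def echo (M : Bits S.L) (y : ℕ → Bit) (j : ℕ) : Bits (S.b j) :=
  if S.Accepts M y j then S.E.enc (S.w j) (S.decoded y j 0) else 0

/-- The encoding of the evaluations at the two field elements that are next in round `j`. -/
noncomputable def evaluations (M : Bits S.L) (a : (j : ℕ) → S.AliceCoins j) (j : ℕ) :
    Bits (S.b j) :=
  let P := S.conv.encode M
  let n := deg S.L + 1 + 2 * (j - 1)
  let m : Bits S.pairLen := Fin.append (S.conv.evalBits P n) (S.conv.evalBits P (n + 1))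
  S.E.enc (S.w j) (resize _ (S.A.enc S.pairLen (S.η j) m (a j)))

/-- Alice has not terminated before round `j`. -/
def AliceRuns (y : ℕ → Bit) (j : ℕ) : Prop := ∀ i, 1 ≤ i → i < j → ¬ IsSilence (S.slot y i 2)

/-- Alice terminates in round `j`, after its third slot. -/
def AliceHalts (y : ℕ → Bit) (j : ℕ) : Prop :=
  1 ≤ j ∧ S.AliceRuns y j ∧ IsSilence (S.slot y j 2)

open Classical in
/-- Alice's algorithm for the message `M`, with private coins `a`. -/
noncomputable def alice (M : Bits S.L) (a : (j : ℕ) → S.AliceCoins j) : Party := fun y t =>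
  let j := S.roundOf t
  if j = 0 then
    some (bitAt (S.conv.evalBits (S.conv.encode M) (t / logq S.L)) (t % logq S.L))
  else if S.AliceRuns y j then
    let i := (t - S.start j) % S.b j
    match (t - S.start j) / S.b j with
      | 1 => some (bitAt (S.echo M y j) i)
      | 3 => if IsSilence (S.slot y j 2) then none else some (bitAt (S.evaluations M a j) i)
      | _ => none
  else none

/-! #### Bob -/

/-- The two evaluations that Bob receives in round `j`. -/
noncomputable def receivedPair (y : ℕ → Bit) (j : ℕ) : Bits S.pairLen :=
  S.A.dec S.pairLen (S.η j) (resize _ (S.decoded y j 3))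

/-- Bob's multiset of polynomial evaluation tuples at the beginning of round `j`. -/
noncomputable def tuples (y : ℕ → Bit) (j : ℕ) : Multiset (GF S.L × GF S.L) :=
  (Multiset.range (deg S.L + 1)).map
      (fun n => (S.conv.nth n, S.conv.rep.symm (fun a => y (n * logq S.L + a)))) +
    ∑ i ∈ Finset.Ico 1 j,
      ({(S.conv.nth (deg S.L + 1 + 2 * (i - 1)),
          S.conv.rep.symm (fun a => S.receivedPair y i (Fin.castAdd _ a))),
        (S.conv.nth (deg S.L + 1 + 2 * (i - 1) + 1),
          S.conv.rep.symm (fun a => S.receivedPair y i (Fin.natAdd _ a)))} :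
        Multiset (GF S.L × GF S.L))

/-- Bob's polynomial in round `j`. -/
noncomputable def guess (y : ℕ → Bit) (j : ℕ) : Poly S.L :=
  S.conv.getPoly (S.conv.maj (S.tuples y j))

/-- The (padded) AMD encoding of the fingerprint of Bob's polynomial in round `j`. -/
noncomputable def fingerprint (r : (j : ℕ) → S.BobCoins j) (y : ℕ → Bit) (j : ℕ) :
    Bits (S.w j) :=
  resize _ (S.A.enc (S.fpLen j) (S.η j)
    (S.F.fp S.L (S.η j) (r j).1 (S.word (S.guess y j))) (r j).2.1)

/-- The echo that Bob hears in round `j` is the fingerprint that he sent. -/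
def Matches (r : (j : ℕ) → S.BobCoins j) (y : ℕ → Bit) (j : ℕ) : Prop :=
  S.decoded y j 1 = S.fingerprint r y j

/-- Bob has not terminated before round `j`. -/
def BobRuns (r : (j : ℕ) → S.BobCoins j) (y : ℕ → Bit) (j : ℕ) : Prop :=
  ∀ i, 1 ≤ i → i < j → ¬ S.Matches r y i

/-- Bob terminates in round `j`, after its second slot. -/
def BobHalts (r : (j : ℕ) → S.BobCoins j) (y : ℕ → Bit) (j : ℕ) : Prop :=
  1 ≤ j ∧ S.BobRuns r y j ∧ S.Matches r y j

open Classical in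
/-- Bob's algorithm, with private coins `r`. -/
noncomputable def bob (r : (j : ℕ) → S.BobCoins j) : Party := fun y t =>
  let j := S.roundOf t
  if j = 0 then none
  else if S.BobRuns r y j then
    let i := (t - S.start j) % S.b j
    match (t - S.start j) / S.b j with
      | 0 => some (bitAt (S.E.enc (S.w j) (S.fingerprint r y j)) i)
      | 2 => if S.Matches r y j then none else some (bitAt (r j).2.2 i)
      | _ => none
  else none

/-! #### Executions -/

/-- The bits delivered in the execution with message `M`, adversary `adv` and coins `ω`. -/
noncomputable def run (M : Bits S.L) (adv : Adversary) (ω : S.Coins) : ℕ → Bit :=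
  received (S.alice M fun j => (ω j).1) (S.bob fun j => (ω j).2) adv

/-- The number of bits flipped by the adversary in the execution. -/
noncomputable def T (M : Bits S.L) (adv : Adversary) (ω : S.Coins) : ℕ :=
  flipCount (S.alice M fun j => (ω j).1) (S.bob fun j => (ω j).2) adv

/-- The number of bits sent in the execution. -/
noncomputable def cost (M : Bits S.L) (adv : Adversary) (ω : S.Coins) : ℕ∞ :=
  bitsSent (S.alice M fun j => (ω j).1) (S.bob fun j => (ω j).2) adv

/-- Both players terminate, Bob before Alice, and Bob's final polynomial yields `M'`. -/
def Outputs (M : Bits S.L) (adv : Adversary) (ω : S.Coins) (M' : Bits S.L) : Prop :=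
  ∃ jB jA, S.BobHalts (fun j => (ω j).2) (S.run M adv ω) jB ∧
    S.AliceHalts (S.run M adv ω) jA ∧ jB ≤ jA ∧
    S.conv.messageOf (S.guess (S.run M adv ω) jB) = M'

end Setup

end UnknownNoise

/-!
# A robust one-way protocol over a channel with an unknown amount of noise

**The tools.** A fingerprint of a string is a prefix of a random multiple of the value of a
polynomial at a random point (`exists_fingerprint`), the AMD code authenticates a message by the
value of a polynomial at a random point (`exists_amd`), and the error-correcting codes come from
the Gilbert–Varshamov bound together with syndrome decoding (`exists_ecc`).

**Why few bits are sent.** Call a round corrupted if the number of charged flips in it is at least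
a fixed fraction of the length of a slot. In a round that is not corrupted all codewords are decoded
correctly and silence is recognized. Hence every such round before Alice's last one is a round
in which Bob has a wrong polynomial (`Setup.guess_ne_of_not_corrupted`). By majority vote and
because two distinct polynomials agree in at most `d` points, a wrong polynomial in round `j`
requires that a constant fraction of the evaluations is wrong
(`card_mul_le_of_getPoly_ne`, `le_mul_card_bad`), so that `j` is at most of the order of the number
of wrong initial evaluations, which is at most `min (T, d + 1)`, plus the number of corrupted rounds
(`Setup.le_of_guess_ne`). The length of round `j` is proportional to `A + ⌊j / d⌋` for a number `A`
of the order of `log (L / δ)`. If the initial errors dominate, then `j` is `O(d)` and all rounds up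
to `j` have length `O(A)`; if the corrupted rounds dominate, then the flips in them pay for all
rounds up to `j`, because the lengths grow only linearly (`mul_le_of_le_errors`,
`sum_le_of_errors`). This yields `Setup.cost_le`; no
probability is involved in it.

**Why Bob is right with probability `1 - δ`.** As the adversary does not see the channel and the
decoder commutes with shifts of codewords, what a player decodes is what was sent plus a fixed
string. Given the past, round `j` misleads a player with probability at most `3 * η_j`: Alice
accepts a wrong or changed fingerprint (excluded by the fingerprint scheme and the AMD code), or
Bob hears his fingerprint although Alice sent zeros (excluded by the random seed), or random bits
look like silence (`Setup.uniform_misleading_le`). The `η_j` are summable with sum at most `δ / 3`,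
and the bound given the past becomes one on the product space by `infinitePi_setOf_mem_le`. Without
such a failure Alice outlasts Bob, and Bob can only stop with the right message; since the number
of flips is finite, he does stop (`Setup.outputs_of_not_failure`).
-/

namespace UnknownNoise

/-! ### Uniform measures and ceilings of logarithms -/

section UniformMeasure

variable {α : Type} [MeasurableSpace α] [MeasurableSingletonClass α] [Finite α]

theorem uniform_apply (s : Set α) : uniform α s = (s.ncard : ENNReal) / Nat.card α := by
  classical
  have := Fintype.ofFinite α
  rw [uniform, uniformOn_univ, Measure.count_apply_finite s s.toFinite,
    Set.ncard_eq_toFinset_card s s.toFinite, Nat.card_eq_fintype_card]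

theorem uniform_le_ofReal [Nonempty α] {s : Set α} {p : ℝ} :
    (s.ncard : ℝ) ≤ p * Nat.card α → uniform α s ≤ ENNReal.ofReal p := by
  intro h
  have hc : (0 : ℝ) < Nat.card α := by exact_mod_cast Nat.card_pos
  rw [uniform_apply]
  rw [← ENNReal.ofReal_natCast, ← ENNReal.ofReal_natCast (Nat.card α),
    ← ENNReal.ofReal_div_of_pos hc]
  exact ENNReal.ofReal_le_ofReal ((div_le_iff₀ hc).2 h)

theorem ncard_le_of_uniform_le [Nonempty α] {s : Set α} {p : ℝ} (hp : 0 ≤ p)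
    (h : uniform α s ≤ ENNReal.ofReal p) : (s.ncard : ℝ) ≤ p * Nat.card α := by
  have hc : (0 : ℝ) < Nat.card α := by exact_mod_cast Nat.card_pos
  rw [uniform_apply, ← ENNReal.ofReal_natCast, ← ENNReal.ofReal_natCast (Nat.card α),
    ← ENNReal.ofReal_div_of_pos hc, ENNReal.ofReal_le_ofReal_iff hp] at h
  exact (div_le_iff₀ hc).1 h

end UniformMeasure

theorem clog2_le_iff {x : ℝ} (hx : 0 < x) (n : ℕ) : clog2 x ≤ n ↔ x ≤ 2 ^ n := by
  rw [clog2, Nat.ceil_le, Real.logb_le_iff_le_rpow (by norm_num) hx, Real.rpow_natCast]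

theorem le_two_pow_clog2 {x : ℝ} (hx : 0 < x) : x ≤ 2 ^ clog2 x :=
  (clog2_le_iff hx _).1 le_rfl

theorem clog2_pos {x : ℝ} (hx : 1 < x) : 0 < clog2 x := by
  rw [Nat.pos_iff_ne_zero]
  intro h
  have := (clog2_le_iff (by linarith) 0).1 h.le
  norm_num at this
  linarith

theorem clog2_mono {x y : ℝ} (hx : 0 < x) (h : x ≤ y) : clog2 x ≤ clog2 y :=
  (clog2_le_iff hx _).2 (h.trans (le_two_pow_clog2 (hx.trans_le h)))

/-- Multiplication by a power of two shifts `⌈log₂⌉` exactly (for arguments at least `1`, where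
the ceiling is not truncated at `0`). -/
theorem clog2_mul_two_pow {x : ℝ} (hx : 1 ≤ x) (n : ℕ) : clog2 (x * 2 ^ n) = clog2 x + n := by
  have h0 : 0 < x := by linarith
  rw [clog2, Real.logb_mul h0.ne' (by positivity), Real.logb_pow, Real.logb_self_eq_one (by norm_num),
    mul_one, Nat.ceil_add_natCast (Real.logb_nonneg (by norm_num) hx), clog2]

theorem clog2_natCast (n : ℕ) : clog2 (n : ℝ) = Nat.clog 2 n := by
  rw [clog2, ← Real.natCeil_logb_natCast]; norm_num

/-! ### Polynomial fingerprints -/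

theorem ncard_eval_eq_zero_le {K : Type*} [Field K] {D : Polynomial K} (hD : D ≠ 0) :
    {x | D.eval x = 0}.ncard ≤ D.natDegree := by
  classical
  have : {x | D.eval x = 0} = (D.roots.toFinset : Set K) := by
    ext x; simp [hD]
  rw [this, Set.ncard_coe_finset]
  exact (Multiset.toFinset_card_le _).trans (Polynomial.card_roots' D)

theorem card_bits (n : ℕ) : Nat.card (Bits n) = 2 ^ n := by simp

/-- The polynomial with coefficient sequence `m` followed by `1`; the final `1` makes strings of
different lengths give different polynomials. -/
noncomputable def stringPoly (K : Type*) [Field K] [Algebra Bit K] : List Bit → Polynomial K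
  | [] => 1
  | b :: m => Polynomial.C (algebraMap Bit K b) + Polynomial.X * stringPoly K m

section StringPoly

variable (K : Type*) [Field K] [Algebra Bit K]

theorem stringPoly_ne_zero (m : List Bit) : stringPoly K m ≠ 0 := by
  induction m with
  | nil => simp [stringPoly]
  | cons b m ih =>
    intro h
    have h0 := congrArg (Polynomial.coeff · 0) h
    simp only [stringPoly, Polynomial.coeff_add, Polynomial.coeff_C_zero,
      Polynomial.mul_coeff_zero, Polynomial.coeff_X_zero, zero_mul, add_zero,
      Polynomial.coeff_zero] at h0
    rw [stringPoly, h0] at h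
    simp [Polynomial.X_ne_zero, ih] at h

theorem stringPoly_injective : Function.Injective (stringPoly K) := by
  intro m
  induction m with
  | nil =>
    intro m' h
    cases m' with
    | nil => rfl
    | cons b m' =>
      exfalso
      have h0 := congrArg (Polynomial.coeff · 0) h
      simp only [stringPoly, Polynomial.coeff_add, Polynomial.coeff_C_zero,
        Polynomial.mul_coeff_zero, Polynomial.coeff_X_zero, zero_mul, add_zero,
        Polynomial.coeff_one_zero] at h0
      rw [stringPoly, stringPoly, ← h0] at h
      simp [Polynomial.X_ne_zero, stringPoly_ne_zero] at h
  | cons b m ih =>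
    intro m' h
    have h0 := congrArg (Polynomial.coeff · 0) h
    cases m' with
    | nil =>
      exfalso
      simp only [stringPoly, Polynomial.coeff_add, Polynomial.coeff_C_zero,
        Polynomial.mul_coeff_zero, Polynomial.coeff_X_zero, zero_mul, add_zero,
        Polynomial.coeff_one_zero] at h0
      rw [stringPoly, stringPoly, h0] at h
      simp [Polynomial.X_ne_zero, stringPoly_ne_zero] at h
    | cons b' m' =>
      simp only [stringPoly, Polynomial.coeff_add, Polynomial.coeff_C_zero,
        Polynomial.mul_coeff_zero, Polynomial.coeff_X_zero, zero_mul, add_zero] at h0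
      rw [stringPoly, stringPoly, h0] at h
      have h1 := mul_left_cancel₀ Polynomial.X_ne_zero (add_left_cancel h)
      rw [ih h1, (algebraMap Bit K).injective h0]

theorem natDegree_stringPoly_le (m : List Bit) : (stringPoly K m).natDegree ≤ m.length := by
  induction m with
  | nil => simp [stringPoly]
  | cons b m ih =>
    rw [stringPoly]
    refine (Polynomial.natDegree_add_le _ _).trans ?_
    rw [Polynomial.natDegree_C, List.length_cons]
    refine max_le (by omega) (Polynomial.natDegree_mul_le.trans ?_)
    rw [Polynomial.natDegree_X]
    omega

end StringPoly

theorem ncard_bits_prefix_zero {k r : ℕ} (hr : r ≤ k) :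
    {v : Bits k | (fun i : Fin r => v (Fin.castLE hr i)) = 0}.ncard ≤ 2 ^ (k - r) := by
  rw [← card_bits, ← Set.ncard_univ]
  refine Set.ncard_le_ncard_of_injOn (fun v (i : Fin (k - r)) => v ⟨r + i, by omega⟩)
    (fun _ _ => Set.mem_univ _) ?_
  intro v hv v' hv' h
  funext i
  by_cases hi : (i : ℕ) < r
  · have h1 := congrFun hv ⟨i, hi⟩
    have h2 := congrFun hv' ⟨i, hi⟩
    simp only [Pi.zero_apply] at h1 h2
    exact h1.trans h2.symm
  · have h1 := congrFun h ⟨i - r, by omega⟩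
    have h2 : (⟨r + (i - r), by omega⟩ : Fin k) = i := by ext; simp; omega
    simp only [h2] at h1
    exact h1

/-- A fingerprint of `m` with seed `(x, y) ∈ GF(2ᵏ)²` is a prefix of the bits of `y * P(x)`, where
`P` has the bits of `m` as coefficients. Two strings collide if `x` is a root of the difference
of their polynomials, or if a uniformly random field element has a zero prefix. -/
theorem exists_fingerprint (ℓ : ℕ) (p : ℝ) :
    ∃ tag : Bits (4 * clog2 (ℓ / p)) → List Bit → Bits (2 * clog2 (1 / p)),
      0 < ℓ → 0 < p → p < 1 → ∀ m m' : List Bit,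
        m.length ≤ ℓ → m'.length ≤ ℓ → m ≠ m' →
          uniform (Bits (4 * clog2 (ℓ / p))) {s | tag s m = tag s m'} ≤ ENNReal.ofReal p := by
  by_cases hv : 0 < ℓ ∧ 0 < p ∧ p < 1
  swap
  · exact ⟨fun _ _ => 0, fun h1 h2 h3 => absurd ⟨h1, h2, h3⟩ hv⟩
  obtain ⟨hℓ, hp, hp1⟩ := hv
  have hℓ1 : (1 : ℝ) ≤ ℓ := by exact_mod_cast hℓ
  have hle : 1 / p ≤ ℓ / p := by gcongr
  have h1p : 1 < 1 / p := by rw [lt_div_iff₀ hp]; linarith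
  set c := clog2 (ℓ / p) with hc
  set c' := clog2 (1 / p) with hc'
  have hcc : c' ≤ c := clog2_mono (by positivity) hle
  have hc'0 : 0 < c' := clog2_pos h1p
  have hk : 2 * c ≠ 0 := by omega
  have hr : 2 * c' ≤ 2 * c := by omega
  let K := GaloisField 2 (2 * c)
  have hK : Nat.card K = 2 ^ (2 * c) := GaloisField.card 2 _ hk
  have φ : K ≃ₗ[ZMod 2] Bits (2 * c) :=
    LinearEquiv.ofFinrankEq _ _ (by rw [GaloisField.finrank 2 hk]; simp)
  have hE : Nonempty (Bits (4 * c) ≃ K × K) := by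
    refine Finite.card_eq.mp ?_
    rw [Nat.card_prod, hK, card_bits, ← pow_add]
    congr 1; omega
  obtain ⟨e⟩ := hE
  refine ⟨fun s m i => φ ((e s).2 * (stringPoly K m).eval (e s).1) (Fin.castLE hr i), ?_⟩
  intro _ _ _ m m' hm hm' hne
  set D := stringPoly K m - stringPoly K m' with hD
  have hD0 : D ≠ 0 := sub_ne_zero.2 fun h => hne (stringPoly_injective K h)
  have hdeg : D.natDegree ≤ ℓ := (Polynomial.natDegree_sub_le _ _).trans
    (max_le ((natDegree_stringPoly_le K m).trans hm) ((natDegree_stringPoly_le K m').trans hm'))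
  let Z : Set (Bits (2 * c)) := {v | (fun i : Fin (2 * c') => v (Fin.castLE hr i)) = 0}
  have key : {s : Bits (4 * c) | (fun i => φ ((e s).2 * (stringPoly K m).eval (e s).1)
      (Fin.castLE hr i)) = fun i => φ ((e s).2 * (stringPoly K m').eval (e s).1)
      (Fin.castLE hr i)}.ncard ≤ ℓ * 2 ^ (2 * c) + 2 ^ (2 * c) * 2 ^ (2 * c - 2 * c') := by
    have hsub : {s : Bits (4 * c) | (fun i => φ ((e s).2 * (stringPoly K m).eval (e s).1)
      (Fin.castLE hr i)) = fun i => φ ((e s).2 * (stringPoly K m').eval (e s).1)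
      (Fin.castLE hr i)} ⊆ (e ⁻¹' ({x | D.eval x = 0} ×ˢ Set.univ)) ∪
        {s | D.eval (e s).1 ≠ 0 ∧ φ ((e s).2 * D.eval (e s).1) ∈ Z} := by
      intro s hs
      by_cases h0 : D.eval (e s).1 = 0
      · exact Or.inl ⟨h0, Set.mem_univ _⟩
      · refine Or.inr ⟨h0, ?_⟩
        funext i
        have := congrFun hs i
        rw [hD, Polynomial.eval_sub, mul_sub, map_sub, Pi.sub_apply, this, sub_self]
        rfl
    refine (Set.ncard_le_ncard hsub).trans ((Set.ncard_union_le _ _).trans (add_le_add ?_ ?_))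
    · calc _ ≤ ({x | D.eval x = 0} ×ˢ (Set.univ : Set K)).ncard :=
            Set.ncard_le_ncard_of_injOn e (fun _ h => h) e.injective.injOn
        _ ≤ _ := by
            rw [Set.ncard_prod, Set.ncard_univ, hK]
            exact Nat.mul_le_mul_right _ ((ncard_eval_eq_zero_le hD0).trans hdeg)
    · calc _ ≤ ((Set.univ : Set K) ×ˢ Z).ncard := by
            refine Set.ncard_le_ncard_of_injOn
              (fun s => ((e s).1, φ ((e s).2 * D.eval (e s).1)))
              (fun s h => ⟨Set.mem_univ _, h.2⟩) ?_
            intro s hs s' hs' h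
            have h1 : (e s).1 = (e s').1 := (Prod.mk.inj h).1
            have h2 : (e s).2 * D.eval (e s).1 = (e s').2 * D.eval (e s').1 :=
              φ.injective (Prod.mk.inj h).2
            rw [h1] at h2
            exact e.injective (Prod.ext h1 (mul_right_cancel₀ hs'.1 h2))
        _ ≤ _ := by
            rw [Set.ncard_prod, Set.ncard_univ, hK]
            exact Nat.mul_le_mul_left _ (ncard_bits_prefix_zero hr)
  refine uniform_le_ofReal ?_
  rw [card_bits]
  refine (Nat.cast_le.2 key).trans ?_
  have e1 : (ℓ : ℝ) / p ≤ 2 ^ c := le_two_pow_clog2 (by positivity)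
  have e2 : 1 / p ≤ 2 ^ c' := le_two_pow_clog2 (by positivity)
  have e3 : (2 : ℝ) ≤ 2 ^ c' := by
    calc (2 : ℝ) = 2 ^ 1 := by norm_num
      _ ≤ _ := pow_le_pow_right₀ (by norm_num) hc'0
  have e4 : (2 : ℝ) ^ c' ≤ 2 ^ c := pow_le_pow_right₀ (by norm_num) hcc
  rw [div_le_iff₀ hp] at e1 e2
  have e5 : (2 : ℝ) ^ (2 * c - 2 * c') * (2 ^ c' * 2 ^ c') = 2 ^ c * 2 ^ c := by
    rw [← pow_add, ← pow_add, ← pow_add]; congr 1; omega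
  push_cast
  have e6 : (2 : ℝ) ^ (4 * c) = (2 ^ c * 2 ^ c) * (2 ^ c * 2 ^ c) := by
    rw [← pow_add, ← pow_add]; congr 1; omega
  have e7 : (2 : ℝ) ^ (2 * c) = 2 ^ c * 2 ^ c := by rw [← pow_add]; congr 1; omega
  rw [e6, e7]
  set a : ℝ := 2 ^ c with ha
  set u : ℝ := 2 ^ c' with hu
  set z : ℝ := (2 : ℝ) ^ (2 * c - 2 * c') with hz
  have ha0 : 0 < a := by positivity
  have hz0 : 0 < z := by positivity
  have f1 : 2 * (ℓ : ℝ) ≤ p * (a * a) := by nlinarith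
  have f2 : 2 * z ≤ p * (a * a) := by
    rw [← e5]
    nlinarith [mul_le_mul_of_nonneg_left (show (2 : ℝ) ≤ p * (u * u) by nlinarith) hz0.le]
  nlinarith [mul_pos ha0 ha0]

theorem FingerprintScheme.nonempty : Nonempty FingerprintScheme := by
  choose tag htag using exists_fingerprint
  exact ⟨⟨4, 2, by norm_num, by norm_num, tag, htag⟩⟩

/-! ### Algebraic manipulation detection codes -/

/-- The polynomial `X ^ N + ∑ mᵢ X ^ (i + 1)` whose value authenticates the message `m`. Its
leading exponent `N = 2 * (x / 2) + 3` is odd, so that it does not vanish in characteristic `2`,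
and exceeds the other exponents by at least two. -/
noncomputable def amdPoly (K : Type*) [Field K] [Algebra Bit K] {x : ℕ} (m : Bits x) :
    Polynomial K :=
  Polynomial.X ^ (2 * (x / 2) + 3) +
    ∑ i : Fin x, Polynomial.C (algebraMap Bit K (m i)) * Polynomial.X ^ ((i : ℕ) + 1)

section AmdPoly

open Polynomial

variable (K : Type*) [Field K] [Algebra Bit K] {x : ℕ}

theorem natDegree_amdPoly_comp_le (m : Bits x) (a : K) :
    ((amdPoly K m).comp (X + C a)).natDegree ≤ x + 3 := by
  refine natDegree_comp_le.trans ?_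
  rw [natDegree_X_add_C, mul_one, amdPoly]
  refine (natDegree_add_le _ _).trans (max_le ?_ ?_)
  · rw [natDegree_X_pow]; omega
  · refine natDegree_sum_le_of_forall_le _ _ fun i _ => ?_
    refine (natDegree_C_mul_X_pow_le _ _).trans ?_
    have := i.2
    omega

/-- The key to manipulation detection: shifting the evaluation point, the message and the value by
amounts that are not all zero leads to a nonzero polynomial condition on the evaluation point. -/
theorem amdPoly_shift_ne_zero (m t : Bits x) (a b : K) (h : ¬ (t = 0 ∧ a = 0 ∧ b = 0)) :
    (amdPoly K (m + t)).comp (X + C a) - amdPoly K m - C b ≠ 0 := by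
  intro h0
  have hsum : ∀ (m : Bits x) (n : ℕ), (∑ i : Fin x, C (algebraMap Bit K (m i)) *
      X ^ ((i : ℕ) + 1)).coeff (n + 1) = if hn : n < x then algebraMap Bit K (m ⟨n, hn⟩) else 0 := by
    intro m n
    rw [finsetSum_coeff]
    simp only [coeff_C_mul, coeff_X_pow]
    split_ifs with hn
    · rw [Finset.sum_eq_single ⟨n, hn⟩]
      · simp
      · intro i _ hi
        rw [if_neg, mul_zero]
        intro h; apply hi; ext; simp; omega
      · simp
    · refine Finset.sum_eq_zero fun i _ => ?_
      rw [if_neg, mul_zero]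
      have := i.2; omega
  by_cases ha : a = 0
  · subst ha
    rw [C_0, add_zero, comp_X] at h0
    have h1 : ∀ n (hn : n < x), t ⟨n, hn⟩ = 0 := by
      intro n hn
      have := congrArg (coeff · (n + 1)) h0
      simp only [amdPoly, coeff_sub, coeff_add, hsum, dif_pos hn, coeff_C_succ, coeff_zero,
        sub_zero] at this
      rw [Pi.add_apply, map_add] at this
      have h2 : algebraMap Bit K (t ⟨n, hn⟩) = 0 := by linear_combination this
      exact (map_eq_zero _).1 h2
    have ht : t = 0 := funext fun i => h1 i i.2
    subst ht
    rw [add_zero, sub_self, zero_sub, neg_eq_zero, C_eq_zero] at h0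
    exact h ⟨rfl, rfl, h0⟩
  · have := congrArg (coeff · (2 * (x / 2) + 2)) h0
    have hc : CharP K 2 := charP_of_injective_algebraMap (algebraMap Bit K).injective 2
    have hdeg : ((∑ i : Fin x, C (algebraMap Bit K ((m + t) i)) *
        X ^ ((i : ℕ) + 1)).comp (X + C a)).coeff (2 * (x / 2) + 2) = 0 := by
      refine coeff_eq_zero_of_natDegree_lt (lt_of_le_of_lt natDegree_comp_le ?_)
      rw [natDegree_X_add_C, mul_one]
      refine lt_of_le_of_lt (b := x) (natDegree_sum_le_of_forall_le _ _ fun i _ => ?_) (by omega)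
      exact (natDegree_C_mul_X_pow_le _ _).trans i.2
    have hnx : ¬ (2 * (x / 2) + 1 < x) := by omega
    simp only [amdPoly, coeff_sub, coeff_add, add_comp, hdeg, coeff_zero, X_pow_comp,
      coeff_X_add_C_pow, coeff_X_pow, coeff_C_succ, hsum m (2 * (x / 2) + 1), dif_neg hnx] at this
    have e1 : 2 * (x / 2) + 3 - (2 * (x / 2) + 2) = 1 := by omega
    have e2 : (2 * (x / 2) + 3).choose (2 * (x / 2) + 2) = 2 * (x / 2) + 3 :=
      Nat.choose_succ_self_right _
    have h2 : (2 : K) = 0 := CharTwo.two_eq_zero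
    rw [if_neg (by omega), e1, e2] at this
    push_cast at this
    rw [h2] at this
    apply ha
    have h3 : (3 : K) = 1 := by linear_combination h2
    rw [h3] at this
    simpa using this

end AmdPoly

/-- The encoding of `m` with coins `r` consists of `m`, of `r` and of the value at `r` of the
polynomial with coefficients `m`. -/
theorem exists_amd (x : ℕ) (η : ℝ) :
    ∃ (enc : Bits x → Bits (3 * clog2 (x / η)) → Bits (x + 6 * clog2 (x / η)))
      (dec : Bits (x + 6 * clog2 (x / η)) → Bits x), 0 < x → 0 < η → η < 1 →
      (∀ m r, dec (enc m r) = m) ∧ ∀ (m : Bits x) (t : Bits (x + 6 * clog2 (x / η))), t ≠ 0 →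
        uniform (Bits (3 * clog2 (x / η))) {r | ∃ m' r', enc m' r' = enc m r + t}
          ≤ ENNReal.ofReal η := by
  by_cases hv : 0 < x ∧ 0 < η ∧ η < 1
  swap
  · exact ⟨fun _ _ => 0, fun _ => 0, fun h1 h2 h3 => absurd ⟨h1, h2, h3⟩ hv⟩
  obtain ⟨hx, hη, hη1⟩ := hv
  have hx1 : (1 : ℝ) ≤ x := by exact_mod_cast hx
  have h1x : 1 < x / η := by rw [lt_div_iff₀ hη]; linarith
  set c := clog2 (x / η) with hc
  have hc0 : 0 < c := clog2_pos h1x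
  have hk : 3 * c ≠ 0 := by omega
  let K := GaloisField 2 (3 * c)
  have hK : Nat.card K = 2 ^ (3 * c) := GaloisField.card 2 _ hk
  have φ : Bits (3 * c) ≃ₗ[ZMod 2] K :=
    LinearEquiv.ofFinrankEq _ _ (by rw [GaloisField.finrank 2 hk]; simp)
  have ψ : (Bits x × K × K) ≃ₗ[ZMod 2] Bits (x + 6 * c) :=
    LinearEquiv.ofFinrankEq _ _ (by
      rw [Module.finrank_prod, Module.finrank_prod, GaloisField.finrank 2 hk]; simp; omega)
  refine ⟨fun m r => ψ (m, φ r, (amdPoly K m).eval (φ r)), fun z => (ψ.symm z).1, ?_⟩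
  refine fun _ _ _ => ⟨fun m r => by simp, fun m t ht => ?_⟩
  obtain ⟨⟨tm, a, b⟩, rfl⟩ := ψ.surjective t
  have hne : ¬ (tm = 0 ∧ a = 0 ∧ b = 0) := by
    rintro ⟨rfl, rfl, rfl⟩
    exact ht (map_zero ψ)
  set D := (amdPoly K (m + tm)).comp (Polynomial.X + Polynomial.C a) - amdPoly K m -
    Polynomial.C b with hD
  have hD0 : D ≠ 0 := amdPoly_shift_ne_zero K m tm a b hne
  have hdeg : D.natDegree ≤ x + 3 := by
    refine (Polynomial.natDegree_sub_le _ _).trans (max_le ?_ (by simp))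
    refine (Polynomial.natDegree_sub_le _ _).trans
      (max_le (natDegree_amdPoly_comp_le K _ _) ?_)
    have := natDegree_amdPoly_comp_le K m 0
    rwa [Polynomial.C_0, add_zero, Polynomial.comp_X] at this
  refine uniform_le_ofReal ?_
  have hsub : {r | ∃ m' r', ψ (m', φ r', (amdPoly K m').eval (φ r')) =
      ψ (m, φ r, (amdPoly K m).eval (φ r)) + ψ (tm, a, b)}.ncard ≤
      {z : K | D.eval z = 0}.ncard := by
    refine Set.ncard_le_ncard_of_injOn φ ?_ φ.injective.injOn
    rintro r ⟨m', r', h⟩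
    rw [← map_add] at h
    have h1 := ψ.injective h
    simp only [Prod.mk_add_mk, Prod.mk.injEq] at h1
    obtain ⟨rfl, h2, h3⟩ := h1
    rw [h2] at h3
    simp only [Set.mem_ofPred_eq, hD, Polynomial.eval_sub, Polynomial.eval_comp,
      Polynomial.eval_add, Polynomial.eval_X, Polynomial.eval_C, h3]
    ring
  rw [card_bits]
  refine (Nat.cast_le.2 (hsub.trans ((ncard_eval_eq_zero_le hD0).trans hdeg))).trans ?_
  have e1 : (x : ℝ) / η ≤ 2 ^ c := le_two_pow_clog2 (by positivity)
  have e3 : (2 : ℝ) ≤ 2 ^ c := by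
    calc (2 : ℝ) = 2 ^ 1 := by norm_num
      _ ≤ _ := pow_le_pow_right₀ (by norm_num) hc0
  rw [div_le_iff₀ hη] at e1
  push_cast
  have e7 : (2 : ℝ) ^ (3 * c) = 2 ^ c * 2 ^ c * 2 ^ c := by
    rw [← pow_add, ← pow_add]; congr 1; omega
  rw [e7]
  set u : ℝ := 2 ^ c with hu
  have h4 : (4 : ℝ) ≤ u * u := by nlinarith
  calc (x : ℝ) + 3 ≤ x * 4 := by linarith
    _ ≤ (u * η) * (u * u) := mul_le_mul e1 h4 (by norm_num) (by positivity)
    _ = _ := by ring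

theorem AMDCode.nonempty : Nonempty AMDCode := by
  choose enc dec h using exists_amd
  exact ⟨⟨6, by norm_num, fun x η => 3 * clog2 (x / η), enc, dec,
    fun x η h1 h2 h3 => (h x η h1 h2 h3).1, fun x η h1 h2 h3 => (h x η h1 h2 h3).2⟩⟩

/-! ### Linear error-correcting codes -/

/-- A volume bound for Hamming balls, from `∑ᵤ 3 ^ (n - |u|) = 4 ^ n`. -/
theorem ncard_hammingNorm_le (n w : ℕ) (hw : w ≤ n) :
    {u : Bits n | hammingNorm u ≤ w}.ncard * 3 ^ (n - w) ≤ 4 ^ n := by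
  classical
  have hsum : ∑ u : Bits n, ∏ i, (if u i = 0 then 3 else 1) = 4 ^ n := by
    have h := Finset.prod_univ_sum (fun _ : Fin n => (Finset.univ : Finset Bit))
      (fun _ b => if b = 0 then 3 else 1)
    rw [Fintype.piFinset_univ] at h
    rw [← h, Finset.prod_const, Finset.card_univ, Fintype.card_fin]
    rfl
  have hprod : ∀ u : Bits n, (∏ i, (if u i = 0 then 3 else 1)) * 3 ^ hammingNorm u = 3 ^ n := by
    intro u
    rw [hammingNorm, ← Finset.prod_const, Finset.prod_filter, ← Finset.prod_mul_distrib]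
    rw [Finset.prod_congr rfl (g := fun _ => 3), Finset.prod_const, Finset.card_univ,
      Fintype.card_fin]
    intro i _
    by_cases h : u i = 0 <;> simp [h]
  rw [Set.ncard_eq_toFinset_card', Set.toFinset_ofPred, ← hsum, ← smul_eq_mul,
    ← Finset.sum_const]
  refine (Finset.sum_le_sum (g := fun u => ∏ i, (if u i = 0 then 3 else 1)) ?_).trans
    (Finset.sum_le_sum_of_subset (Finset.filter_subset _ _))
  intro u hu
  have hu' : hammingNorm u ≤ w := (Finset.mem_filter.1 hu).2
  have := hprod u
  refine Nat.le_of_mul_le_mul_right (?_ : _ * 3 ^ hammingNorm u ≤ _ * 3 ^ hammingNorm u)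
    (by positivity)
  rw [this, ← pow_add]
  exact Nat.pow_le_pow_right (by norm_num) (by omega)

/-- The Gilbert–Varshamov argument: as long as the balls of radius `k` around the codewords do not
cover the whole space, a further generator can be added. -/
theorem exists_linearMap_large_weight (k j : ℕ) (hj : j ≤ k) :
    ∃ f : Bits j →ₗ[ZMod 2] Bits (5 * k), ∀ m, m ≠ 0 → k < hammingNorm (f m) := by
  classical
  induction j with
  | zero => exact ⟨0, fun m hm => absurd (Subsingleton.elim _ _) hm⟩
  | succ j ih =>
    obtain ⟨f, hf⟩ := ih (by omega)
    obtain ⟨v, hv⟩ : ∃ v, ∀ m, k < hammingNorm (f m + v) := by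
      by_contra! hcon
      let B : Set (Bits (5 * k)) := {u | hammingNorm u ≤ k}
      have h1 : (Set.univ : Set (Bits (5 * k))).ncard ≤
          ((Set.univ : Set (Bits j)) ×ˢ B).ncard := by
        refine (Set.ncard_le_ncard ?_).trans
          (Set.ncard_image_le (f := fun z : Bits j × Bits (5 * k) => z.2 - f z.1))
        intro v _
        obtain ⟨m, hm⟩ := hcon v
        exact ⟨(m, f m + v), ⟨Set.mem_univ _, hm⟩, by simp⟩
      rw [Set.ncard_prod, Set.ncard_univ, Set.ncard_univ, card_bits, card_bits] at h1
      have h2 : B.ncard * 3 ^ (5 * k - k) ≤ 4 ^ (5 * k) :=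
        ncard_hammingNorm_le (5 * k) k (by omega)
      have h3 : 2 ^ j ≤ 2 ^ k := Nat.pow_le_pow_right (by norm_num) (by omega)
      have e : 5 * k - k = 4 * k := by omega
      rw [e] at h2
      have h4 : 2 ^ (5 * k) * 3 ^ (4 * k) ≤ 2 ^ k * 4 ^ (5 * k) := by
        calc 2 ^ (5 * k) * 3 ^ (4 * k) ≤ 2 ^ j * B.ncard * 3 ^ (4 * k) := by gcongr
          _ = 2 ^ j * (B.ncard * 3 ^ (4 * k)) := by ring
          _ ≤ _ := by gcongr
      simp only [pow_mul] at h4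
      rw [← mul_pow, ← mul_pow] at h4
      have := (Nat.pow_le_pow_iff_left (by omega)).1 h4
      norm_num at this
    refine ⟨f ∘ₗ LinearMap.funLeft _ _ Fin.succ +
      (LinearMap.proj (0 : Fin (j + 1))).smulRight v, fun m hm => ?_⟩
    simp only [LinearMap.add_apply, LinearMap.comp_apply, LinearMap.smulRight_apply,
      LinearMap.proj_apply]
    have h01 : ∀ z : ZMod 2, z = 0 ∨ z = 1 := by decide
    rcases h01 (m 0) with h0 | h0
    · rw [h0, zero_smul, add_zero]
      refine hf _ fun h => hm (funext fun i => ?_)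
      refine Fin.cases h0 (fun i => ?_) i
      exact congrFun h i
    · rw [h0, one_smul]
      exact hv _

/-- Syndrome decoding: the decoder subtracts an element of least weight of the coset of the
received word. -/
theorem exists_ecc (k : ℕ) :
    ∃ (enc : Bits k → Bits (5 * k)) (dec : Bits (5 * k) → Bits k),
      (∀ m m', enc (m + m') = enc m + enc m') ∧
      (∀ m t, (hammingNorm t : ℝ) ≤ 1 / 10 * (5 * k : ℕ) → dec (enc m + t) = m) ∧
      ∀ m t, dec (enc m + t) = m + dec t := by
  classical
  obtain ⟨f, hf⟩ := exists_linearMap_large_weight k k le_rfl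
  have hinj : Function.Injective f := by
    rw [injective_iff_map_eq_zero]
    intro m hm
    by_contra h
    have := hf m h
    simp [hm] at this
  let C := LinearMap.range f
  have hlead : ∀ z : Bits (5 * k) ⧸ C, ∃ e : Bits (5 * k), C.mkQ e = z ∧
      ∀ e', C.mkQ e' = z → hammingNorm e ≤ hammingNorm e' := by
    intro z
    obtain ⟨e, he, hmin⟩ := Set.exists_min_image {e | C.mkQ e = z} hammingNorm (Set.toFinite _)
      (C.mkQ_surjective z)
    exact ⟨e, he, fun e' he' => hmin e' he'⟩
  choose lead hlead1 hlead2 using hlead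
  have hdec : ∀ y, ∃ m, f m = y - lead (C.mkQ y) := by
    intro y
    have h : C.mkQ (y - lead (C.mkQ y)) = 0 := by rw [map_sub, hlead1, sub_self]
    exact (Submodule.Quotient.mk_eq_zero C).1 h
  choose dec hdec using hdec
  have hmk : ∀ m t, C.mkQ (f m + t) = C.mkQ t := by
    intro m t
    rw [map_add]
    have : C.mkQ (f m) = 0 := by
      rw [← LinearMap.mem_ker, C.ker_mkQ]; exact ⟨m, rfl⟩
    rw [this, zero_add]
  have hshift : ∀ m t, dec (f m + t) = m + dec t := by
    intro m t
    apply hinj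
    rw [hdec, hmk, map_add, hdec, add_sub_assoc]
  refine ⟨f, dec, map_add f, fun m t ht => ?_, hshift⟩
  rw [hshift]
  suffices dec t = 0 by rw [this, add_zero]
  by_contra h
  have h1 := hf _ h
  rw [hdec] at h1
  have h2 : hammingNorm (t - lead (C.mkQ t)) ≤ hammingNorm t + hammingNorm (lead (C.mkQ t)) := by
    have := hammingDist_triangle (lead (C.mkQ t)) 0 t
    rwa [hammingDist_zero_right, hammingDist_zero_left, hammingDist_eq_hammingNorm,
      neg_add_eq_sub, add_comm] at this
  have h3 := hlead2 (C.mkQ t) t rfl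
  have h4 : (k : ℝ) < 2 * hammingNorm t := by exact_mod_cast (by omega)
  push_cast at ht
  linarith

theorem ErrorCorrectingCode.nonempty : Nonempty ErrorCorrectingCode := by
  choose enc dec h1 h2 h3 using exists_ecc
  exact ⟨⟨5, by norm_num, 1 / 10, by norm_num, enc, dec, h1, h2, h3⟩⟩

/-! ### The channel -/

theorem bitAt_fin {n : ℕ} (v : Bits n) (i : Fin n) : bitAt v i = v i := by
  rw [bitAt, dif_pos i.2]

theorem before_apply {y : ℕ → Bit} {t i : ℕ} (h : i < t) : before y t i = y i := if_pos h

theorem before_congr {y y' : ℕ → Bit} {t : ℕ} (h : ∀ i < t, y i = y' i) :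
    before y t = before y' t := by
  funext i
  by_cases hi : i < t <;> simp [before, hi, h]

theorem before_before {y : ℕ → Bit} {t t' : ℕ} (h : t ≤ t') :
    before (before y t') t = before y t :=
  before_congr fun _ hi => before_apply (hi.trans_le h)

theorem sent_before (A B : Party) (y : ℕ → Bit) {t t' : ℕ} (h : t ≤ t') :
    sent A B (before y t') t = sent A B y t := by
  rw [sent, sent, before_before h]

section Channel

variable (A B : Party) (adv : Adversary)

theorem transcript_of_lt (t i : ℕ) (hi : i < t) :
    transcript A B adv t i = received A B adv i := by
  induction t with
  | zero => omega
  | succ t ih =>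
    rcases Nat.lt_succ_iff_lt_or_eq.1 hi with h | rfl
    · rw [transcript, Function.update_of_ne h.ne, ih h]
    · rfl

theorem transcript_of_ge (t i : ℕ) (hi : t ≤ i) : transcript A B adv t i = 0 := by
  induction t with
  | zero => rfl
  | succ t ih =>
    rw [transcript, Function.update_of_ne (by omega), ih (by omega)]

theorem transcript_eq_before (t : ℕ) :
    transcript A B adv t = before (received A B adv) t := by
  funext i
  by_cases h : i < t
  · rw [transcript_of_lt _ _ _ _ _ h, before_apply h]
  · rw [transcript_of_ge _ _ _ _ _ (not_lt.1 h), before, if_neg h]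

theorem received_of_sent {t : ℕ} {b : Bit} (h : sent A B (received A B adv) t = some b) :
    received A B adv t = b + adv.flip t := by
  rw [received, transcript]
  simp only [transcript_eq_before, Function.update_self, sent_before _ _ _ le_rfl, h]

theorem received_succ_of_silent {t : ℕ} (h : sent A B (received A B adv) t = none)
    (h' : sent A B (received A B adv) (t + 1) = none) :
    received A B adv (t + 1) = received A B adv t + adv.flip (t + 1) := by
  rw [received, transcript]
  simp only [transcript_eq_before, Function.update_self, sent_before _ _ _ le_rfl, h',
    Nat.add_sub_cancel, sent_before _ _ _ (Nat.le_succ _), h]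
  rw [if_pos ⟨by omega, trivial⟩, before_apply (Nat.lt_succ_self t)]

open Classical in
/-- The flips that count: those of bits that are sent, and those in a silent period after its
first step. -/
noncomputable def chargedFlips : Finset ℕ :=
  adv.flips.filter (fun t => sent A B (received A B adv) t ≠ none ∨
    (0 < t ∧ sent A B (received A B adv) (t - 1) = none))

variable {A B adv}

theorem mem_chargedFlips_of_sent {t : ℕ} {b : Bit} (h : sent A B (received A B adv) t = some b)
    (ht : adv.flip t ≠ 0) : t ∈ chargedFlips A B adv := by
  classical
  have : t ∈ adv.flips := by
    by_contra hn
    exact ht (if_neg hn)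
  exact Finset.mem_filter.2 ⟨this, Or.inl (by simp [h])⟩

theorem mem_chargedFlips_of_silent {t : ℕ} (h : sent A B (received A B adv) t = none)
    (ht : adv.flip (t + 1) ≠ 0) : t + 1 ∈ chargedFlips A B adv := by
  classical
  have : t + 1 ∈ adv.flips := by
    by_contra hn
    exact ht (if_neg hn)
  exact Finset.mem_filter.2 ⟨this, Or.inr ⟨by omega, by simpa using h⟩⟩

end Channel

/-! ### Lengths and times -/

theorem logq_pos {L : ℕ} (hL : 2 ≤ L) : 0 < logq L := Nat.clog_pos (by norm_num) hL

theorem le_two_pow_logq (L : ℕ) : L ≤ 2 ^ logq L := Nat.le_pow_clog (by norm_num) L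

theorem logq_lt {L : ℕ} (hL : 2 ≤ L) : logq L < L := by
  have h := logq_pos hL
  have h1 : 2 ^ (logq L - 1) < L := Nat.pow_pred_clog_lt_self (by norm_num) (by omega)
  have h2 : logq L - 1 < 2 ^ (logq L - 1) := Nat.lt_two_pow_self
  omega

theorem deg_add_one {L : ℕ} (hL : 2 ≤ L) : deg L + 1 = (L + logq L - 1) / logq L := by
  have h := logq_pos hL
  have : 1 ≤ (L + logq L - 1) / logq L := (Nat.le_div_iff_mul_le h).2 (by omega)
  rw [deg]; omega

theorem le_deg_mul {L : ℕ} (hL : 2 ≤ L) : L ≤ (deg L + 1) * logq L := by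
  rw [deg_add_one hL]
  have h := logq_pos hL
  have h1 := Nat.div_add_mod (L + logq L - 1) (logq L)
  have h2 := Nat.mod_lt (L + logq L - 1) h
  rw [mul_comm] at h1
  omega

theorem deg_mul_lt {L : ℕ} (hL : 2 ≤ L) : deg L * logq L < L := by
  have h1 := Nat.div_mul_le_self (L + logq L - 1) (logq L)
  rw [← deg_add_one hL, add_mul, one_mul] at h1
  have h := logq_pos hL
  omega

theorem deg_pos {L : ℕ} (hL : 2 ≤ L) : 0 < deg L := by
  by_contra h
  have h0 : deg L = 0 := by omega
  have h1 := le_deg_mul hL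
  have h2 := logq_lt hL
  rw [h0] at h1
  omega

theorem deg_lt {L : ℕ} (hL : 2 ≤ L) : deg L < L := by
  have h1 := deg_mul_lt hL
  have h2 := Nat.le_mul_of_pos_right (deg L) (logq_pos hL)
  omega

theorem two_mul_deg_le {L : ℕ} (hL : 2 ≤ L) : 2 * deg L ≤ 2 ^ logq L := by
  have h1 := deg_mul_lt hL
  have h2 := le_two_pow_logq L
  rcases Nat.lt_or_ge (logq L) 2 with h | h
  · have h3 : logq L = 1 := by have := logq_pos hL; omega
    rw [h3] at h1 h2 ⊢
    omega
  · have := Nat.mul_le_mul_left (deg L) h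
    omega

namespace Setup

variable (S : Setup)

/-- The parameter ranges of the theorem. -/
structure Valid : Prop where
  two_le : 2 ≤ S.L
  δ_pos : 0 < S.δ
  δ_lt : S.δ < 1

/-- `⌈log₂ (L / η_j)⌉`, the unit in which the lengths of round `j` are measured. -/
noncomputable def lg (j : ℕ) : ℕ := clog2 (S.L / S.η j)

/-- The value of `⌈log₂ (L / η_j)⌉` for `j < d`. -/
noncomputable def lgBase : ℕ := clog2 (6 * deg S.L * S.L / S.δ)

variable {S}

theorem b_eq (j : ℕ) : S.b j = S.E.Ce * S.κ * S.lg j := by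
  rw [b, w, lg, mul_assoc]

theorem start_one : S.start 1 = (deg S.L + 1) * logq S.L := by simp [start]

theorem start_succ {j : ℕ} (hj : 1 ≤ j) : S.start (j + 1) = S.start j + 4 * S.b j := by
  rw [start, start, Finset.sum_Ico_succ_top hj, add_assoc]

theorem start_mono {i j : ℕ} (h : i ≤ j) : S.start i ≤ S.start j := by
  rw [start, start]
  exact Nat.add_le_add_left
    (Finset.sum_le_sum_of_subset (Finset.Ico_subset_Ico_right h)) _

theorem roundOf_of_lt {t : ℕ} (ht : t < S.start 1) : S.roundOf t = 0 := by
  rw [roundOf, Nat.findGreatest_eq_zero_iff]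
  intro n hn _ h
  have := start_mono (S := S) (Nat.succ_le_of_lt hn)
  simp only [Nat.succ_eq_add_one, zero_add] at this
  omega

theorem slot_end_le {j s i : ℕ} (hj : 1 ≤ j) (hs : s < 4) (hi : i < S.b j) :
    S.start j + s * S.b j + i < S.start (j + 1) := by
  rw [start_succ hj]
  have : s * S.b j + S.b j ≤ 4 * S.b j := by
    rw [← Nat.succ_mul]; exact Nat.mul_le_mul_right _ hs
  omega

theorem slot_div {j s i : ℕ} (hi : i < S.b j) :
    (S.start j + s * S.b j + i - S.start j) / S.b j = s := by
  rw [add_assoc, Nat.add_sub_cancel_left, Nat.add_comm, Nat.add_mul_div_right _ _ (by omega),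
    Nat.div_eq_of_lt hi, zero_add]

theorem slot_mod {j s i : ℕ} (hi : i < S.b j) :
    (S.start j + s * S.b j + i - S.start j) % S.b j = i := by
  rw [add_assoc, Nat.add_sub_cancel_left, Nat.add_comm, Nat.add_mul_mod_self_right,
    Nat.mod_eq_of_lt hi]

theorem b_ge (j : ℕ) : 71 * S.lg j ≤ S.b j := by
  rw [b_eq]
  refine Nat.mul_le_mul_right _ ?_
  have h1 : 71 ≤ S.κ := le_max_left _ _
  have h2 := S.E.Ce_pos
  nlinarith

namespace Valid

variable (hS : S.Valid)

include hS

theorem L_pos : (0 : ℝ) < S.L := by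
  have := hS.two_le; exact_mod_cast (by omega)

theorem one_le_L : (1 : ℝ) ≤ S.L := by
  have := hS.two_le; exact_mod_cast (by omega)

theorem one_le_deg : (1 : ℝ) ≤ deg S.L := by
  have := deg_pos hS.two_le; exact_mod_cast (by omega)

theorem η_pos (j : ℕ) : 0 < S.η j := by
  have := hS.one_le_deg
  have := hS.δ_pos
  rw [η]; positivity

theorem η_lt_one (j : ℕ) : S.η j < 1 := by
  have h1 := hS.one_le_deg
  have h2 := hS.δ_pos
  have h3 := hS.δ_lt
  have h4 : (1 / 2 : ℝ) ^ (j / deg S.L) ≤ 1 := pow_le_one₀ (by norm_num) (by norm_num)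
  rw [η, div_lt_one (by positivity)]
  nlinarith

theorem one_lt_base : 1 < 6 * deg S.L * S.L / S.δ := by
  have h1 := hS.one_le_deg
  have h2 := hS.one_le_L
  rw [lt_div_iff₀ hS.δ_pos]
  have := hS.δ_lt
  nlinarith

theorem lgBase_pos : 0 < S.lgBase := clog2_pos hS.one_lt_base

theorem lg_eq (j : ℕ) : S.lg j = S.lgBase + j / deg S.L := by
  have h1 := hS.one_le_deg
  have h2 := hS.δ_pos
  rw [lg, lgBase, ← clog2_mul_two_pow hS.one_lt_base.le]
  congr 1
  rw [η, one_div, inv_pow]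
  field_simp

theorem lg_pos (j : ℕ) : 0 < S.lg j := by
  rw [hS.lg_eq]; exact Nat.add_pos_left hS.lgBase_pos _

theorem le_two_pow_lg (j : ℕ) : S.L / S.η j ≤ 2 ^ S.lg j :=
  le_two_pow_clog2 (div_pos hS.L_pos (hS.η_pos j))

theorem half_pow_lg_le (j : ℕ) : (1 / 2 : ℝ) ^ S.lg j ≤ S.η j := by
  have h1 := hS.le_two_pow_lg j
  have h2 := hS.η_pos j
  have h3 := hS.one_le_L
  rw [div_le_iff₀ h2] at h1
  rw [one_div, inv_pow, inv_le_iff_one_le_mul₀ (by positivity), mul_comm]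
  linarith

theorem clog2_inv_le (j : ℕ) : clog2 (1 / S.η j) ≤ S.lg j := by
  have h2 := hS.η_pos j
  have h3 := hS.one_le_L
  exact clog2_mono (by positivity) (by gcongr)

/-- A message of at most `a * ⌈log₂ (L / η_j)⌉` bits fits, after AMD encoding, into the common
length of the messages of round `j`. -/
theorem amd_length_le (j x : ℕ) (hx0 : 0 < x)
    (hx : x ≤ (S.F.Cs + S.F.Ch + 2) * S.lg j) :
    x + S.A.Ca * clog2 (x / S.η j) ≤ S.w j := by
  have h2 := hS.η_pos j
  have h3 := hS.one_le_L
  set a := S.F.Cs + S.F.Ch + 2 with ha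
  have h1 : clog2 (x / S.η j) ≤ a + 2 * S.lg j := by
    rw [clog2_le_iff (by positivity)]
    have e1 : (x : ℝ) ≤ 2 ^ (a + S.lg j) := by
      have : x ≤ 2 ^ (a + S.lg j) := by
        refine hx.trans ?_
        rw [pow_add]
        exact Nat.mul_le_mul Nat.lt_two_pow_self.le Nat.lt_two_pow_self.le
      exact_mod_cast this
    have e2 : 1 / S.η j ≤ 2 ^ S.lg j := by
      refine le_trans ?_ (hS.le_two_pow_lg j)
      gcongr
    calc (x : ℝ) / S.η j = x * (1 / S.η j) := by ring
      _ ≤ 2 ^ (a + S.lg j) * 2 ^ S.lg j := mul_le_mul e1 e2 (by positivity) (by positivity)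
      _ = _ := by rw [← pow_add]; congr 1; omega
  have h4 := hS.lg_pos j
  have h5 : clog2 (x / S.η j) ≤ (a + 2) * S.lg j := by nlinarith
  calc x + S.A.Ca * clog2 (x / S.η j) ≤ a * S.lg j + S.A.Ca * ((a + 2) * S.lg j) := by gcongr
    _ = (a + S.A.Ca * (a + 2)) * S.lg j := by ring
    _ ≤ _ := Nat.mul_le_mul_right _ (le_max_right _ _)

theorem fpLen_pos (j : ℕ) : 0 < S.fpLen j := by
  have h1 := hS.lg_pos j
  have := Nat.mul_pos S.F.Cs_pos h1
  rw [fpLen, seedLen]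
  exact Nat.add_pos_left this _

theorem fp_length_le (j : ℕ) : S.fpLen j + S.A.Ca * clog2 (S.fpLen j / S.η j) ≤ S.w j := by
  refine hS.amd_length_le j _ (hS.fpLen_pos j) ?_
  have h1 := hS.clog2_inv_le j
  calc S.fpLen j ≤ S.F.Cs * S.lg j + S.F.Ch * S.lg j := by
        rw [fpLen, seedLen]; gcongr; rfl
    _ ≤ _ := by rw [← add_mul]; exact Nat.mul_le_mul_right _ (by omega)

theorem logq_le_lg (j : ℕ) : logq S.L ≤ S.lg j := by
  rw [logq, ← clog2_natCast]
  refine clog2_mono hS.L_pos ?_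
  rw [le_div_iff₀ (hS.η_pos j)]
  have := hS.η_lt_one j
  have := hS.L_pos
  nlinarith

theorem pairLen_pos : 0 < S.pairLen := by
  have := logq_pos hS.two_le
  rw [pairLen]; omega

theorem pair_length_le (j : ℕ) : S.pairLen + S.A.Ca * clog2 (S.pairLen / S.η j) ≤ S.w j := by
  refine hS.amd_length_le j _ hS.pairLen_pos ?_
  have h1 := hS.logq_le_lg j
  rw [pairLen]
  nlinarith [Nat.zero_le (S.F.Cs * S.lg j), Nat.zero_le (S.F.Ch * S.lg j)]

theorem b_pos (j : ℕ) : 0 < S.b j := by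
  have h1 := b_ge (S := S) j
  have h2 := hS.lg_pos j
  omega

theorem le_start {j : ℕ} (hj : 1 ≤ j) : j ≤ S.start j := by
  induction j, hj using Nat.le_induction with
  | base =>
    rw [start_one]
    have := le_deg_mul hS.two_le
    have := hS.two_le
    omega
  | succ j hj ih =>
    rw [start_succ hj]
    have := hS.b_pos j
    omega

theorem roundOf_eq {j t : ℕ} (hj : 1 ≤ j) (h1 : S.start j ≤ t) (h2 : t < S.start (j + 1)) :
    S.roundOf t = j := by
  rw [roundOf, Nat.findGreatest_eq_iff]
  refine ⟨(hS.le_start hj).trans h1, fun _ => h1, fun n hn _ h => ?_⟩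
  have := start_mono (S := S) (Nat.succ_le_of_lt hn)
  simp only [Nat.succ_eq_add_one] at this
  omega

theorem roundOf_slot {j s i : ℕ} (hj : 1 ≤ j) (hs : s < 4) (hi : i < S.b j) :
    S.roundOf (S.start j + s * S.b j + i) = j :=
  hS.roundOf_eq hj (by omega) (slot_end_le hj hs hi)

end Valid

end Setup

namespace Setup

/-! ### Locality: what the players know depends on earlier deliveries only -/

section Locality

variable {S : Setup} {y y' : ℕ → Bit}

theorem slot_congr {j s : ℕ} (h : ∀ i < S.start j + (s + 1) * S.b j, y i = y' i) :
    S.slot y j s = S.slot y' j s := by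
  funext i
  refine h _ ?_
  have := i.2
  rw [add_mul, one_mul]
  omega

theorem slot_congr_of_round {j s : ℕ} (hj : 1 ≤ j) (hs : s < 4)
    (h : ∀ i < S.start (j + 1), y i = y' i) : S.slot y j s = S.slot y' j s :=
  funext fun i => h _ (slot_end_le hj hs i.2)

theorem decoded_congr {j s : ℕ} (h : S.slot y j s = S.slot y' j s) :
    S.decoded y j s = S.decoded y' j s := by
  rw [decoded, decoded, h]

theorem echo_congr (M : Bits S.L) {j : ℕ} (h : ∀ i < S.start j + S.b j, y i = y' i) :
    S.echo M y j = S.echo M y' j := by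
  have h1 : S.decoded y j 0 = S.decoded y' j 0 := decoded_congr (slot_congr (by simpa using h))
  rw [echo, echo, Accepts, Accepts, h1]

theorem aliceRuns_congr {j : ℕ} (h : ∀ i < S.start j, y i = y' i) :
    S.AliceRuns y j ↔ S.AliceRuns y' j := by
  refine forall_congr' fun i => forall_congr' fun h1 => forall_congr' fun h2 => ?_
  rw [slot_congr_of_round h1 (by norm_num) fun k hk => h k (hk.trans_le (start_mono h2))]

theorem guess_congr {j : ℕ} (hj : 1 ≤ j) (h : ∀ i < S.start j, y i = y' i) :
    S.guess y j = S.guess y' j := by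
  rw [guess, guess]
  congr 2
  rw [tuples, tuples]
  congr 1
  · refine Multiset.map_congr rfl fun n hn => ?_
    congr 2
    funext a
    refine h _ ?_
    refine lt_of_lt_of_le ?_ (start_mono hj)
    rw [start_one]
    have h1 : n + 1 ≤ deg S.L + 1 := Multiset.mem_range.1 hn
    have h2 := Nat.mul_le_mul_right (logq S.L) h1
    rw [add_mul, one_mul] at h2
    have := a.2
    omega
  · refine Finset.sum_congr rfl fun i hi => ?_
    obtain ⟨h1, h2⟩ := Finset.mem_Ico.1 hi
    have : S.receivedPair y i = S.receivedPair y' i := by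
      rw [receivedPair, receivedPair, decoded_congr]
      exact slot_congr_of_round h1 (by norm_num) fun k hk => h k (hk.trans_le (start_mono h2))
    rw [this]

theorem fingerprint_congr {r r' : (j : ℕ) → S.BobCoins j} {j : ℕ} (hj : 1 ≤ j)
    (h : ∀ i < S.start j, y i = y' i) (hr : r j = r' j) :
    S.fingerprint r y j = S.fingerprint r' y' j := by
  rw [fingerprint, fingerprint, guess_congr hj h, hr]

theorem matches_congr {r r' : (j : ℕ) → S.BobCoins j} {j : ℕ} (hj : 1 ≤ j)
    (h : ∀ i < S.start j + 2 * S.b j, y i = y' i) (hr : r j = r' j) :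
    S.Matches r y j ↔ S.Matches r' y' j := by
  rw [Matches, Matches, fingerprint_congr hj (fun i hi => h i (by omega)) hr,
    decoded_congr (slot_congr h)]

theorem bobRuns_congr {r r' : (j : ℕ) → S.BobCoins j} {j : ℕ}
    (h : ∀ i < S.start j, y i = y' i) (hr : ∀ i < j, r i = r' i) :
    S.BobRuns r y j ↔ S.BobRuns r' y' j := by
  refine forall_congr' fun i => forall_congr' fun h1 => forall_congr' fun h2 => ?_
  rw [matches_congr h1 (fun k hk => h k ?_) (hr i h2)]
  have := start_mono (S := S) (Nat.succ_le_of_lt h2)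
  rw [Nat.succ_eq_add_one, start_succ h1] at this
  omega

end Locality

/-! ### What is sent and delivered in the slots of a round -/

section Slots

variable {S : Setup} {M : Bits S.L} {a : (j : ℕ) → S.AliceCoins j} {r : (j : ℕ) → S.BobCoins j}
  {y : ℕ → Bit}

theorem alice_initial {t : ℕ} (ht : t < S.start 1) :
    S.alice M a y t =
      some (bitAt (S.conv.evalBits (S.conv.encode M) (t / logq S.L)) (t % logq S.L)) := by
  rw [alice]
  simp only [roundOf_of_lt ht, if_true]

theorem bob_initial {t : ℕ} (ht : t < S.start 1) : S.bob r y t = none := by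
  rw [bob]
  simp only [roundOf_of_lt ht, if_true]

open Classical in
theorem Valid.alice_slot (hS : S.Valid) {j s i : ℕ} (hj : 1 ≤ j) (hs : s < 4) (hi : i < S.b j) :
    S.alice M a y (S.start j + s * S.b j + i) =
      if S.AliceRuns y j then
        match s with
        | 1 => some (bitAt (S.echo M y j) i)
        | 3 => if IsSilence (S.slot y j 2) then none else some (bitAt (S.evaluations M a j) i)
        | _ => none
      else none := by
  have hk := hS.roundOf_slot hj hs hi
  simp only [alice]
  generalize S.roundOf (S.start j + s * S.b j + i) = k at hk ⊢
  subst hk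
  simp only [slot_div hi, slot_mod hi]
  exact if_neg (by omega)

open Classical in
theorem Valid.bob_slot (hS : S.Valid) {j s i : ℕ} (hj : 1 ≤ j) (hs : s < 4) (hi : i < S.b j) :
    S.bob r y (S.start j + s * S.b j + i) =
      if S.BobRuns r y j then
        match s with
        | 0 => some (bitAt (S.E.enc (S.w j) (S.fingerprint r y j)) i)
        | 2 => if S.Matches r y j then none else some (bitAt (r j).2.2 i)
        | _ => none
      else none := by
  have hk := hS.roundOf_slot hj hs hi
  simp only [bob]
  generalize S.roundOf (S.start j + s * S.b j + i) = k at hk ⊢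
  subst hk
  simp only [slot_div hi, slot_mod hi]
  exact if_neg (by omega)

theorem sent_initial {t : ℕ} (ht : t < S.start 1) :
    sent (S.alice M a) (S.bob r) y t =
      some (bitAt (S.conv.evalBits (S.conv.encode M) (t / logq S.L)) (t % logq S.L)) := by
  rw [sent, alice_initial ht, Option.some_or]

theorem aliceRuns_before {j t : ℕ} (h : S.start j ≤ t) :
    S.AliceRuns (before y t) j ↔ S.AliceRuns y j :=
  aliceRuns_congr fun _ hi => before_apply (hi.trans_le h)

theorem bobRuns_before {j t : ℕ} (h : S.start j ≤ t) :
    S.BobRuns r (before y t) j ↔ S.BobRuns r y j :=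
  bobRuns_congr (fun _ hi => before_apply (hi.trans_le h)) fun _ _ => rfl

theorem matches_before {j i : ℕ} (hj : 1 ≤ j) :
    S.Matches r (before y (S.start j + 2 * S.b j + i)) j ↔ S.Matches r y j :=
  matches_congr hj (fun k hk => before_apply (by omega)) rfl

variable (hS : S.Valid) {j i : ℕ} (hj : 1 ≤ j) (hi : i < S.b j)
include hS hj hi

theorem sent_slot_zero (hB : S.BobRuns r y j) :
    sent (S.alice M a) (S.bob r) y (S.start j + 0 * S.b j + i) =
      some (bitAt (S.E.enc (S.w j) (S.fingerprint r y j)) i) := by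
  rw [sent, hS.alice_slot hj (by norm_num) hi, hS.bob_slot hj (by norm_num) hi,
    if_pos ((bobRuns_before (by omega)).2 hB)]
  simp only [ite_self, Option.none_or]
  rw [fingerprint_congr hj (fun k hk => before_apply (by omega)) rfl]

theorem sent_slot_one (hA : S.AliceRuns y j) :
    sent (S.alice M a) (S.bob r) y (S.start j + 1 * S.b j + i) =
      some (bitAt (S.echo M y j) i) := by
  rw [sent, hS.alice_slot hj (by norm_num) hi, if_pos ((aliceRuns_before (by omega)).2 hA)]
  simp only [Option.some_or]
  rw [echo_congr M (fun k hk => before_apply (by omega))]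

theorem sent_slot_two (hB : S.BobRuns r y j) (hM : ¬ S.Matches r y j) :
    sent (S.alice M a) (S.bob r) y (S.start j + 2 * S.b j + i) =
      some (bitAt (r j).2.2 i) := by
  rw [sent, hS.alice_slot hj (by norm_num) hi, hS.bob_slot hj (by norm_num) hi,
    if_pos ((bobRuns_before (by omega)).2 hB)]
  simp only [ite_self, Option.none_or]
  rw [if_neg (mt (matches_before hj).1 hM)]

theorem sent_slot_two_none (h : ¬ (S.BobRuns r y j ∧ ¬ S.Matches r y j)) :
    sent (S.alice M a) (S.bob r) y (S.start j + 2 * S.b j + i) = none := by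
  rw [sent, hS.alice_slot hj (by norm_num) hi, hS.bob_slot hj (by norm_num) hi]
  simp only [ite_self, Option.none_or]
  split_ifs with h1 h2
  · rfl
  · exact absurd ⟨(bobRuns_before (by omega)).1 h1,
      mt (matches_before hj).2 h2⟩ h
  · rfl

theorem sent_slot_three (hA : S.AliceRuns y j) (hN : ¬ IsSilence (S.slot y j 2)) :
    sent (S.alice M a) (S.bob r) y (S.start j + 3 * S.b j + i) =
      some (bitAt (S.evaluations M a j) i) := by
  have h2 : S.slot (before y (S.start j + 3 * S.b j + i)) j 2 = S.slot y j 2 :=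
    slot_congr fun k hk => before_apply (by omega)
  rw [sent, hS.alice_slot hj (by norm_num) hi, if_pos ((aliceRuns_before (by omega)).2 hA)]
  simp only
  rw [if_neg (by rwa [h2]), Option.some_or]

end Slots

/-- The error-corrected encoding of `v`, as a string of the length of a slot of round `j`. -/
noncomputable def codeword (S : Setup) (j : ℕ) (v : Bits (S.w j)) : Bits (S.b j) :=
  S.E.enc (S.w j) v

theorem dec_codeword_add (S : Setup) (j : ℕ) (v : Bits (S.w j)) (t : Bits (S.b j)) :
    S.E.dec (S.w j) (S.codeword j v + t) = v + S.E.dec (S.w j) t :=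
  S.E.dec_shift _ _ _

/-- The bits by which the adversary changes slot `s` of round `j`. -/
noncomputable def noise (S : Setup) (adv : Adversary) (j s : ℕ) : Bits (S.b j) :=
  fun i => adv.flip (S.start j + s * S.b j + i)

section Delivery

variable {S : Setup} {M : Bits S.L} {a : (j : ℕ) → S.AliceCoins j} {r : (j : ℕ) → S.BobCoins j}
  {adv : Adversary} (hS : S.Valid) {j : ℕ} (hj : 1 ≤ j)

local notation "Y" => received (S.alice M a) (S.bob r) adv

theorem slot_of_sent {s : ℕ} {v : Bits (S.b j)}
    (h : ∀ i, i < S.b j → sent (S.alice M a) (S.bob r) Y (S.start j + s * S.b j + i) =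
      some (bitAt v i)) :
    S.slot Y j s = v + S.noise adv j s := by
  funext i
  rw [slot, received_of_sent _ _ _ (h i i.2), bitAt_fin]
  rfl

theorem received_initial {t : ℕ} (ht : t < S.start 1) :
    Y t = bitAt (S.conv.evalBits (S.conv.encode M) (t / logq S.L)) (t % logq S.L) +
      adv.flip t :=
  received_of_sent _ _ _ (sent_initial ht)

include hS hj

theorem slot_zero (hB : S.BobRuns r Y j) :
    S.slot Y j 0 = S.codeword j (S.fingerprint r Y j) + S.noise adv j 0 :=
  slot_of_sent fun _ hi => sent_slot_zero hS hj hi hB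

theorem slot_one (hA : S.AliceRuns Y j) : S.slot Y j 1 = S.echo M Y j + S.noise adv j 1 :=
  slot_of_sent fun _ hi => sent_slot_one hS hj hi hA

theorem slot_two (hB : S.BobRuns r Y j) (hM : ¬ S.Matches r Y j) :
    S.slot Y j 2 = (r j).2.2 + S.noise adv j 2 :=
  slot_of_sent fun _ hi => sent_slot_two hS hj hi hB hM

theorem slot_three (hA : S.AliceRuns Y j) (hN : ¬ IsSilence (S.slot Y j 2)) :
    S.slot Y j 3 = S.evaluations M a j + S.noise adv j 3 :=
  slot_of_sent fun _ hi => sent_slot_three hS hj hi hA hN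

theorem decoded_zero (hB : S.BobRuns r Y j) :
    S.decoded Y j 0 = S.fingerprint r Y j + S.E.dec (S.w j) (S.noise adv j 0) := by
  rw [decoded, slot_zero hS hj hB, dec_codeword_add]

end Delivery

end Setup

/-! ### Majority vote and polynomial reconstruction -/

theorem sum_count_le_card {α : Type*} [DecidableEq α] (s : Finset α) (B : Multiset α) :
    ∑ x ∈ s, B.count x ≤ B.card := by
  rw [← Multiset.toFinset_sum_count_eq B]
  have : ∑ x ∈ s, B.count x = ∑ x ∈ s.filter (· ∈ B.toFinset), B.count x := by
    rw [Finset.sum_filter_of_ne]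
    intro x _ hx
    rw [Multiset.mem_toFinset]
    exact Multiset.count_ne_zero.1 hx
  rw [this]
  exact Finset.sum_le_sum_of_subset fun x hx => (Finset.mem_filter.1 hx).2

section Reconstruction

variable {L : ℕ} (c : Conventions L)

open Classical in
theorem support_maj (B : Multiset (GF L × GF L)) (R : Poly L) :
    support (c.maj B) R = ((B.map Prod.fst).toFinset.filter
      (fun x => (R : Polynomial (GF L)).eval x = c.winner B x)).card := by
  rw [support, ← Finset.card_image_of_injective (f := fun x => (x, c.winner B x)) _
    (fun a b h => (Prod.mk.inj h).1), ← Set.ncard_coe_finset]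
  congr 1
  ext ⟨x, z⟩
  simp only [Conventions.maj, Finset.coe_image, Set.mem_ofPred_eq, Set.mem_image,
    Finset.mem_coe, Finset.mem_filter, Prod.mk.injEq]
  constructor
  · rintro ⟨⟨x', hx', rfl, rfl⟩, h⟩
    exact ⟨x', ⟨hx', h⟩, rfl, rfl⟩
  · rintro ⟨x', ⟨hx', h⟩, rfl, rfl⟩
    exact ⟨⟨x', hx', rfl, rfl⟩, h⟩

theorem Poly.ncard_eval_eq_le {P Q : Poly L} (h : Q ≠ P) :
    {x | (Q : Polynomial (GF L)).eval x = (P : Polynomial (GF L)).eval x}.ncard ≤ deg L := by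
  have h0 : ((Q - P : Poly L) : Polynomial (GF L)) ≠ 0 := by
    rw [Submodule.coe_sub, sub_ne_zero]
    exact fun h' => h (Subtype.ext h')
  have h1 := ncard_eval_eq_zero_le h0
  have h2 : ((Q - P : Poly L) : Polynomial (GF L)).natDegree ≤ deg L := by
    have := (Polynomial.mem_degreeLT.1 (Q - P).2)
    rw [Polynomial.degree_eq_natDegree h0] at this
    exact Nat.lt_succ_iff.1 (by exact_mod_cast this)
  refine le_trans (le_of_eq ?_) (h1.trans h2)
  congr 1
  ext x
  simp [sub_eq_zero]

open Classical in
/-- If reconstruction from the majority values misses `P`, then at least about half of the points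
have a wrong majority value; for each of these, at least half of the copies are wrong. -/
theorem card_mul_le_of_getPoly_ne (B : Multiset (GF L × GF L)) (P : Poly L) (m : ℕ)
    (hm : ∀ x ∈ (B.map Prod.fst).toFinset, m ≤ (B.map Prod.fst).count x)
    (hne : c.getPoly (c.maj B) ≠ P) :
    (B.map Prod.fst).toFinset.card * m ≤
      4 * (B.filter fun z => (P : Polynomial (GF L)).eval z.1 ≠ z.2).card + deg L * m := by
  have : Finite (GF L) := inferInstance
  have := Fintype.ofFinite (GF L)
  set X := (B.map Prod.fst).toFinset with hX
  set Q := c.getPoly (c.maj B) with hQ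
  set p := (P : Polynomial (GF L)) with hp
  set C := B.filter fun z => p.eval z.1 ≠ z.2 with hC
  set Xb := X.filter fun x => p.eval x ≠ c.winner B x with hXb
  have h1 : (X.filter fun x => p.eval x = c.winner B x).card ≤ Xb.card + deg L := by
    have h := c.getPoly_spec (c.maj B) P
    rw [support_maj, support_maj] at h
    refine h.trans ?_
    calc _ ≤ (Xb ∪ Finset.univ.filter fun x => (Q : Polynomial (GF L)).eval x = p.eval x).card := by
          refine Finset.card_le_card fun x hx => ?_
          rw [Finset.mem_filter] at hx
          rw [Finset.mem_union, Finset.mem_filter, Finset.mem_filter]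
          by_cases hx' : p.eval x = c.winner B x
          · exact Or.inr ⟨Finset.mem_univ _, hx.2.trans hx'.symm⟩
          · exact Or.inl ⟨hx.1, hx'⟩
      _ ≤ _ := by
          refine (Finset.card_union_le _ _).trans (Nat.add_le_add_left ?_ _)
          have h2 := Poly.ncard_eval_eq_le hne
          rwa [Set.ncard_eq_toFinset_card', Set.toFinset_ofPred] at h2
  have h2 : X.card ≤ 2 * Xb.card + deg L := by
    have : (X.filter fun x => p.eval x = c.winner B x).card + Xb.card = X.card := by
      rw [hXb]
      convert Finset.card_filter_add_card_filter_not (s := X) (fun x => p.eval x = c.winner B x)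
    omega
  have h3 : ∀ x ∈ Xb, m ≤ 2 * (C.map Prod.fst).count x := by
    intro x hx
    obtain ⟨hxX, hxw⟩ := Finset.mem_filter.1 hx
    refine (hm x hxX).trans ?_
    have hsplit : B = B.filter (fun z => p.eval z.1 = z.2) + C := (Multiset.filter_add_not _ B).symm
    have e1 : (B.map Prod.fst).count x =
        ((B.filter (fun z => p.eval z.1 = z.2)).map Prod.fst).count x +
          (C.map Prod.fst).count x := by
      conv_lhs => rw [hsplit]
      rw [Multiset.map_add, Multiset.count_add]
    have e2 : ((B.filter (fun z => p.eval z.1 = z.2)).map Prod.fst).count x =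
        B.count (x, p.eval x) := by
      rw [Multiset.count_map, Multiset.filter_filter, Multiset.count_eq_card_filter_eq]
      congr 1
      refine Multiset.filter_congr fun z _ => ?_
      constructor
      · rintro ⟨rfl, h⟩; exact Prod.ext rfl h
      · rintro rfl; exact ⟨rfl, rfl⟩
    have e3 : B.count (x, c.winner B x) ≤ (C.map Prod.fst).count x := by
      rw [Multiset.count_map, hC, Multiset.filter_filter, Multiset.count_eq_card_filter_eq]
      refine Multiset.card_le_card (Multiset.monotone_filter_right B ?_)
      rintro z rfl
      exact ⟨rfl, hxw⟩
    have e4 := c.winner_spec B x (p.eval x)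
    have e5 : B.count (x, p.eval x) ≤ B.count (x, c.winner B x) := by convert e4
    omega
  have h4 : Xb.card * m ≤ 2 * C.card := by
    have h5 := sum_count_le_card Xb (C.map Prod.fst)
    rw [Multiset.card_map] at h5
    calc Xb.card * m = ∑ x ∈ Xb, m := by rw [Finset.sum_const, smul_eq_mul]
      _ ≤ ∑ x ∈ Xb, 2 * (C.map Prod.fst).count x := Finset.sum_le_sum h3
      _ ≤ _ := by rw [← Finset.mul_sum]; omega
  have h6 := Nat.mul_le_mul_right m h2
  rw [add_mul, mul_assoc] at h6
  omega

theorem nth_eq_iff {k l : ℕ} : c.nth k = c.nth l ↔ k % 2 ^ logq L = l % 2 ^ logq L := by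
  rw [Conventions.nth, Conventions.nth, c.point.injective.eq_iff, Fin.mk.injEq]

theorem exists_nth (x : GF L) : ∃ i < 2 ^ logq L, c.nth i = x := by
  refine ⟨c.point.symm x, (c.point.symm x).2, ?_⟩
  have : (⟨(c.point.symm x : ℕ) % 2 ^ logq L, Nat.mod_lt _ (by positivity)⟩ : Fin (2 ^ logq L)) =
      c.point.symm x := Fin.ext (Nat.mod_eq_of_lt (c.point.symm x).2)
  rw [Conventions.nth, this, Equiv.apply_symm_apply]

open Classical in
theorem div_le_count_nth (N : ℕ) (x : GF L) :
    N / 2 ^ logq L ≤ ((Multiset.range N).map c.nth).count x := by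
  obtain ⟨i, hi, rfl⟩ := exists_nth c x
  set q := 2 ^ logq L with hq
  rw [Multiset.count_map]
  have h1 : ((Multiset.range (N / q)).map fun l => i + q * l) ≤
      (Multiset.range N).filter fun k => c.nth i = c.nth k := by
    rw [Multiset.le_iff_subset]
    · intro k hk
      obtain ⟨l, hl, rfl⟩ := Multiset.mem_map.1 hk
      rw [Multiset.mem_filter, Multiset.mem_range]
      have h2 : l + 1 ≤ N / q := Multiset.mem_range.1 hl
      have h3 := (Nat.mul_le_mul_left q h2).trans (Nat.mul_div_le N q)
      rw [mul_add, mul_one] at h3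
      refine ⟨by omega, ?_⟩
      rw [nth_eq_iff, Nat.add_mul_mod_self_left]
    · refine (Multiset.nodup_range _).map ?_
      intro l l' h
      have hq0 : 0 < q := by positivity
      exact Nat.eq_of_mul_eq_mul_left hq0 (Nat.add_left_cancel h)
  simpa using Multiset.card_le_card h1

open Classical in
/-- Evaluations at `d + 1 + 2 * n` cyclically ordered points lead to a wrong polynomial only if a
constant fraction of them is wrong. -/
theorem le_mul_card_bad (hL : 2 ≤ L) (n : ℕ) (B : Multiset (GF L × GF L)) (P : Poly L)
    (hB : B.map Prod.fst = (Multiset.range (deg L + 1 + 2 * n)).map c.nth)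
    (hne : c.getPoly (c.maj B) ≠ P) :
    n + 1 ≤ 16 * (B.filter fun z => (P : Polynomial (GF L)).eval z.1 ≠ z.2).card := by
  set N := deg L + 1 + 2 * n with hN
  set q := 2 ^ logq L with hq
  have hq0 : 0 < q := by positivity
  rcases Nat.lt_or_ge N q with h | h
  · -- Every point occurs at most once.
    have h1 := card_mul_le_of_getPoly_ne c B P 1
      (fun x hx => Multiset.count_pos.2 (Multiset.mem_toFinset.1 hx)) hne
    have h2 : (B.map Prod.fst).toFinset.card = N := by
      rw [hB, Multiset.toFinset_card_of_nodup, Multiset.card_map, Multiset.card_range]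
      refine Multiset.Nodup.map_on ?_ (Multiset.nodup_range _)
      intro k hk l hl hkl
      rw [Multiset.mem_range] at hk hl
      rwa [nth_eq_iff, Nat.mod_eq_of_lt (hk.trans h), Nat.mod_eq_of_lt (hl.trans h)] at hkl
    rw [h2] at h1
    omega
  · -- Every field element occurs at least `N / q` times.
    have h1 := card_mul_le_of_getPoly_ne c B P (N / q)
      (fun x _ => by rw [hB]; exact div_le_count_nth c N x) hne
    have h2 : q ≤ (B.map Prod.fst).toFinset.card := by
      rw [hB]
      calc q = ((Multiset.range q).map c.nth).toFinset.card := by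
            rw [Multiset.toFinset_card_of_nodup, Multiset.card_map, Multiset.card_range]
            refine Multiset.Nodup.map_on ?_ (Multiset.nodup_range _)
            intro k hk l hl hkl
            rw [Multiset.mem_range] at hk hl
            rwa [nth_eq_iff, Nat.mod_eq_of_lt hk, Nat.mod_eq_of_lt hl] at hkl
        _ ≤ _ := by
            refine Finset.card_le_card (Multiset.toFinset_subset.2 ?_)
            exact Multiset.map_subset_map (Multiset.range_subset.2 h)
    have h3 := (Nat.mul_le_mul_right (N / q) h2).trans h1
    have h4 := Nat.mul_le_mul_right (N / q) (show 2 * deg L ≤ q from two_mul_deg_le hL)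
    have h5 : 1 ≤ N / q := (Nat.one_le_div_iff hq0).2 h
    have h6 := Nat.div_add_mod N q
    have h7 := Nat.mod_lt N hq0
    have h8 : q ≤ q * (N / q) := Nat.le_mul_of_pos_right q h5
    rw [mul_assoc] at h4
    omega

end Reconstruction

/-! ### The effect of flips on a round -/

theorem resize_apply {m n : ℕ} (v : Bits m) (i : Fin n) (h : (i : ℕ) < m) :
    resize n v i = v ⟨i, h⟩ := by
  rw [resize, bitAt, dif_pos h]

theorem resize_resize {m n : ℕ} (h : m ≤ n) (v : Bits m) : resize m (resize n v) = v := by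
  funext i
  rw [resize_apply _ _ (i.2.trans_le h)]
  exact resize_apply v _ i.2

theorem resize_add {m n : ℕ} (u v : Bits m) : resize n (u + v) = resize n u + resize n v := by
  funext i
  by_cases h : (i : ℕ) < m <;> simp [resize, bitAt, h]

theorem resize_append {m n : ℕ} (u : Bits m) (v : Bits n) :
    resize m (Fin.append u v) = u := by
  funext i
  rw [resize_apply _ _ (by omega)]
  exact Fin.append_left u v i

namespace Setup

section Corruption

variable (S : Setup) (C : Finset ℕ)

/-- The flips of round `j` among the flips in `C`. -/
noncomputable def roundFlips (j : ℕ) : Finset ℕ :=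
  C.filter fun t => S.start j ≤ t ∧ t < S.start (j + 1)

/-- The fraction of the bits of a slot (`ρ` for error correction, `1 / 3` for silence) that has
to be flipped in order to make the players misunderstand each other in that slot. -/
noncomputable def threshold : ℝ := min S.E.ρ (1 / 3)

/-- A round is corrupted if the flips in it could have prevented the decoding of one of its error
correcting codewords or the recognition of silence. -/
def Corrupted (j : ℕ) : Prop := S.threshold * S.b j ≤ (S.roundFlips C j).card

variable {S C}

theorem threshold_pos : 0 < S.threshold := lt_min S.E.ρ_pos (by norm_num)

theorem card_le_card_roundFlips {j s : ℕ} (hj : 1 ≤ j) (hs : s < 4) (I : Finset ℕ)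
    (hI : ∀ i ∈ I, i < S.b j ∧ S.start j + s * S.b j + i ∈ C) :
    I.card ≤ (S.roundFlips C j).card := by
  refine Finset.card_le_card_of_injOn (fun i => S.start j + s * S.b j + i) ?_
    fun i _ i' _ h => Nat.add_left_cancel h
  intro i hi
  obtain ⟨h1, h2⟩ := hI i hi
  exact Finset.mem_filter.2 ⟨h2, by simp only; omega, slot_end_le hj hs h1⟩

theorem dec_codeword_add_noise {adv : Adversary} {j s : ℕ} (hj : 1 ≤ j) (hs : s < 4)
    (hC : ∀ i < S.b j, adv.flip (S.start j + s * S.b j + i) ≠ 0 →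
      S.start j + s * S.b j + i ∈ C)
    (h : ¬ S.Corrupted C j) (v : Bits (S.w j)) :
    S.E.dec (S.w j) (S.codeword j v + S.noise adv j s) = v := by
  classical
  refine S.E.dec_correct _ _ _ ?_
  have h1 : hammingNorm (S.noise adv j s) ≤ (S.roundFlips C j).card := by
    rw [hammingNorm, ← Finset.card_map Fin.valEmbedding]
    refine card_le_card_roundFlips hj hs _ fun i hi => ?_
    obtain ⟨i, hi', rfl⟩ := Finset.mem_map.1 hi
    exact ⟨i.2, hC i i.2 (Finset.mem_filter.1 hi').2⟩
  have h2 := not_le.1 h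
  calc ((hammingNorm (S.noise adv j s) : ℕ) : ℝ) ≤ (S.roundFlips C j).card := by exact_mod_cast h1
    _ ≤ S.threshold * S.b j := h2.le
    _ ≤ S.E.ρ * S.b j := by gcongr; exact min_le_left _ _

theorem dec_noise_eq_zero {adv : Adversary} {j s : ℕ} (hj : 1 ≤ j) (hs : s < 4)
    (hC : ∀ i < S.b j, adv.flip (S.start j + s * S.b j + i) ≠ 0 →
      S.start j + s * S.b j + i ∈ C)
    (h : ¬ S.Corrupted C j) : S.E.dec (S.w j) (S.noise adv j s) = 0 := by
  have h1 := dec_codeword_add_noise hj hs hC h 0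
  rwa [dec_codeword_add, zero_add] at h1

theorem isSilence_of_not_corrupted {y : ℕ → Bit} {j : ℕ} (hj : 1 ≤ j)
    (hC : ∀ i, i + 1 < S.b j →
      y (S.start j + 2 * S.b j + i) ≠ y (S.start j + 2 * S.b j + (i + 1)) →
      S.start j + 2 * S.b j + (i + 1) ∈ C)
    (h : ¬ S.Corrupted C j) : IsSilence (S.slot y j 2) := by
  have h1 : alternations (S.slot y j 2) ≤ (S.roundFlips C j).card := by
    rw [alternations, ← Finset.card_map (addRightEmbedding 1)]
    refine card_le_card_roundFlips hj (s := 2) (by norm_num) _ fun i hi => ?_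
    obtain ⟨i, hi', rfl⟩ := Finset.mem_map.1 hi
    obtain ⟨h2, h3⟩ := Finset.mem_filter.1 hi'
    have h4 : i + 1 < S.b j := by have := Finset.mem_range.1 h2; omega
    rw [bitAt, bitAt, dif_pos (by omega), dif_pos h4] at h3
    exact ⟨h4, hC i h4 h3⟩
  have h2 := not_le.1 h
  have h3 : S.threshold * S.b j ≤ 1 / 3 * S.b j := by gcongr; exact min_le_right _ _
  have h4 : (alternations (S.slot y j 2) : ℝ) ≤ (S.roundFlips C j).card := by exact_mod_cast h1
  have h5 : (3 * alternations (S.slot y j 2) : ℝ) < S.b j := by linarith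
  exact_mod_cast h5

end Corruption

section Messages

variable {S : Setup} {M : Bits S.L} {y : ℕ → Bit} {j : ℕ}

/-- The fingerprint of the string `m` in round `j`, with seed `s`. -/
noncomputable def fpOf (S : Setup) (j : ℕ) (s : Bits (S.seedLen j)) (m : List Bit) :
    Bits (S.fpLen j) :=
  S.F.fp S.L (S.η j) s m

theorem resize_fpOf (s : Bits (S.seedLen j)) (m : List Bit) :
    resize (S.seedLen j) (S.fpOf j s m) = s :=
  resize_append _ _

theorem accepts_iff :
    S.Accepts M y j ↔
      resize (S.w j) (resize (S.fpLen j + S.A.Ca * clog2 (S.fpLen j / S.η j)) (S.decoded y j 0)) =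
        S.decoded y j 0 ∧
      S.A.IsCodeword (η := S.η j)
        (resize (S.fpLen j + S.A.Ca * clog2 (S.fpLen j / S.η j)) (S.decoded y j 0)) ∧
      S.A.dec (S.fpLen j) (S.η j) (resize _ (S.decoded y j 0)) =
        S.fpOf j (resize (S.seedLen j) (S.A.dec (S.fpLen j) (S.η j) (resize _ (S.decoded y j 0))))
          (S.word (S.conv.encode M)) :=
  Iff.rfl

theorem echo_of_accepts (h : S.Accepts M y j) :
    S.echo M y j = S.codeword j (S.decoded y j 0) :=
  if_pos h

theorem echo_of_not_accepts (h : ¬ S.Accepts M y j) : S.echo M y j = 0 := if_neg h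

/-- The two evaluations that Alice sends in round `j`. -/
noncomputable def pairOf (S : Setup) (M : Bits S.L) (j : ℕ) : Bits S.pairLen :=
  Fin.append (S.conv.evalBits (S.conv.encode M) (deg S.L + 1 + 2 * (j - 1)))
    (S.conv.evalBits (S.conv.encode M) (deg S.L + 1 + 2 * (j - 1) + 1))

theorem evaluations_eq (a : (j : ℕ) → S.AliceCoins j) :
    S.evaluations M a j =
      S.codeword j (resize _ (S.A.enc S.pairLen (S.η j) (S.pairOf M j) (a j))) :=
  rfl

/-- The two tuples that Bob receives in round `j`. -/
noncomputable def pairTuples (S : Setup) (y : ℕ → Bit) (j : ℕ) :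
    Multiset (GF S.L × GF S.L) :=
  {(S.conv.nth (deg S.L + 1 + 2 * (j - 1)),
      S.conv.rep.symm (fun a => S.receivedPair y j (Fin.castAdd _ a))),
    (S.conv.nth (deg S.L + 1 + 2 * (j - 1) + 1),
      S.conv.rep.symm (fun a => S.receivedPair y j (Fin.natAdd _ a)))}

/-- The tuples that Bob receives before the first round. -/
noncomputable def initialTuples (S : Setup) (y : ℕ → Bit) : Multiset (GF S.L × GF S.L) :=
  (Multiset.range (deg S.L + 1)).map
    (fun n => (S.conv.nth n, S.conv.rep.symm (fun a => y (n * logq S.L + a))))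

theorem tuples_eq : S.tuples y j = S.initialTuples y + ∑ i ∈ Finset.Ico 1 j, S.pairTuples y i :=
  rfl

theorem tuples_succ (hj : 1 ≤ j) : S.tuples y (j + 1) = S.tuples y j + S.pairTuples y j := by
  rw [tuples_eq, tuples_eq, Finset.sum_Ico_succ_top hj, add_assoc]

theorem pairTuples_map_fst : (S.pairTuples y j).map Prod.fst =
    {S.conv.nth (deg S.L + 1 + 2 * (j - 1)), S.conv.nth (deg S.L + 1 + 2 * (j - 1) + 1)} := by
  rw [pairTuples, Multiset.insert_eq_cons, Multiset.map_cons, Multiset.map_singleton]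
  rfl

theorem card_pairTuples : (S.pairTuples y j).card = 2 := rfl

theorem mem_pairTuples_of_eq (h : S.receivedPair y j = S.pairOf M j) {z : GF S.L × GF S.L}
    (hz : z ∈ S.pairTuples y j) :
    (S.conv.encode M : Polynomial (GF S.L)).eval z.1 = z.2 := by
  rw [pairTuples, h, Multiset.insert_eq_cons, Multiset.mem_cons, Multiset.mem_singleton] at hz
  rcases hz with rfl | rfl
  · have h1 : (fun a => S.pairOf M j (Fin.castAdd (logq S.L) a)) =
        S.conv.evalBits (S.conv.encode M) (deg S.L + 1 + 2 * (j - 1)) :=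
      funext fun a => Fin.append_left _ _ a
    exact ((congrArg S.conv.rep.symm h1).trans (S.conv.rep.symm_apply_apply _)).symm
  · have h1 : (fun a => S.pairOf M j (Fin.natAdd (logq S.L) a)) =
        S.conv.evalBits (S.conv.encode M) (deg S.L + 1 + 2 * (j - 1) + 1) :=
      funext fun a => Fin.append_right _ _ a
    exact ((congrArg S.conv.rep.symm h1).trans (S.conv.rep.symm_apply_apply _)).symm

end Messages

section Rounds

variable {S : Setup} {M : Bits S.L} {a : (j : ℕ) → S.AliceCoins j} {r : (j : ℕ) → S.BobCoins j}
  {adv : Adversary} (hS : S.Valid) {j : ℕ} (hj : 1 ≤ j)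

local notation "Y" => received (S.alice M a) (S.bob r) adv
local notation "Charged" => chargedFlips (S.alice M a) (S.bob r) adv

include hS

theorem accepts_of_guess_eq (hB : S.decoded Y j 0 = S.fingerprint r Y j)
    (hg : S.word (S.guess Y j) = S.word (S.conv.encode M)) : S.Accepts M Y j := by
  have h1 : resize (S.fpLen j + S.A.Ca * clog2 (S.fpLen j / S.η j)) (S.fingerprint r Y j) =
      S.A.enc (S.fpLen j) (S.η j) (S.fpOf j (r j).1 (S.word (S.guess Y j))) (r j).2.1 :=
    resize_resize (hS.fp_length_le j) _
  rw [accepts_iff, hB, h1]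
  refine ⟨rfl, ⟨_, _, rfl⟩, ?_⟩
  rw [S.A.dec_enc _ _ (hS.fpLen_pos j) (hS.η_pos j) (hS.η_lt_one j), resize_fpOf, hg]

include hj

/-- In a round without corruption Bob, if he has the right polynomial, hears his fingerprint. -/
theorem matches_of_not_corrupted (hA : S.AliceRuns Y j) (hB : S.BobRuns r Y j)
    (h : ¬ S.Corrupted Charged j) (hg : S.guess Y j = S.conv.encode M) : S.Matches r Y j := by
  have h0 : S.E.dec (S.w j) (S.noise adv j 0) = 0 :=
    dec_noise_eq_zero hj (by norm_num)
      (fun i hi => mem_chargedFlips_of_sent (sent_slot_zero hS hj hi hB)) h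
  have h1 : S.E.dec (S.w j) (S.noise adv j 1) = 0 :=
    dec_noise_eq_zero hj (by norm_num)
      (fun i hi => mem_chargedFlips_of_sent (sent_slot_one hS hj hi hA)) h
  have h2 : S.decoded Y j 0 = S.fingerprint r Y j := by
    rw [decoded_zero hS hj hB, h0, add_zero]
  have h3 : S.echo M Y j = S.codeword j (S.decoded Y j 0) := by
    exact echo_of_accepts (accepts_of_guess_eq hS h2 (by rw [hg]))
  rw [Matches, decoded, slot_one hS hj hA, h3, dec_codeword_add, h1, add_zero, h2]

theorem isSilence_of_bob_silent (hB : ¬ (S.BobRuns r Y j ∧ ¬ S.Matches r Y j))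
    (h : ¬ S.Corrupted Charged j) : IsSilence (S.slot Y j 2) := by
  refine isSilence_of_not_corrupted hj (fun i hi hne => ?_) h
  have h1 := sent_slot_two_none (M := M) (a := a) hS hj (i := i) (by omega) hB
  have h2 := sent_slot_two_none (M := M) (a := a) hS hj hi hB
  rw [← add_assoc] at h2 hne ⊢
  refine mem_chargedFlips_of_silent h1 fun h0 => hne ?_
  rw [received_succ_of_silent _ _ _ h1 h2, h0, add_zero]

theorem receivedPair_of_not_corrupted (hA : S.AliceRuns Y j) (hN : ¬ IsSilence (S.slot Y j 2))
    (h : ¬ S.Corrupted Charged j) :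
    S.receivedPair Y j = S.pairOf M j := by
  have h1 : ∀ v, S.E.dec (S.w j) (S.codeword j v + S.noise adv j 3) = v :=
    dec_codeword_add_noise hj (by norm_num)
      (fun i hi => mem_chargedFlips_of_sent (sent_slot_three hS hj hi hA hN)) h
  rw [receivedPair, decoded, slot_three hS hj hA hN, evaluations_eq, h1, resize_resize (hS.pair_length_le j),
    S.A.dec_enc _ _ hS.pairLen_pos (hS.η_pos j) (hS.η_lt_one j)]

end Rounds

/-! ### Wrong evaluations -/

section Evaluations

variable {S : Setup} {M : Bits S.L} {a : (j : ℕ) → S.AliceCoins j} {r : (j : ℕ) → S.BobCoins j}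
  {adv : Adversary} (hS : S.Valid) {j : ℕ} (hj : 1 ≤ j)

local notation "Y" => received (S.alice M a) (S.bob r) adv
local notation "Charged" => chargedFlips (S.alice M a) (S.bob r) adv

/-- The flips, among those in `C`, that precede the first round. -/
noncomputable def initialFlips (S : Setup) (C : Finset ℕ) : Finset ℕ :=
  C.filter fun t => t < S.start 1

theorem tuples_map_fst (y : ℕ → Bit) (hj : 1 ≤ j) :
    (S.tuples y j).map Prod.fst =
      (Multiset.range (deg S.L + 1 + 2 * (j - 1))).map S.conv.nth := by
  induction j, hj using Nat.le_induction with
  | base => simp [tuples_eq, initialTuples]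
  | succ j hj ih =>
    have e : deg S.L + 1 + 2 * (j + 1 - 1) = deg S.L + 1 + 2 * (j - 1) + 1 + 1 := by omega
    rw [tuples_succ hj, Multiset.map_add, ih, e, Multiset.range_succ, Multiset.range_succ,
      Multiset.map_cons, Multiset.map_cons, pairTuples_map_fst, Multiset.insert_eq_cons,
      add_comm, Multiset.cons_add, Multiset.singleton_add]
    exact Multiset.cons_swap _ _ _

open Classical in
theorem card_initial_bad_le :
    ((S.initialTuples Y).filter
      fun z => (S.conv.encode M : Polynomial (GF S.L)).eval z.1 ≠ z.2).card ≤
    min (deg S.L + 1) (S.initialFlips Charged).card := by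
  refine le_min ?_ ?_
  · refine (Multiset.card_le_card (Multiset.filter_le _ _)).trans ?_
    rw [initialTuples, Multiset.card_map, Multiset.card_range]
  · rw [initialTuples, Multiset.filter_map, Multiset.card_map]
    change ((Finset.range (deg S.L + 1)).filter _).card ≤ _
    have key : ∀ n ∈ (Finset.range (deg S.L + 1)).filter ((fun z =>
        (S.conv.encode M : Polynomial (GF S.L)).eval z.1 ≠ z.2) ∘
        fun n => (S.conv.nth n, S.conv.rep.symm (fun a => Y (n * logq S.L + a)))),
        ∃ i < logq S.L, n * logq S.L + i ∈ S.initialFlips Charged := by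
      intro n hn
      obtain ⟨hn1, hn2⟩ := Finset.mem_filter.1 hn
      by_contra! hcon
      refine hn2 ?_
      change _ = S.conv.rep.symm (fun a => Y (n * logq S.L + a))
      rw [Equiv.eq_symm_apply]
      funext i
      have h1 : n + 1 ≤ deg S.L + 1 := Finset.mem_range.1 hn1
      have h2 := Nat.mul_le_mul_right (logq S.L) h1
      rw [add_mul, one_mul] at h2
      have h3 : n * logq S.L + i < S.start 1 := by
        rw [start_one]; have := i.2; omega
      have h4 : adv.flip (n * logq S.L + i) = 0 := by
        by_contra h0
        exact hcon i i.2 (Finset.mem_filter.2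
          ⟨mem_chargedFlips_of_sent (sent_initial h3) h0, h3⟩)
      have h5 : (n * logq S.L + i) / logq S.L = n := by
        rw [mul_comm, Nat.mul_add_div (by have := i.2; omega), Nat.div_eq_of_lt i.2, add_zero]
      have h6 : (n * logq S.L + i) % logq S.L = i := by
        rw [mul_comm, Nat.mul_add_mod, Nat.mod_eq_of_lt i.2]
      rw [received_initial h3, h4, add_zero, h5, h6, bitAt_fin]
      rfl
    choose! f hf1 hf2 using key
    refine Finset.card_le_card_of_injOn (fun n => n * logq S.L + f n) hf2 ?_
    intro n hn n' hn' h
    have h1 := hf1 n hn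
    have h2 := hf1 n' hn'
    have h3 := congrArg (· / logq S.L) h
    simp only at h3
    rwa [mul_comm, Nat.mul_add_div (by omega), Nat.div_eq_of_lt h1, mul_comm n',
      Nat.mul_add_div (by omega), Nat.div_eq_of_lt h2] at h3

include hS hj

open Classical in
/-- As long as Bob has a wrong polynomial, the number of rounds is bounded by the number of wrong
initial evaluations and of corrupted rounds. -/
theorem le_of_guess_ne (hA : S.AliceRuns Y j) (hg : S.guess Y j ≠ S.conv.encode M) :
    j ≤ 16 * (min (deg S.L + 1) (S.initialFlips Charged).card +
      2 * ((Finset.Ico 1 j).filter (S.Corrupted Charged)).card) := by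
  have h1 := le_mul_card_bad S.conv hS.two_le (j - 1) (S.tuples Y j) (S.conv.encode M)
    (tuples_map_fst _ hj) hg
  refine le_trans (by omega) (h1.trans (Nat.mul_le_mul_left _ ?_))
  rw [tuples_eq, Multiset.filter_add, Multiset.card_add]
  refine add_le_add card_initial_bad_le ?_
  have h2 : ∀ (f : ℕ → Multiset (GF S.L × GF S.L))
      (p : GF S.L × GF S.L → Prop) [DecidablePred p],
      ((∑ i ∈ Finset.Ico 1 j, f i).filter p).card =
        ∑ i ∈ Finset.Ico 1 j, ((f i).filter p).card := by
    intro f p _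
    induction Finset.Ico 1 j using Finset.induction_on with
    | empty => simp
    | insert i s hi ih => rw [Finset.sum_insert hi, Finset.sum_insert hi, Multiset.filter_add,
        Multiset.card_add, ih]
  rw [h2, Finset.card_filter, Finset.mul_sum]
  refine Finset.sum_le_sum fun i hi => ?_
  obtain ⟨hi1, hi2⟩ := Finset.mem_Ico.1 hi
  split_ifs with hc
  · exact (Multiset.card_le_card (Multiset.filter_le _ _)).trans (by rw [card_pairTuples, mul_one])
  · have hN := hA i hi1 hi2
    have hAi : S.AliceRuns Y i := fun k hk hki => hA k hk (hki.trans hi2)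
    have h3 := receivedPair_of_not_corrupted hS hi1 hAi hN hc
    rw [mul_zero, nonpos_iff_eq_zero, Multiset.card_eq_zero, Multiset.filter_eq_nil]
    exact fun z hz => not_not.2 (mem_pairTuples_of_eq h3 hz)

end Evaluations

end Setup

/-! ### Sums of round lengths -/

theorem sq_card_le_two_mul_sum (R : Finset ℕ) (hR : ∀ i ∈ R, 1 ≤ i) :
    R.card ^ 2 ≤ 2 * ∑ i ∈ R, i := by
  induction R using Finset.induction_on_max with
  | empty => simp
  | insert m R hm ih =>
    have hmR : m ∉ R := fun h => (hm m h).false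
    have h1 := ih fun i hi => hR i (Finset.mem_insert_of_mem hi)
    have h2 : R.card + 1 ≤ m := by
      rw [← Finset.card_insert_of_notMem hmR]
      calc (insert m R).card ≤ (Finset.Icc 1 m).card := by
            refine Finset.card_le_card fun i hi => Finset.mem_Icc.2 ⟨hR i hi, ?_⟩
            rcases Finset.mem_insert.1 hi with rfl | h
            · exact le_rfl
            · exact (hm i h).le
        _ = m := by simp
    rw [Finset.sum_insert hmR, Finset.card_insert_of_notMem hmR]
    nlinarith

section AffineSums

variable {A d : ℕ}

/-- The sum of `A + ⌊i / d⌋` over `c` distinct rounds is at least of the order `c * A + c² / d`. -/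
theorem card_mul_le_sum (hA : 0 < A) (hd : 0 < d) (R : Finset ℕ) (hR : ∀ i ∈ R, 1 ≤ i) :
    (R.card : ℝ) * A + (R.card : ℝ) ^ 2 / (2 * d) ≤ 2 * ∑ i ∈ R, ((A + i / d : ℕ) : ℝ) := by
  have hd' : (0 : ℝ) < d := by exact_mod_cast hd
  have h1 : ((R.card : ℝ)) ^ 2 ≤ 2 * ∑ i ∈ R, (i : ℝ) := by
    have h := (Nat.cast_le (α := ℝ)).2 (sq_card_le_two_mul_sum R hR)
    push_cast at h
    exact h
  have h2 : ∀ i ∈ R, (A : ℝ) + (i : ℝ) / d ≤ 2 * ((A + i / d : ℕ) : ℝ) := by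
    intro i _
    have h3 : i < d * (i / d + 1) := by
      rw [mul_add, mul_one]
      have := Nat.div_add_mod i d
      have := Nat.mod_lt i hd
      omega
    have h4 : (i : ℝ) / d ≤ ((i / d : ℕ) : ℝ) + 1 := by
      rw [div_le_iff₀ hd', mul_comm]
      exact_mod_cast h3.le
    have h5 : (1 : ℝ) ≤ A := by exact_mod_cast hA
    have h6 : (0 : ℝ) ≤ ((i / d : ℕ) : ℝ) := Nat.cast_nonneg _
    rw [Nat.cast_add]
    linarith
  have h3 := Finset.sum_le_sum h2
  rw [Finset.sum_add_distrib, Finset.sum_const, nsmul_eq_mul, ← Finset.sum_div,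
    ← Finset.mul_sum] at h3
  have h4 : (R.card : ℝ) ^ 2 / (2 * d) ≤ (∑ i ∈ R, (i : ℝ)) / d := by
    rw [div_le_div_iff₀ (by positivity) hd']
    nlinarith
  linarith

/-- If a round `j` is bounded by the number `B` of early errors, then its length is of the order
of `A`, since `B` is at most `d + 1`; if it is bounded by the number of rounds in `R`, then the sum
over all rounds up to `j` is bounded by that over the rounds in `R`. -/
theorem mul_le_of_le_errors (hA : 0 < A) (hd : 0 < d) {B j : ℕ} (hB : B ≤ d + 1) (R : Finset ℕ)
    (hR : ∀ i ∈ R, 1 ≤ i) (hj : j ≤ 16 * (B + 2 * R.card)) :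
    (j : ℝ) * ((A + j / d : ℕ) : ℝ) ≤
      4656 * A * B + 9216 * ∑ i ∈ R, ((A + i / d : ℕ) : ℝ) := by
  have hd' : (1 : ℝ) ≤ d := by exact_mod_cast hd
  have hA' : (1 : ℝ) ≤ A := by exact_mod_cast hA
  have hS : (0 : ℝ) ≤ ∑ i ∈ R, ((A + i / d : ℕ) : ℝ) :=
    Finset.sum_nonneg fun _ _ => Nat.cast_nonneg _
  have hdiv : ((j / d : ℕ) : ℝ) ≤ (j : ℝ) / d := Nat.cast_div_le
  rcases Nat.le_total R.card B with h | h
  · -- Here `j ≤ 48 * B = O(d)`, so that the length of round `j` is a constant multiple of `A`.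
    have h1 : (j : ℝ) ≤ 48 * B := by exact_mod_cast (by omega)
    have h2 : (j : ℝ) / d ≤ 96 := by
      rw [div_le_iff₀ (by linarith)]
      have : (B : ℝ) ≤ d + 1 := by exact_mod_cast hB
      linarith
    have h3 : ((A + j / d : ℕ) : ℝ) ≤ 97 * A := by
      rw [Nat.cast_add]; linarith
    calc (j : ℝ) * ((A + j / d : ℕ) : ℝ) ≤ (48 * B) * (97 * A) := by gcongr
      _ = 4656 * A * B := by ring
      _ ≤ _ := by linarith
  · -- Here both sides are of the order of `c * A + c² / d` for the cardinality `c` of `R`.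
    have h1 : (j : ℝ) ≤ 48 * R.card := by exact_mod_cast (by omega)
    have h2 := card_mul_le_sum hA hd R hR
    have h3 : ((A + j / d : ℕ) : ℝ) ≤ A + 48 * R.card / d := by
      rw [Nat.cast_add]
      gcongr
      exact hdiv.trans (by gcongr)
    have h4 : (0 : ℝ) ≤ (R.card : ℝ) * A := by positivity
    have h5 : (0 : ℝ) ≤ 4656 * A * B := by positivity
    calc (j : ℝ) * ((A + j / d : ℕ) : ℝ) ≤ (48 * R.card) * (A + 48 * R.card / d) := by gcongr
      _ = 48 * (R.card * A) + 4608 * ((R.card : ℝ) ^ 2 / (2 * d)) := by field_simp; ring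
      _ ≤ 4608 * (R.card * A + (R.card : ℝ) ^ 2 / (2 * d)) := by linarith
      _ ≤ _ := by linarith

open Classical in
theorem sum_le_of_errors (hA : 0 < A) (hd : 0 < d) {B N : ℕ} (hB : B ≤ d + 1) (R : ℕ → Prop)
    (h : ∀ j ∈ Finset.Ico 1 N, ¬ R j → j ≤ 16 * (B + 2 * ((Finset.Ico 1 j).filter R).card)) :
    ∑ j ∈ Finset.Ico 1 N, ((A + j / d : ℕ) : ℝ) ≤
      4656 * A * B + 9217 * ∑ j ∈ (Finset.Ico 1 N).filter R, ((A + j / d : ℕ) : ℝ) := by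
  have hmono : ∀ {s t : Finset ℕ}, s ⊆ t →
      ∑ j ∈ s, ((A + j / d : ℕ) : ℝ) ≤ ∑ j ∈ t, ((A + j / d : ℕ) : ℝ) := fun hst =>
    Finset.sum_le_sum_of_subset_of_nonneg hst fun _ _ _ => Nat.cast_nonneg _
  set s := (Finset.Ico 1 N).filter R with hs
  have hs0 : (0 : ℝ) ≤ ∑ j ∈ s, ((A + j / d : ℕ) : ℝ) :=
    Finset.sum_nonneg fun _ _ => Nat.cast_nonneg _
  rcases ((Finset.Ico 1 N).filter fun j => ¬ R j).eq_empty_or_nonempty with h0 | h0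
  · have h1 : Finset.Ico 1 N ⊆ s := by
      intro j hj
      by_contra hn
      have : j ∈ (Finset.Ico 1 N).filter fun j => ¬ R j :=
        Finset.mem_filter.2 ⟨hj, fun hr => hn (Finset.mem_filter.2 ⟨hj, hr⟩)⟩
      rw [h0] at this
      exact absurd this (Finset.notMem_empty j)
    have h2 := hmono h1
    have h3 : (0 : ℝ) ≤ 4656 * A * B := by positivity
    linarith
  · -- `m` is the last round outside `R`; all later rounds belong to `R`.
    set m := ((Finset.Ico 1 N).filter fun j => ¬ R j).max' h0 with hm
    obtain ⟨hm1, hm2⟩ := Finset.mem_filter.1 (Finset.max'_mem _ h0)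
    rw [← hm] at hm1 hm2
    have h1 : Finset.Ico 1 N ⊆ Finset.Ico 1 (m + 1) ∪ s := by
      intro j hj
      rw [Finset.mem_union]
      by_cases hr : R j
      · exact Or.inr (Finset.mem_filter.2 ⟨hj, hr⟩)
      · have h2 : j ≤ m := Finset.le_max' _ j (Finset.mem_filter.2 ⟨hj, hr⟩)
        exact Or.inl (Finset.mem_Ico.2 ⟨(Finset.mem_Ico.1 hj).1, by omega⟩)
    have h2 : ∑ j ∈ Finset.Ico 1 (m + 1), ((A + j / d : ℕ) : ℝ) ≤
        m * ((A + m / d : ℕ) : ℝ) := by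
      calc _ ≤ ∑ j ∈ Finset.Ico 1 (m + 1), ((A + m / d : ℕ) : ℝ) := by
            refine Finset.sum_le_sum fun j hj => ?_
            have : j ≤ m := by have := (Finset.mem_Ico.1 hj).2; omega
            exact_mod_cast Nat.add_le_add_left (Nat.div_le_div_right this) A
        _ = _ := by rw [Finset.sum_const, Nat.card_Ico, nsmul_eq_mul, Nat.add_sub_cancel]
    have h3 := mul_le_of_le_errors hA hd hB ((Finset.Ico 1 m).filter R)
      (fun i hi => (Finset.mem_Ico.1 (Finset.mem_filter.1 hi).1).1) (h m hm1 hm2)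
    have h4 : ∑ j ∈ (Finset.Ico 1 m).filter R, ((A + j / d : ℕ) : ℝ) ≤
        ∑ j ∈ s, ((A + j / d : ℕ) : ℝ) :=
      hmono (Finset.filter_subset_filter _
        (Finset.Ico_subset_Ico_right (Finset.mem_Ico.1 hm1).2.le))
    have h5 := (hmono h1).trans (Finset.sum_union_inter (s₁ := Finset.Ico 1 (m + 1))
      (s₂ := s) (f := fun j => ((A + j / d : ℕ) : ℝ)) ▸
        le_add_of_nonneg_right (Finset.sum_nonneg fun _ _ => Nat.cast_nonneg _))
    linarith

/-- The length of the last round is bounded by that of the previous one. -/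
theorem sum_succ_le (hA : 0 < A) {N : ℕ} (hN : 1 ≤ N) :
    ∑ j ∈ Finset.Ico 1 (N + 1), ((A + j / d : ℕ) : ℝ) ≤
      2 * A + 3 * ∑ j ∈ Finset.Ico 1 N, ((A + j / d : ℕ) : ℝ) := by
  have hA' : (1 : ℝ) ≤ A := by exact_mod_cast hA
  have hstep : ∀ k, ((A + (k + 1) / d : ℕ) : ℝ) ≤ ((A + k / d : ℕ) : ℝ) + 1 := by
    intro k
    have : (k + 1) / d ≤ k / d + 1 := by
      rw [Nat.succ_div]; split_ifs <;> omega
    exact_mod_cast (by omega)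
  rw [Finset.sum_Ico_succ_top hN]
  obtain ⟨k, rfl⟩ : ∃ k, N = k + 1 := ⟨N - 1, by omega⟩
  have h1 := hstep k
  rcases Nat.eq_zero_or_pos k with rfl | hk
  · simp only [Nat.zero_div, add_zero, zero_add, Finset.Ico_self, Finset.sum_empty] at h1 ⊢
    linarith
  · rw [Finset.sum_Ico_succ_top hk]
    have h2 : (0 : ℝ) ≤ ∑ j ∈ Finset.Ico 1 k, ((A + j / d : ℕ) : ℝ) :=
      Finset.sum_nonneg fun _ _ => Nat.cast_nonneg _
    have h3 : (1 : ℝ) ≤ ((A + k / d : ℕ) : ℝ) := by exact_mod_cast Nat.add_pos_left hA _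
    linarith

end AffineSums

/-! ### The number of bits sent -/

namespace Setup

section Cost

variable {S : Setup}

theorem card_initial_add_sum_round_le (C : Finset ℕ) (N : ℕ) :
    (S.initialFlips C).card + ∑ j ∈ Finset.Ico 1 N, (S.roundFlips C j).card ≤ C.card := by
  classical
  have hdisj : ∀ i j, 1 ≤ i → i < j → Disjoint (S.roundFlips C i) (S.roundFlips C j) := by
    intro i j _ hij
    rw [Finset.disjoint_left]
    intro t ht ht'
    have h1 := (Finset.mem_filter.1 ht).2.2
    have h2 := (Finset.mem_filter.1 ht').2.1
    have h3 := start_mono (S := S) (Nat.succ_le_of_lt hij)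
    rw [Nat.succ_eq_add_one] at h3
    omega
  have h1 : ∑ j ∈ Finset.Ico 1 N, (S.roundFlips C j).card =
      ((Finset.Ico 1 N).biUnion (S.roundFlips C)).card := by
    rw [Finset.card_biUnion]
    intro i hi j hj hij
    rcases Nat.lt_or_gt_of_ne hij with h | h
    · exact hdisj i j (Finset.mem_Ico.1 hi).1 h
    · exact (hdisj j i (Finset.mem_Ico.1 hj).1 h).symm
  rw [h1, ← Finset.card_union_of_disjoint]
  · refine Finset.card_le_card (Finset.union_subset (Finset.filter_subset _ _) ?_)
    exact Finset.biUnion_subset.2 fun j _ => Finset.filter_subset _ _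
  · rw [Finset.disjoint_left]
    intro t ht ht'
    obtain ⟨j, hj, hjt⟩ := Finset.mem_biUnion.1 ht'
    have h1 := (Finset.mem_filter.1 ht).2
    have h2 := (Finset.mem_filter.1 hjt).2.1
    have h3 := start_mono (S := S) (Finset.mem_Ico.1 hj).1
    omega

variable {M : Bits S.L} {a : (j : ℕ) → S.AliceCoins j} {r : (j : ℕ) → S.BobCoins j}
  {adv : Adversary} (hS : S.Valid) {j : ℕ}

local notation "Y" => received (S.alice M a) (S.bob r) adv
local notation "Charged" => chargedFlips (S.alice M a) (S.bob r) adv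

include hS

theorem roundOf_spec {t : ℕ} (hj : 1 ≤ j) (ht : S.start j ≤ t) :
    j ≤ S.roundOf t ∧ S.start (S.roundOf t) ≤ t :=
  ⟨Nat.le_findGreatest ((hS.le_start hj).trans ht) ht,
    Nat.findGreatest_spec (P := fun j => S.start j ≤ t) ((hS.le_start hj).trans ht) ht⟩

theorem sendSteps_alice_subset (y : ℕ → Bit) (h : S.AliceHalts y j) :
    sendSteps (S.alice M a) y ⊆ Finset.range (S.start (j + 1)) := by
  intro t ht
  rw [Finset.coe_range, Set.mem_Iio]
  by_contra hn
  obtain ⟨h1, h2⟩ := roundOf_spec hS (Nat.le_add_left 1 j) (not_lt.1 hn)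
  refine ht ?_
  rw [alice]
  simp only
  rw [if_neg (by omega), if_neg]
  rw [aliceRuns_before h2]
  exact fun hA => hA j h.1 (by omega) h.2.2

theorem sendSteps_bob_subset (y : ℕ → Bit) (h : S.BobHalts r y j) :
    sendSteps (S.bob r) y ⊆ Finset.Ico (S.start 1) (S.start (j + 1)) := by
  intro t ht
  rw [Finset.coe_Ico, Set.mem_Ico]
  refine ⟨?_, ?_⟩
  · by_contra hn
    exact ht (bob_initial (not_le.1 hn))
  · by_contra hn
    obtain ⟨h1, h2⟩ := roundOf_spec hS (Nat.le_add_left 1 j) (not_lt.1 hn)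
    refine ht ?_
    rw [bob]
    simp only
    rw [if_neg (by omega), if_neg]
    rw [bobRuns_before h2]
    exact fun hB => hB j h.1 (by omega) h.2.2

theorem bitsSent_le (y : ℕ → Bit) {jA jB : ℕ} (hA : S.AliceHalts y jA) (hB : S.BobHalts r y jB)
    (h : jB ≤ jA) :
    ∃ n : ℕ, (sendSteps (S.alice M a) y).encard + (sendSteps (S.bob r) y).encard = n ∧
      n ≤ S.start 1 + ∑ j ∈ Finset.Ico 1 (jA + 1), 8 * S.b j := by
  have h1 := sendSteps_alice_subset (M := M) (a := a) hS y hA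
  have h2 := sendSteps_bob_subset hS y hB
  have f1 := (Finset.finite_toSet _).subset h1
  have f2 := (Finset.finite_toSet _).subset h2
  refine ⟨(sendSteps (S.alice M a) y).ncard + (sendSteps (S.bob r) y).ncard, ?_, ?_⟩
  · rw [Nat.cast_add, f1.cast_ncard_eq, f2.cast_ncard_eq]
  · have g1 := Set.ncard_le_ncard h1
    have g2 := Set.ncard_le_ncard h2
    rw [Set.ncard_coe_finset, Finset.card_range] at g1
    rw [Set.ncard_coe_finset, Nat.card_Ico] at g2
    have g3 := start_mono (S := S) (Nat.succ_le_succ h)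
    have g4 : S.start (jA + 1) = S.start 1 + ∑ j ∈ Finset.Ico 1 (jA + 1), 4 * S.b j := by
      rw [start_one, start]
    have g5 : ∑ j ∈ Finset.Ico 1 (jA + 1), 8 * S.b j =
        2 * ∑ j ∈ Finset.Ico 1 (jA + 1), 4 * S.b j := by
      rw [Finset.mul_sum]; exact Finset.sum_congr rfl fun _ _ => by ring
    simp only [Nat.succ_eq_add_one] at g3
    omega

/-- A round before Alice's last one is corrupted, unless Bob has a wrong polynomial in it: if Bob
has left, then silence was not recognized, and otherwise he did not hear his fingerprint. -/
theorem guess_ne_of_not_corrupted {jA : ℕ} (hA : S.AliceRuns Y jA) (hj : 1 ≤ j) (hjA : j < jA)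
    (h : ¬ S.Corrupted Charged j) : S.guess Y j ≠ S.conv.encode M := by
  intro hg
  have hAj : S.AliceRuns Y j := fun k hk hkj => hA k hk (hkj.trans hjA)
  have hN := hA j hj hjA
  refine hN (isSilence_of_bob_silent hS hj ?_ h)
  rintro ⟨hB, hM⟩
  exact hM (matches_of_not_corrupted hS hj hAj hB h hg)

omit hS in
theorem sum_corrupted_le [DecidablePred (S.Corrupted Charged)] (N : ℕ) :
    S.threshold * (S.E.Ce * S.κ) *
      ∑ j ∈ (Finset.Ico 1 N).filter (S.Corrupted Charged), (S.lg j : ℝ) ≤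
        (Charged).card := by
  have h1 := card_initial_add_sum_round_le (S := S) (Charged) N
  have h2 : ∑ j ∈ (Finset.Ico 1 N).filter (S.Corrupted Charged), S.threshold * S.b j ≤
      ∑ j ∈ (Finset.Ico 1 N).filter (S.Corrupted Charged), ((S.roundFlips Charged j).card : ℝ) :=
    Finset.sum_le_sum fun j hj => (Finset.mem_filter.1 hj).2
  have h3 : ∑ j ∈ (Finset.Ico 1 N).filter (S.Corrupted Charged), (S.roundFlips Charged j).card ≤
      ∑ j ∈ Finset.Ico 1 N, (S.roundFlips Charged j).card :=
    Finset.sum_le_sum_of_subset (Finset.filter_subset _ _)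
  have h4 : ∑ j ∈ (Finset.Ico 1 N).filter (S.Corrupted Charged),
      ((S.roundFlips Charged j).card : ℝ) ≤ (Charged).card := by
    exact_mod_cast (by omega)
  refine le_trans (le_of_eq ?_) (h2.trans h4)
  rw [Finset.mul_sum]
  refine Finset.sum_congr rfl fun j _ => ?_
  rw [b_eq]
  push_cast
  ring

/-- All rounds up to Alice's last one, measured in units of `b_j`, are paid for by the flips in
corrupted rounds, up to a term for the initial flips and one for the first round. -/
theorem sum_lg_le {jA : ℕ} (hA : S.AliceHalts Y jA) :
    S.E.Ce * S.κ * ∑ j ∈ Finset.Ico 1 (jA + 1), (S.lg j : ℝ) ≤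
      S.E.Ce * S.κ * (2 * S.lgBase +
        13968 * S.lgBase * (min (deg S.L + 1) (Charged).card : ℕ)) +
      27651 / S.threshold * (Charged).card := by
  classical
  have hθ := threshold_pos (S := S)
  set B := min (deg S.L + 1) (S.initialFlips Charged).card with hB
  have hBle : B ≤ min (deg S.L + 1) (Charged).card :=
    min_le_min_left _ (Finset.card_le_card (Finset.filter_subset _ _))
  have h1 := sum_le_of_errors (N := jA) hS.lgBase_pos (deg_pos hS.two_le)
    (show B ≤ deg S.L + 1 from min_le_left _ _) (S.Corrupted Charged) (by
      intro j hj hc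
      obtain ⟨hj1, hj2⟩ := Finset.mem_Ico.1 hj
      exact le_of_guess_ne hS hj1 (fun k hk hkj => hA.2.1 k hk (hkj.trans hj2))
        (guess_ne_of_not_corrupted hS hA.2.1 hj1 hj2 hc))
  have h2 := sum_succ_le (d := deg S.L) hS.lgBase_pos hA.1
  have h3 := sum_corrupted_le (S := S) (M := M) (a := a) (r := r) (adv := adv) jA
  simp only [← hS.lg_eq] at h1 h2
  set s := ∑ j ∈ (Finset.Ico 1 jA).filter (S.Corrupted Charged), (S.lg j : ℝ) with hs
  have h4 : S.E.Ce * S.κ * s ≤ 1 / S.threshold * (Charged).card := by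
    rw [one_div, inv_mul_eq_div, le_div_iff₀ hθ]
    linarith
  have h5 : (B : ℝ) ≤ (min (deg S.L + 1) (Charged).card : ℕ) := by exact_mod_cast hBle
  have h6 : ∑ j ∈ Finset.Ico 1 (jA + 1), (S.lg j : ℝ) ≤
      2 * S.lgBase + 13968 * S.lgBase * (min (deg S.L + 1) (Charged).card : ℕ) + 27651 * s := by
    have : (S.lgBase : ℝ) * B ≤ S.lgBase * (min (deg S.L + 1) (Charged).card : ℕ) := by gcongr
    linarith
  calc _ ≤ S.E.Ce * S.κ * (2 * S.lgBase +
        13968 * S.lgBase * (min (deg S.L + 1) (Charged).card : ℕ) + 27651 * s) := by gcongr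
    _ = S.E.Ce * S.κ * (2 * S.lgBase +
        13968 * S.lgBase * (min (deg S.L + 1) (Charged).card : ℕ)) +
          27651 * (S.E.Ce * S.κ * s) := by ring
    _ ≤ S.E.Ce * S.κ * (2 * S.lgBase +
        13968 * S.lgBase * (min (deg S.L + 1) (Charged).card : ℕ)) +
          27651 * (1 / S.threshold * (Charged).card) := by gcongr
    _ = _ := by ring

end Cost

/-- The constant of the communication bound. It depends on the tools only: each round costs at most
`8 * b_j` bits, the sum of the `b_j` is bounded in `sum_lg_le`, and `lgBase` and `d + 1` are bounded
by multiples of `log (L / δ)` and of `L / log L`. -/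
noncomputable def costConst (S : Setup) : ℝ :=
  1 + 1117520 * (S.E.Ce * S.κ) + 221208 / S.threshold

section CostBound

variable {S : Setup} (hS : S.Valid)
include hS

theorem lgBase_le : S.lgBase ≤ 5 * clog2 (S.L / S.δ) := by
  have h0 := hS.δ_pos
  have h1 := hS.δ_lt
  have h2 : (2 : ℝ) ≤ S.L := by exact_mod_cast hS.two_le
  have h3 : (deg S.L : ℝ) ≤ S.L := by exact_mod_cast (deg_lt hS.two_le).le
  have h4 : S.L ≤ S.L / S.δ := by rw [le_div_iff₀ h0]; nlinarith
  have h5 : (S.L : ℝ) / S.δ ≤ 2 ^ clog2 (S.L / S.δ) := le_two_pow_clog2 (by positivity)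
  rw [lgBase, clog2_le_iff (by have := hS.one_le_deg; positivity)]
  set x := (S.L : ℝ) / S.δ with hx
  have h6 : (8 : ℝ) ≤ x ^ 3 := by
    calc (8 : ℝ) = 2 ^ 3 := by norm_num
      _ ≤ _ := by gcongr; linarith
  calc 6 * (deg S.L : ℝ) * S.L / S.δ = 6 * deg S.L * x := by rw [hx]; ring
    _ ≤ x ^ 3 * x * x := by gcongr <;> linarith
    _ = x ^ 5 := by ring
    _ ≤ (2 ^ clog2 x) ^ 5 := by gcongr
    _ = _ := by rw [← pow_mul, mul_comm]

/-- The communication bound: the evaluations sent in plain take at most `L + log L` bits, and the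
rounds are bounded by `sum_lg_le`. -/
theorem cost_le {M M' : Bits S.L} {adv : Adversary} {ω : S.Coins} (h : S.Outputs M adv ω M') :
    ∃ n : ℕ, S.cost M adv ω = n ∧ (n : ℝ) ≤ S.L + S.costConst * (S.T M adv ω +
      min ((S.T M adv ω : ℝ) + 1) (S.L / clog2 S.L) * clog2 (S.L / S.δ)) := by
  obtain ⟨jB, jA, hB, hA, hle, -⟩ := h
  obtain ⟨n, hn, hn'⟩ := bitsSent_le (M := M) (a := fun j => (ω j).1) hS _ hA hB hle
  refine ⟨n, hn, ?_⟩
  have hsum := sum_lg_le hS hA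
  have hT : (chargedFlips (S.alice M fun j => (ω j).1) (S.bob fun j => (ω j).2) adv).card =
      S.T M adv ω := rfl
  rw [hT] at hsum
  set T := S.T M adv ω
  have hθ := threshold_pos (S := S)
  have hL := hS.two_le
  have hq0 : 0 < logq S.L := logq_pos hL
  have hq : clog2 (S.L : ℝ) = logq S.L := clog2_natCast S.L
  rw [hq]
  have hq1 : (0 : ℝ) < logq S.L := by exact_mod_cast hq0
  set lam := clog2 (S.L / S.δ) with hlam
  set m := min ((T : ℝ) + 1) (S.L / (logq S.L : ℝ)) with hm
  have hm1 : 1 ≤ m := by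
    refine le_min (by have : (0 : ℝ) ≤ T := Nat.cast_nonneg _; linarith) ?_
    rw [le_div_iff₀ hq1, one_mul]
    exact_mod_cast (logq_lt hL).le
  have hlq : (logq S.L : ℝ) ≤ lam := by
    have : logq S.L ≤ lam := by
      rw [← hq]
      refine clog2_mono hS.L_pos ?_
      rw [le_div_iff₀ hS.δ_pos]
      have := hS.δ_lt
      have := hS.L_pos
      nlinarith
    exact_mod_cast this
  have hdm : ((min (deg S.L + 1) T : ℕ) : ℝ) ≤ 2 * m := by
    have h1 : ((min (deg S.L + 1) T : ℕ) : ℝ) ≤ T + 1 := by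
      have : min (deg S.L + 1) T ≤ T + 1 := (min_le_right _ _).trans (Nat.le_succ _)
      exact_mod_cast this
    have h2 : ((min (deg S.L + 1) T : ℕ) : ℝ) ≤ 2 * (S.L / logq S.L) := by
      have h3 : ((min (deg S.L + 1) T : ℕ) : ℝ) ≤ deg S.L + 1 := by
        exact_mod_cast min_le_left (deg S.L + 1) T
      refine h3.trans ?_
      rw [← mul_div_assoc, le_div_iff₀ hq1]
      have h4 := deg_mul_lt hL
      have h5 := logq_lt hL
      have h6 : (deg S.L + 1) * logq S.L ≤ 2 * S.L := by rw [add_mul, one_mul]; omega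
      exact_mod_cast h6
    rcases min_choice ((T : ℝ) + 1) (S.L / (logq S.L : ℝ)) with h | h
    · rw [hm, h]
      have : (0 : ℝ) ≤ T := Nat.cast_nonneg _
      linarith
    · rw [hm, h]; exact h2
  have hbase : (S.lgBase : ℝ) ≤ 5 * lam := by exact_mod_cast lgBase_le hS
  have hml : (lam : ℝ) ≤ m * lam := by
    have : (0 : ℝ) ≤ lam := Nat.cast_nonneg _
    nlinarith
  have hprod : (S.lgBase : ℝ) * (min (deg S.L + 1) T : ℕ) ≤ 10 * (m * lam) := by
    calc (S.lgBase : ℝ) * (min (deg S.L + 1) T : ℕ) ≤ (5 * lam) * (2 * m) := by gcongr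
      _ = _ := by ring
  have hstart : (S.start 1 : ℝ) ≤ S.L + lam := by
    have h1 : S.start 1 ≤ S.L + logq S.L := by
      rw [start_one, add_mul, one_mul]
      have := deg_mul_lt hL
      omega
    have h2 : (S.start 1 : ℝ) ≤ S.L + logq S.L := by exact_mod_cast h1
    linarith
  have hn2 : (n : ℝ) ≤ S.start 1 +
      8 * (S.E.Ce * S.κ * ∑ j ∈ Finset.Ico 1 (jA + 1), (S.lg j : ℝ)) := by
    refine (Nat.cast_le.2 hn').trans (le_of_eq ?_)
    push_cast
    rw [Finset.mul_sum, Finset.mul_sum]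
    congr 1
    refine Finset.sum_congr rfl fun j _ => ?_
    rw [b_eq]
    push_cast
    ring
  have hC : (0 : ℝ) ≤ S.E.Ce * S.κ := by positivity
  have hbr : 2 * (S.lgBase : ℝ) + 13968 * S.lgBase * (min (deg S.L + 1) T : ℕ) ≤
      139690 * (m * lam) := by linarith
  have h1 := mul_le_mul_of_nonneg_left hbr hC
  have hT0 : (0 : ℝ) ≤ T := Nat.cast_nonneg _
  have hml0 : (0 : ℝ) ≤ m * lam := le_trans (Nat.cast_nonneg _) hml
  have e1 : 0 ≤ (S.E.Ce * S.κ : ℝ) * T := by positivity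
  have e2 : 0 ≤ 221208 / S.threshold * (m * lam) := by positivity
  calc (n : ℝ) ≤ S.L + lam + 8 * (S.E.Ce * S.κ * (139690 * (m * lam)) +
        27651 / S.threshold * T) := by linarith
    _ = S.L + lam + 1117520 * (S.E.Ce * S.κ) * (m * lam) + 221208 / S.threshold * T := by ring
    _ ≤ S.L + S.costConst * (T + m * lam) := by
      rw [costConst]
      nlinarith

end CostBound

end Setup

/-! ### Uniform coins -/

section UniformProduct

variable {α β : Type} [MeasurableSpace α] [MeasurableSingletonClass α] [Finite α] [Nonempty α]
  [MeasurableSpace β] [MeasurableSingletonClass β] [Finite β] [Nonempty β]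

theorem uniform_prod_le {s : Set (α × β)} {p : ℝ} (hp : 0 ≤ p)
    (h : ∀ x, uniform β {y | (x, y) ∈ s} ≤ ENNReal.ofReal p) :
    uniform (α × β) s ≤ ENNReal.ofReal p := by
  classical
  have := Fintype.ofFinite α
  have := Fintype.ofFinite β
  refine uniform_le_ofReal ?_
  have h1 : s.ncard = ∑ x : α, {y | (x, y) ∈ s}.ncard := by
    simp only [Set.ncard_eq_toFinset_card', Set.toFinset_ofPred, Finset.card_filter]
    rw [← Fintype.sum_prod_type' (f := fun x y => if (x, y) ∈ s then 1 else 0),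
      ← Finset.card_filter]
    congr 1
    ext z
    simp
  rw [h1, Nat.card_prod, Nat.cast_sum]
  calc ∑ x : α, ({y | (x, y) ∈ s}.ncard : ℝ) ≤ ∑ _x : α, p * Nat.card β :=
        Finset.sum_le_sum fun x _ => ncard_le_of_uniform_le hp (h x)
    _ = _ := by
        rw [Finset.sum_const, nsmul_eq_mul, Finset.card_univ, ← Nat.card_eq_fintype_card]
        push_cast
        ring

theorem uniform_prod_le' {s : Set (α × β)} {p : ℝ} (hp : 0 ≤ p)
    (h : ∀ y, uniform α {x | (x, y) ∈ s} ≤ ENNReal.ofReal p) :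
    uniform (α × β) s ≤ ENNReal.ofReal p := by
  have h1 := uniform_prod_le (s := Prod.swap ⁻¹' s) hp h
  refine uniform_le_ofReal ?_
  have h2 := ncard_le_of_uniform_le hp h1
  have h3 : (Prod.swap ⁻¹' s : Set (β × α)).ncard = s.ncard := by
    rw [← Set.image_swap_eq_preimage_swap, Set.ncard_image_of_injective _ Prod.swap_injective]
  rw [h3, Nat.card_prod] at h2
  rwa [Nat.card_prod, mul_comm (Nat.card α)]

instance : IsProbabilityMeasure (uniform α) :=
  isProbabilityMeasure_uniformOn Set.finite_univ Set.univ_nonempty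

end UniformProduct

/-- A random string has few alternations with small probability: the alternations are the ones of
the string of differences, so that the volume bound for Hamming balls applies. -/
theorem ncard_isSilence_le (N : ℕ) :
    {v : Bits (N + 1) | IsSilence v}.ncard * 3 ^ (N - N / 3) ≤ 2 * 4 ^ N := by
  classical
  have h1 : {v : Bits (N + 1) | IsSilence v}.ncard ≤
      ((Set.univ : Set Bit) ×ˢ {u : Bits N | hammingNorm u ≤ N / 3}).ncard := by
    refine Set.ncard_le_ncard_of_injOn
      (fun v => (v 0, fun i => v i.castSucc - v i.succ)) ?_ ?_
    · intro v hv
      refine ⟨Set.mem_univ _, ?_⟩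
      have h2 : hammingNorm (fun i : Fin N => v i.castSucc - v i.succ) = alternations v := by
        rw [hammingNorm, alternations, ← Finset.card_map Fin.valEmbedding]
        congr 1
        ext i
        simp only [Finset.mem_map, Finset.mem_filter, Finset.mem_univ, true_and,
          Fin.valEmbedding_apply, Finset.mem_range, Nat.add_sub_cancel]
        constructor
        · rintro ⟨k, hk, rfl⟩
          refine ⟨k.2, ?_⟩
          rw [bitAt, bitAt, dif_pos (by omega), dif_pos (by omega)]
          exact sub_ne_zero.1 hk
        · rintro ⟨hi, hne⟩
          refine ⟨⟨i, hi⟩, ?_, rfl⟩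
          rw [bitAt, bitAt, dif_pos (by omega), dif_pos (by omega)] at hne
          exact sub_ne_zero.2 hne
      have h3 : 3 * alternations v < N + 1 := hv
      change hammingNorm (fun i : Fin N => v i.castSucc - v i.succ) ≤ N / 3
      omega
    · intro v _ v' _ h
      have e1 : v 0 = v' 0 := (Prod.mk.inj h).1
      have e2 := (Prod.mk.inj h).2
      funext i
      induction i using Fin.induction with
      | zero => exact e1
      | succ i ih =>
        have e3 : v i.castSucc - v i.succ = v' i.castSucc - v' i.succ := congrFun e2 i
        rw [ih] at e3
        exact sub_right_injective e3
  have h2 := ncard_hammingNorm_le N (N / 3) (Nat.div_le_self _ _)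
  rw [Set.ncard_prod, Set.ncard_univ] at h1
  have h3 : Nat.card Bit = 2 := by simp
  rw [h3] at h1
  calc _ ≤ 2 * {u : Bits N | hammingNorm u ≤ N / 3}.ncard * 3 ^ (N - N / 3) := by gcongr
    _ = 2 * ({u : Bits N | hammingNorm u ≤ N / 3}.ncard * 3 ^ (N - N / 3)) := by ring
    _ ≤ _ := by gcongr

theorem uniform_isSilence_le {n c : ℕ} (hn : 71 * c ≤ n) (hc : 0 < c) (t : Bits n) :
    uniform (Bits n) {v | IsSilence (v + t)} ≤ ENNReal.ofReal ((1 / 2) ^ c) := by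
  obtain ⟨N, rfl⟩ : ∃ N, n = N + 1 := ⟨n - 1, by omega⟩
  refine uniform_le_ofReal ?_
  rw [card_bits]
  have h0 : {v : Bits (N + 1) | IsSilence (v + t)}.ncard ≤
      {v : Bits (N + 1) | IsSilence v}.ncard :=
    Set.ncard_le_ncard_of_injOn (fun v => v + t) (fun v hv => hv)
      (add_left_injective t).injOn
  have h1 := ncard_isSilence_le N
  set k := {v : Bits (N + 1) | IsSilence v}.ncard
  refine (Nat.cast_le.2 h0).trans ?_
  -- The cubes are compared, because the exponents are multiples of one third.
  have h2 : (k * 2 ^ c) ^ 3 ≤ (2 ^ (N + 1)) ^ 3 := by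
    refine Nat.le_of_mul_le_mul_right (?_ : _ * 9 ^ N ≤ _ * 9 ^ N) (by positivity)
    have e1 : 9 ^ N ≤ (3 ^ (N - N / 3)) ^ 3 := by
      rw [show (9 : ℕ) = 3 ^ 2 by norm_num, ← pow_mul, ← pow_mul]
      exact Nat.pow_le_pow_right (by norm_num) (by omega)
    have e2 : 8 ^ c * 8 ^ N ≤ 9 ^ N := by
      obtain ⟨m, rfl⟩ : ∃ m, N = 70 * c + m := ⟨N - 70 * c, by omega⟩
      rw [pow_add, pow_add, pow_mul, pow_mul, ← mul_assoc, ← mul_pow]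
      exact Nat.mul_le_mul (Nat.pow_le_pow_left (by norm_num) c)
        (Nat.pow_le_pow_left (by norm_num) m)
    calc (k * 2 ^ c) ^ 3 * 9 ^ N ≤ (k * 2 ^ c) ^ 3 * (3 ^ (N - N / 3)) ^ 3 := by gcongr
      _ = (k * 3 ^ (N - N / 3)) ^ 3 * 8 ^ c := by
          rw [show (8 : ℕ) ^ c = (2 ^ c) ^ 3 by rw [← pow_mul, mul_comm, pow_mul]; norm_num]
          ring
      _ ≤ (2 * 4 ^ N) ^ 3 * 8 ^ c := by gcongr
      _ = (2 ^ (N + 1)) ^ 3 * (8 ^ c * 8 ^ N) := by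
          rw [show (4 : ℕ) ^ N = 2 ^ N * 2 ^ N by rw [← mul_pow]; norm_num,
            show (8 : ℕ) ^ N = (2 ^ N) ^ 3 by rw [← pow_mul, mul_comm, pow_mul]; norm_num]
          ring
      _ ≤ _ := by gcongr
  have h3 : k * 2 ^ c ≤ 2 ^ (N + 1) := (Nat.pow_le_pow_iff_left (by norm_num)).1 h2
  have h4 : (k : ℝ) * 2 ^ c ≤ 2 ^ (N + 1) := by exact_mod_cast h3
  push_cast
  rw [one_div, inv_pow, inv_mul_eq_div, le_div_iff₀ (by positivity)]
  exact h4

/-! ### Conditioning on the past -/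

section Conditioning

variable {X : ℕ → Type} [∀ i, MeasurableSpace (X i)] [∀ i, MeasurableSingletonClass (X i)]
  [∀ i, Finite (X i)] [∀ i, Nonempty (X i)]

/-- If, whatever happened before, coordinate `j` falls into the forbidden set `B` determined by
the previous coordinates with probability at most `ε`, then the total probability is at most
`ε`. -/
theorem infinitePi_setOf_mem_le (μ : (i : ℕ) → Measure (X i)) [∀ i, IsProbabilityMeasure (μ i)]
    (j : ℕ) (B : ((i : ℕ) → X i) → Set (X j)) (ε : ENNReal)
    (hB : ∀ ω ω' : (i : ℕ) → X i, (∀ i < j, ω i = ω' i) → B ω = B ω')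
    (hε : ∀ ω, μ j (B ω) ≤ ε) :
    Measure.infinitePi μ {ω | ω j ∈ B ω} ≤ ε := by
  classical
  have := fun i => Fintype.ofFinite (X i)
  let z : (i : ℕ) → X i := fun i => Classical.arbitrary _
  let ext : ((i : Fin j) → X i) → (i : ℕ) → X i :=
    fun h i => if hi : i < j then h ⟨i, hi⟩ else z i
  have hext : ∀ h (i : Fin j), ext h i = h i := fun h i => dif_pos i.2
  let t : ((i : Fin j) → X i) → (i : ℕ) → Set (X i) :=
    fun h => Function.update (fun i => {ext h i}) j (B (ext h))
  have hsub : {ω | ω j ∈ B ω} ⊆ ⋃ h, (Finset.range (j + 1) : Set ℕ).pi (t h) := by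
    intro ω hω
    refine Set.mem_iUnion.2 ⟨fun i => ω i, fun i hi => ?_⟩
    have hpast : ∀ i < j, ω i = ext (fun i => ω i) i := fun i hi =>
      (hext (fun i => ω i) ⟨i, hi⟩).symm
    rcases Nat.lt_succ_iff_lt_or_eq.1 (Finset.mem_range.1 hi) with h | rfl
    · rw [show t (fun i => ω i) i = {ext (fun i => ω i) i} from Function.update_of_ne h.ne _ _]
      exact hpast i h
    · rw [show t (fun i => ω i) i = B (ext fun i => ω i) from Function.update_self _ _ _,
        ← hB ω _ hpast]
      exact hω
  have hbox : ∀ h, Measure.infinitePi μ ((Finset.range (j + 1) : Set ℕ).pi (t h)) ≤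
      (∏ i : Fin j, μ i {h i}) * ε := by
    intro h
    rw [Measure.infinitePi_pi μ fun i _ => (Set.toFinite _).measurableSet,
      Finset.prod_range_succ, ← Fin.prod_univ_eq_prod_range (fun i => μ i (t h i)) j]
    refine mul_le_mul' (le_of_eq (Finset.prod_congr rfl fun i _ => ?_)) ?_
    · rw [show t h i = {ext h i} from Function.update_of_ne i.2.ne _ _, hext]
    · rw [show t h j = B (ext h) from Function.update_self _ _ _]
      exact hε _
  calc Measure.infinitePi μ {ω | ω j ∈ B ω}
      ≤ ∑ h, Measure.infinitePi μ ((Finset.range (j + 1) : Set ℕ).pi (t h)) :=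
        (measure_mono hsub).trans (measure_iUnion_fintype_le _ _)
    _ ≤ ∑ h : (i : Fin j) → X i, (∏ i : Fin j, μ i {h i}) * ε := Finset.sum_le_sum fun h _ => hbox h
    _ = (∏ i : Fin j, ∑ x, μ i {x}) * ε := by
        rw [← Finset.sum_mul, Finset.prod_univ_sum, Fintype.piFinset_univ]
    _ = ε := by
        have : ∀ i : Fin j, ∑ x, μ i {x} = 1 := fun i => by
          rw [sum_measure_singleton, Finset.coe_univ, measure_univ]
        simp [this]

end Conditioning

theorem transcript_congr {A A' B B' : Party} (adv : Adversary) {n : ℕ}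
    (hA : ∀ t < n, ∀ y, A y t = A' y t) (hB : ∀ t < n, ∀ y, B y t = B' y t) {t : ℕ}
    (ht : t ≤ n) : transcript A B adv t = transcript A' B' adv t := by
  induction t with
  | zero => rfl
  | succ t ih =>
    have hs : ∀ k ≤ t, ∀ y, sent A B y k = sent A' B' y k := fun k hk y => by
      rw [sent, sent, hA k (by omega), hB k (by omega)]
    rw [transcript, transcript, ih (by omega)]
    simp only [hs t le_rfl, hs (t - 1) (Nat.sub_le _ _)]

namespace Setup

variable {S : Setup}

section Past

theorem roundOf_lt {j t : ℕ} (hj : 1 ≤ j) (ht : t < S.start j) : S.roundOf t < j := by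
  by_contra hn
  have h0 : S.roundOf t ≠ 0 := by omega
  have h1 : S.start (S.roundOf t) ≤ t :=
    Nat.findGreatest_of_ne_zero (P := fun j => S.start j ≤ t) rfl h0
  have h2 := start_mono (S := S) (not_lt.1 hn)
  omega

theorem alice_coins_congr {M : Bits S.L} {a a' : (j : ℕ) → S.AliceCoins j} {y : ℕ → Bit} {t : ℕ}
    (h : a (S.roundOf t) = a' (S.roundOf t)) : S.alice M a y t = S.alice M a' y t := by
  have : S.evaluations M a (S.roundOf t) = S.evaluations M a' (S.roundOf t) := by
    rw [evaluations_eq, evaluations_eq, h]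
  simp only [alice, this]

theorem bob_coins_congr {r r' : (j : ℕ) → S.BobCoins j} {y : ℕ → Bit} {t : ℕ}
    (h : ∀ i ≤ S.roundOf t, r i = r' i) : S.bob r y t = S.bob r' y t := by
  by_cases h0 : S.roundOf t = 0
  · simp only [bob, h0, if_true]
  · have hj : 1 ≤ S.roundOf t := Nat.one_le_iff_ne_zero.2 h0
    have h1 := bobRuns_congr (y := y) (y' := y) (j := S.roundOf t) (fun _ _ => rfl)
      fun i hi => h i hi.le
    have h2 := fingerprint_congr (y := y) (y' := y) hj (fun _ _ => rfl) (h _ le_rfl)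
    have h3 := matches_congr (y := y) (y' := y) hj (fun _ _ => rfl) (h _ le_rfl)
    simp only [bob]
    rw [propext h1, propext h3, h2, h _ le_rfl]

theorem run_congr {M : Bits S.L} {adv : Adversary} {ω ω' : S.Coins} {j : ℕ} (hj : 1 ≤ j)
    (h : ∀ i < j, ω i = ω' i) {t : ℕ} (ht : t < S.start j) :
    S.run M adv ω t = S.run M adv ω' t := by
  rw [run, run, received, received]
  refine congrFun (transcript_congr adv (n := S.start j) (fun k hk y => ?_) (fun k hk y => ?_)
    (by omega)) t
  · exact alice_coins_congr (by rw [h _ (roundOf_lt hj hk)])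
  · exact bob_coins_congr fun i hi => by rw [h i (hi.trans_lt (roundOf_lt hj hk))]

end Past

/-! ### The failure probability of a round -/

section Failure

variable (S)

/-- Alice's test, applied to the decoded string `f` in round `j`. -/
def AcceptsString (M : Bits S.L) (j : ℕ) (f : Bits (S.w j)) : Prop :=
  resize (S.w j) (resize (S.fpLen j + S.A.Ca * clog2 (S.fpLen j / S.η j)) f) = f ∧
    S.A.IsCodeword (η := S.η j)
      (resize (S.fpLen j + S.A.Ca * clog2 (S.fpLen j / S.η j)) f) ∧
    S.A.dec (S.fpLen j) (S.η j) (resize _ f) =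
      S.fpOf j (resize (S.seedLen j) (S.A.dec (S.fpLen j) (S.η j) (resize _ f)))
        (S.word (S.conv.encode M))

/-- The padded AMD encoding of the fingerprint of the string `m` with Bob's coins `x`. -/
noncomputable def fingerprintString (j : ℕ) (m : List Bit) (x : S.BobCoins j) : Bits (S.w j) :=
  resize _ (S.A.enc (S.fpLen j) (S.η j) (S.fpOf j x.1 m) x.2.1)

variable {S}

theorem fingerprint_eq (r : (j : ℕ) → S.BobCoins j) (y : ℕ → Bit) (j : ℕ) :
    S.fingerprint r y j = S.fingerprintString j (S.word (S.guess y j)) (r j) :=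
  rfl

theorem accepts_iff_acceptsString {M : Bits S.L} {y : ℕ → Bit} {j : ℕ} :
    S.Accepts M y j ↔ S.AcceptsString M j (S.decoded y j 0) :=
  Iff.rfl

variable (S)

/-- The event that Alice accepts although Bob's string `m` is wrong or the fingerprint was
changed by `t`. -/
def falseAccept (M : Bits S.L) (j : ℕ) (m : List Bit) (t : Bits (S.w j)) :
    Set (S.AliceCoins j × S.BobCoins j) :=
  {x | S.AcceptsString M j (S.fingerprintString j m x.2 + t) ∧
    (t ≠ 0 ∨ m ≠ S.word (S.conv.encode M))}

/-- The event that Bob's fingerprint is the fixed string `t`. -/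
def falseEcho (j : ℕ) (m : List Bit) (t : Bits (S.w j)) :
    Set (S.AliceCoins j × S.BobCoins j) :=
  {x | S.fingerprintString j m x.2 = t}

/-- The event that Bob's random bits, changed by `t`, look like silence. -/
def falseSilence (j : ℕ) (t : Bits (S.b j)) : Set (S.AliceCoins j × S.BobCoins j) :=
  {x | IsSilence (x.2.2.2 + t)}

/-- The coins of round `j` that mislead a player if Bob's string is `m`. -/
def misleading (M : Bits S.L) (adv : Adversary) (j : ℕ) (m : List Bit) :
    Set (S.AliceCoins j × S.BobCoins j) :=
  S.falseAccept M j m (S.E.dec (S.w j) (S.noise adv j 0)) ∪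
    (S.falseEcho j m (S.E.dec (S.w j) (S.noise adv j 1)) ∪ S.falseSilence j (S.noise adv j 2))

/-- The coins for which a player is misled in round `j`, with both players still running. -/
def failure (M : Bits S.L) (adv : Adversary) (j : ℕ) : Set S.Coins :=
  {ω | S.BobRuns (fun j => (ω j).2) (S.run M adv ω) j ∧ S.AliceRuns (S.run M adv ω) j ∧
    ω j ∈ S.misleading M adv j (S.word (S.guess (S.run M adv ω) j))}

variable {S} (hS : S.Valid) (j : ℕ)
include hS

/-- Without a change, acceptance is a collision of fingerprints; a change has to turn the AMD
codeword into another one. -/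
theorem uniform_falseAccept_le (M : Bits S.L) (m : List Bit) (hm : m.length ≤ S.L)
    (t : Bits (S.w j)) :
    uniform _ (S.falseAccept M j m t) ≤ ENNReal.ofReal (S.η j) := by
  have hη := (hS.η_pos j).le
  have hfit : ∀ v : Bits (S.fpLen j + S.A.Ca * clog2 (S.fpLen j / S.η j)),
      resize (S.fpLen j + S.A.Ca * clog2 (S.fpLen j / S.η j)) (resize (S.w j) v) = v :=
    fun v => resize_resize (hS.fp_length_le j) v
  by_cases ht : t = 0
  · subst ht
    by_cases hne : m = S.word (S.conv.encode M)
    · have : S.falseAccept M j m 0 = ∅ :=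
        Set.eq_empty_of_forall_notMem fun x hx => hx.2.elim (fun h => h rfl) (fun h => h hne)
      rw [this, measure_empty]
      exact zero_le
    refine uniform_prod_le hη fun _ => uniform_prod_le' hη fun z => ?_
    refine (measure_mono ?_).trans (S.F.collision S.L (S.η j) (by have := hS.two_le; omega)
      (hS.η_pos j) (hS.η_lt_one j) m (S.word (S.conv.encode M)) hm
      (by rw [word, List.length_ofFn]) hne)
    rintro s ⟨⟨-, -, h⟩, -⟩
    rw [add_zero, fingerprintString, hfit,
      S.A.dec_enc _ _ (hS.fpLen_pos j) (hS.η_pos j) (hS.η_lt_one j), resize_fpOf] at h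
    have h2 := congrArg (fun (v : Bits (S.fpLen j)) (i : Fin (S.F.Ch * clog2 (1 / S.η j))) =>
      v (Fin.natAdd (S.seedLen j) i)) h
    refine Eq.trans (funext fun i => ?_) (h2.trans (funext fun i => ?_))
    · exact (Fin.append_right s _ i).symm
    · exact Fin.append_right s _ i
  · refine uniform_prod_le hη fun _ => uniform_prod_le hη fun s => uniform_prod_le' hη fun z => ?_
    set u : Bits (S.fpLen j + S.A.Ca * clog2 (S.fpLen j / S.η j)) := resize _ t with hu
    by_cases hu0 : u = 0
    · -- The change affects the padding, which Alice checks.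
      refine le_trans (le_of_eq ?_) zero_le
      refine (congrArg _ (Set.eq_empty_of_forall_notMem ?_)).trans measure_empty
      rintro c ⟨⟨h, -⟩, -⟩
      rw [resize_add, ← hu, hu0, add_zero, fingerprintString, hfit] at h
      exact ht (left_eq_add.1 h)
    · refine (measure_mono ?_).trans (S.A.detect (S.fpLen j) (S.η j) (hS.fpLen_pos j)
        (hS.η_pos j) (hS.η_lt_one j) (S.fpOf j s m) u hu0)
      rintro c ⟨⟨-, ⟨m', r', h⟩, -⟩, -⟩
      rw [resize_add, fingerprintString, hfit] at h
      exact ⟨m', r', h⟩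

/-- The fingerprint contains the uniformly random seed. -/
theorem uniform_falseEcho_le (m : List Bit) (t : Bits (S.w j)) :
    uniform _ (S.falseEcho j m t) ≤ ENNReal.ofReal (S.η j) := by
  have hη := (hS.η_pos j).le
  refine uniform_prod_le hη fun _ => uniform_prod_le' hη fun z => ?_
  have h1 : {s | (s, z) ∈ {x : S.BobCoins j | S.fingerprintString j m x = t}} ⊆
      {resize (S.seedLen j) (S.A.dec (S.fpLen j) (S.η j) (resize _ t))} := by
    intro s hs
    have hs' : S.fingerprintString j m (s, z) = t := hs
    rw [Set.mem_singleton_iff, ← hs', fingerprintString, resize_resize (hS.fp_length_le j),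
      S.A.dec_enc _ _ (hS.fpLen_pos j) (hS.η_pos j) (hS.η_lt_one j), resize_fpOf]
  refine uniform_le_ofReal ?_
  have h2 := Set.ncard_le_ncard h1
  rw [Set.ncard_singleton] at h2
  have h3 : ({s | (s, z) ∈ {x : S.BobCoins j | S.fingerprintString j m x = t}}.ncard : ℝ) ≤ 1 := by
    exact_mod_cast h2
  refine h3.trans ?_
  rw [card_bits]
  have h4 := hS.half_pow_lg_le j
  have h5 : S.lg j ≤ S.seedLen j := Nat.le_mul_of_pos_left _ S.F.Cs_pos
  have h6 : (2 : ℝ) ^ S.lg j ≤ 2 ^ S.seedLen j := pow_le_pow_right₀ (by norm_num) h5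
  rw [one_div, inv_pow, inv_le_iff_one_le_mul₀ (by positivity)] at h4
  push_cast
  nlinarith [hS.η_pos j]

theorem uniform_falseSilence_le (t : Bits (S.b j)) :
    uniform _ (S.falseSilence j t) ≤ ENNReal.ofReal (S.η j) := by
  have hη := (hS.η_pos j).le
  refine uniform_prod_le hη fun _ => uniform_prod_le hη fun _ => uniform_prod_le hη fun _ => ?_
  exact (uniform_isSilence_le (b_ge j) (hS.lg_pos j) t).trans
    (ENNReal.ofReal_le_ofReal (hS.half_pow_lg_le j))

theorem uniform_misleading_le (M : Bits S.L) (adv : Adversary) (m : List Bit)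
    (hm : m.length ≤ S.L) :
    uniform _ (S.misleading M adv j m) ≤ ENNReal.ofReal (3 * S.η j) := by
  have hη := (hS.η_pos j).le
  have e : 3 * S.η j = S.η j + (S.η j + S.η j) := by ring
  rw [e, ENNReal.ofReal_add hη (by linarith), ENNReal.ofReal_add hη hη]
  refine (measure_union_le _ _).trans (add_le_add (uniform_falseAccept_le hS j M m hm _) ?_)
  exact (measure_union_le _ _).trans
    (add_le_add (uniform_falseEcho_le hS j m _) (uniform_falseSilence_le hS j _))

theorem coinMeasure_failure_le (M : Bits S.L) (adv : Adversary) (hj : 1 ≤ j) :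
    S.coinMeasure (S.failure M adv j) ≤ ENNReal.ofReal (3 * S.η j) := by
  refine infinitePi_setOf_mem_le (fun j => uniform (S.AliceCoins j × S.BobCoins j)) j
    (fun ω => {x | S.BobRuns (fun j => (ω j).2) (S.run M adv ω) j ∧
      S.AliceRuns (S.run M adv ω) j ∧
      x ∈ S.misleading M adv j (S.word (S.guess (S.run M adv ω) j))}) _ ?_ ?_
  · intro ω ω' h
    have hy : ∀ t < S.start j, S.run M adv ω t = S.run M adv ω' t := fun t => run_congr hj h
    ext x
    simp only [Set.mem_ofPred_eq]
    rw [bobRuns_congr hy fun i hi => by rw [h i hi], aliceRuns_congr hy, guess_congr hj hy]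
  · intro ω
    refine (measure_mono fun x hx => hx.2.2).trans
      (uniform_misleading_le hS j M adv _ ?_)
    rw [word, List.length_ofFn]

end Failure

end Setup

namespace Setup

variable {S : Setup}

/-! ### Executions without failure -/

theorem messageOf_encode (hS : S.Valid) (M : Bits S.L) :
    S.conv.messageOf (S.conv.encode M) = M := by
  funext t
  have hq := logq_pos hS.two_le
  have h1 : (t : ℕ) / logq S.L < deg S.L + 1 := by
    rw [Nat.div_lt_iff_lt_mul hq]
    exact t.2.trans_le (le_deg_mul hS.two_le)
  have h2 : (S.conv.encode M : Polynomial (GF S.L)).coeff (t / logq S.L) =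
      S.conv.rep.symm (fun a => bitAt M (t / logq S.L * logq S.L + a)) := by
    have h3 := (Polynomial.degreeLTEquiv (GF S.L) (deg S.L + 1)).apply_symm_apply
      (fun i => S.conv.rep.symm (fun a => bitAt M (i * logq S.L + a)))
    exact congrFun h3 ⟨t / logq S.L, h1⟩
  rw [Conventions.messageOf, h2, Equiv.apply_symm_apply, bitAt, dif_pos (Nat.mod_lt _ hq)]
  simp only
  rw [mul_comm, Nat.div_add_mod, bitAt_fin]

theorem exists_not_corrupted (hS : S.Valid) (C : Finset ℕ) {N : ℕ} (hN : 1 ≤ N) :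
    ∃ j, N ≤ j ∧ ¬ S.Corrupted C j := by
  by_contra! hcon
  have h1 := card_initial_add_sum_round_le (S := S) C (N + C.card + 1)
  have h2 : ∀ j ∈ Finset.Ico N (N + C.card + 1), 1 ≤ (S.roundFlips C j).card := by
    intro j hj
    have h3 := hcon j (Finset.mem_Ico.1 hj).1
    have h4 : 0 < S.threshold * S.b j :=
      mul_pos threshold_pos (by exact_mod_cast hS.b_pos j)
    exact_mod_cast h4.trans_le h3
  have h3 := Finset.sum_le_sum h2
  rw [Finset.sum_const, Nat.card_Ico, smul_eq_mul, mul_one] at h3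
  have h4 : ∑ j ∈ Finset.Ico N (N + C.card + 1), (S.roundFlips C j).card ≤
      ∑ j ∈ Finset.Ico 1 (N + C.card + 1), (S.roundFlips C j).card :=
    Finset.sum_le_sum_of_subset (Finset.Ico_subset_Ico_left hN)
  omega

section Success

variable (hS : S.Valid) {M : Bits S.L} {adv : Adversary} {ω : S.Coins}
  (hgood : ∀ j, 1 ≤ j → ω ∉ S.failure M adv j)

local notation "Y" => S.run M adv ω

include hS hgood

/-- Alice does not mistake Bob's random bits for silence. -/
theorem aliceRuns_of_bobRuns {j : ℕ} (hj : 1 ≤ j) (hB : S.BobRuns (fun j => (ω j).2) Y j) :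
    S.AliceRuns Y j := by
  induction j, hj using Nat.le_induction with
  | base => intro i h1 h2; omega
  | succ j hj ih =>
    have hBj : S.BobRuns (fun j => (ω j).2) Y j := fun i h1 h2 => hB i h1 (by omega)
    have hM := hB j hj (by omega)
    have hA := ih hBj
    intro i h1 h2
    rcases Nat.lt_succ_iff_lt_or_eq.1 h2 with h | rfl
    · exact hA i h1 h
    · intro hsil
      refine hgood i hj ⟨hBj, hA, Or.inr (Or.inr ?_)⟩
      have h3 := slot_two (M := M) (a := fun j => (ω j).1) (adv := adv) hS hj hBj hM
      change IsSilence ((ω i).2.2.2 + S.noise adv i 2)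
      rw [← h3]
      exact hsil

theorem messageOf_guess_of_matches {j : ℕ} (hj : 1 ≤ j) (hB : S.BobRuns (fun j => (ω j).2) Y j)
    (hM : S.Matches (fun j => (ω j).2) Y j) : S.conv.messageOf (S.guess Y j) = M := by
  have hA := aliceRuns_of_bobRuns hS hgood hj hB
  have hnot : ω j ∉ S.misleading M adv j (S.word (S.guess Y j)) :=
    fun h => hgood j hj ⟨hB, hA, h⟩
  have h0 := decoded_zero (M := M) (a := fun j => (ω j).1) (adv := adv) hS hj hB
  have h1 := slot_one (r := fun j => (ω j).2) (adv := adv) hS hj hA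
  by_cases hacc : S.Accepts M Y j
  · by_contra hne
    refine hnot (Or.inl ⟨?_, Or.inr fun h => hne ?_⟩)
    · rw [accepts_iff_acceptsString] at hacc
      rw [← fingerprint_eq (fun j => (ω j).2) Y j]
      exact h0 ▸ hacc
    · have h2 := List.ofFn_injective h
      rw [h2, messageOf_encode hS]
  · refine absurd (Or.inr (Or.inl ?_)) hnot
    have h2 : S.slot Y j 1 = S.noise adv j 1 := by
      rw [← zero_add (S.noise adv j 1), ← echo_of_not_accepts hacc]
      exact h1
    have h3 : S.decoded Y j 1 = S.fingerprint (fun j => (ω j).2) Y j := hM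
    rw [decoded, h2] at h3
    exact h3.symm

theorem exists_bobHalts : ∃ j, S.BobHalts (fun j => (ω j).2) Y j := by
  classical
  by_contra! hcon
  have hB : ∀ j, 1 ≤ j → S.BobRuns (fun j => (ω j).2) Y j := by
    intro j hj
    induction j, hj using Nat.le_induction with
    | base => intro i h1 h2; omega
    | succ j hj ih =>
      intro i h1 h2
      rcases Nat.lt_succ_iff_lt_or_eq.1 h2 with h | rfl
      · exact ih i h1 h
      · exact fun hM => hcon i ⟨hj, ih, hM⟩
  set C := chargedFlips (S.alice M fun j => (ω j).1) (S.bob fun j => (ω j).2) adv with hC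
  -- The number of rounds in which Bob can have a wrong polynomial is bounded, since corrupted
  -- rounds contain flips.
  set J := 16 * (deg S.L + 1 + 2 * C.card) with hJ
  obtain ⟨j, hj, hc⟩ := exists_not_corrupted hS C (N := J + 1) (by omega)
  have hj1 : 1 ≤ j := by omega
  have hA := aliceRuns_of_bobRuns hS hgood hj1 (hB j hj1)
  have hg : S.guess Y j = S.conv.encode M := by
    by_contra hne
    have h1 := le_of_guess_ne (r := fun j => (ω j).2) (adv := adv) hS hj1 hA hne
    have h2 : ((Finset.Ico 1 j).filter (S.Corrupted C)).card ≤ C.card := by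
      have h3 := card_initial_add_sum_round_le (S := S) C j
      have h4 : ∀ i ∈ (Finset.Ico 1 j).filter (S.Corrupted C), 1 ≤ (S.roundFlips C i).card := by
        intro i hi
        have h5 : 0 < S.threshold * S.b i :=
          mul_pos threshold_pos (by exact_mod_cast hS.b_pos i)
        exact_mod_cast h5.trans_le (Finset.mem_filter.1 hi).2
      have h5 := Finset.sum_le_sum h4
      rw [Finset.sum_const, smul_eq_mul, mul_one] at h5
      have h6 : ∑ i ∈ (Finset.Ico 1 j).filter (S.Corrupted C), (S.roundFlips C i).card ≤
          ∑ i ∈ Finset.Ico 1 j, (S.roundFlips C i).card :=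
        Finset.sum_le_sum_of_subset (Finset.filter_subset _ _)
      omega
    have h7 := min_le_left (deg S.L + 1) (S.initialFlips C).card
    rw [← hC] at h1
    omega
  exact hcon j ⟨hj1, hB j hj1,
    matches_of_not_corrupted (r := fun j => (ω j).2) (adv := adv) hS hj1 hA (hB j hj1) hc hg⟩

theorem outputs_of_not_failure : S.Outputs M adv ω M := by
  classical
  obtain ⟨jB, hB⟩ := exists_bobHalts hS hgood
  have hAB := aliceRuns_of_bobRuns hS hgood hB.1 hB.2.1
  have hex : ∃ j, 1 ≤ j ∧ IsSilence (S.slot Y j 2) := by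
    obtain ⟨j, hj, hc⟩ :=
      exists_not_corrupted hS (chargedFlips (S.alice M fun j => (ω j).1) (S.bob fun j => (ω j).2) adv) hB.1
    have hj1 : 1 ≤ j := hB.1.trans hj
    refine ⟨j, hj1, isSilence_of_bob_silent (r := fun j => (ω j).2) (adv := adv) hS hj1 ?_ hc⟩
    rintro ⟨h1, h2⟩
    rcases hj.eq_or_lt with rfl | h
    · exact h2 hB.2.2
    · exact h1 jB hB.1 h hB.2.2
  obtain ⟨h1, h2⟩ := Nat.find_spec hex
  refine ⟨jB, Nat.find hex, hB, ⟨h1, fun i hi hlt hsil => Nat.find_min hex hlt ⟨hi, hsil⟩, h2⟩,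
    ?_, messageOf_guess_of_matches hS hgood hB.1 hB.2.1 hB.2.2⟩
  by_contra hlt
  exact hAB _ h1 (not_le.1 hlt) h2

end Success

/-! ### The success probability -/

theorem sum_half_pow_div_le (d n : ℕ) (hd : 0 < d) :
    ∑ j ∈ Finset.range n, (1 / 2 : ℝ) ^ (j / d) ≤ 2 * d := by
  have h1 : ∀ n, ∑ j ∈ Finset.range (d * n), (1 / 2 : ℝ) ^ (j / d) =
      2 * d * (1 - (1 / 2) ^ n) := by
    intro n
    induction n with
    | zero => simp
    | succ n ih =>
      rw [mul_add, mul_one, Finset.sum_range_add, ih, Finset.sum_congr rfl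
        (g := fun _ => (1 / 2 : ℝ) ^ n)]
      · rw [Finset.sum_const, Finset.card_range, nsmul_eq_mul]
        ring
      · intro i hi
        rw [Nat.mul_add_div hd, Nat.div_eq_of_lt (Finset.mem_range.1 hi), add_zero]
  calc ∑ j ∈ Finset.range n, (1 / 2 : ℝ) ^ (j / d)
      ≤ ∑ j ∈ Finset.range (d * n), (1 / 2 : ℝ) ^ (j / d) :=
        Finset.sum_le_sum_of_subset_of_nonneg
          (Finset.range_subset_range.2 (Nat.le_mul_of_pos_left n hd)) fun _ _ _ => by positivity
    _ = 2 * d * (1 - (1 / 2) ^ n) := h1 n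
    _ ≤ 2 * d := by
        have : (0 : ℝ) ≤ (1 / 2) ^ n := by positivity
        have : (0 : ℝ) ≤ d := Nat.cast_nonneg d
        nlinarith

theorem tsum_failure_le (hS : S.Valid) :
    ∑' j, ENNReal.ofReal (3 * S.η (j + 1)) ≤ ENNReal.ofReal S.δ := by
  have hd := hS.one_le_deg
  have hδ := hS.δ_pos
  have hη : ∀ j, 0 ≤ 3 * S.η j := fun j => by have := hS.η_pos j; linarith
  refine ENNReal.tsum_le_of_sum_range_le fun n => ?_
  rw [← ENNReal.ofReal_sum_of_nonneg fun j _ => hη _]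
  refine ENNReal.ofReal_le_ofReal ?_
  calc ∑ j ∈ Finset.range n, 3 * S.η (j + 1)
      ≤ ∑ j ∈ Finset.range (n + 1), 3 * S.η j := by
        rw [Finset.sum_range_succ']
        have := hη 0
        linarith
    _ = (S.δ / (2 * deg S.L)) * ∑ j ∈ Finset.range (n + 1), (1 / 2 : ℝ) ^ (j / deg S.L) := by
        rw [Finset.mul_sum]
        refine Finset.sum_congr rfl fun j _ => ?_
        rw [η]
        field_simp
        norm_num
    _ ≤ (S.δ / (2 * deg S.L)) * (2 * deg S.L) := by
        gcongr
        exact sum_half_pow_div_le _ _ (deg_pos hS.two_le)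
    _ = S.δ := by field_simp

theorem le_coinMeasure_outputs (hS : S.Valid) (M : Bits S.L) (adv : Adversary) :
    ENNReal.ofReal (1 - S.δ) ≤ S.coinMeasure {ω | S.Outputs M adv ω M} := by
  have hprob : S.coinMeasure Set.univ = 1 := by
    rw [coinMeasure]; exact measure_univ
  have hcover : (Set.univ : Set S.Coins) ⊆
      {ω | S.Outputs M adv ω M} ∪ ⋃ j, S.failure M adv (j + 1) := by
    intro ω _
    by_cases h : ∃ j, ω ∈ S.failure M adv (j + 1)
    · exact Or.inr (Set.mem_iUnion.2 h)
    · refine Or.inl (outputs_of_not_failure hS fun j hj hf => h ⟨j - 1, ?_⟩)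
      rwa [Nat.sub_add_cancel hj]
  have h1 : 1 ≤ S.coinMeasure {ω | S.Outputs M adv ω M} + ENNReal.ofReal S.δ := by
    rw [← hprob]
    refine (measure_mono hcover).trans ((measure_union_le _ _).trans (add_le_add_right ?_ _))
    refine (measure_iUnion_le _).trans (le_trans (ENNReal.tsum_le_tsum fun j => ?_)
      (tsum_failure_le hS))
    exact coinMeasure_failure_le hS (j + 1) M adv (Nat.le_add_left 1 j)
  rw [ENNReal.ofReal_sub _ hS.δ_pos.le, ENNReal.ofReal_one]
  exact tsub_le_iff_right.2 h1

end Setup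

end UnknownNoise

open UnknownNoise in
theorem theorem3p1 :
    Nonempty FingerprintScheme ∧ Nonempty AMDCode ∧ Nonempty ErrorCorrectingCode ∧
    ∀ (F : FingerprintScheme) (A : AMDCode) (E : ErrorCorrectingCode),
      ∃ K : ℝ, 0 < K ∧
        ∀ (L : ℕ), 2 ≤ L → ∀ (δ : ℝ), 0 < δ → δ < 1 →
        ∀ (conv : Conventions L) (M : Bits L) (adv : Adversary),
          let S : Setup := ⟨F, A, E, L, δ, conv⟩
          ENNReal.ofReal (1 - δ) ≤ S.coinMeasure {ω | S.Outputs M adv ω M} ∧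
          ∀ (ω : S.Coins) (M' : Bits L), S.Outputs M adv ω M' →
            ∃ n : ℕ, S.cost M adv ω = n ∧
              (n : ℝ) ≤ L + K * (S.T M adv ω +
                min ((S.T M adv ω : ℝ) + 1) (L / clog2 L) * clog2 (L / δ)) := by
  refine ⟨FingerprintScheme.nonempty, AMDCode.nonempty, ErrorCorrectingCode.nonempty, ?_⟩
  intro F A E
  obtain ⟨c⟩ := Conventions.nonempty le_rfl
  -- The constant does not depend on the length, the error parameter and the conventions.
  refine ⟨Setup.costConst ⟨F, A, E, 2, 1, c⟩, ?_, fun L hL δ h0 h1 conv M adv => ?_⟩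
  · have := Setup.threshold_pos (S := ⟨F, A, E, 2, 1, c⟩)
    rw [Setup.costConst]
    positivity
  · have hS : Setup.Valid ⟨F, A, E, L, δ, conv⟩ := ⟨hL, h0, h1⟩
    exact ⟨Setup.le_coinMeasure_outputs hS M adv, fun ω M' h => Setup.cost_le hS h⟩
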